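/- Manifolds are smooth, Hausdorff and second countable. A smooth groupoid $\mathcal G$ has manifolds $\mathcal G_0$ of objects and $\mathcal G_1$ of arrows, smooth structure maps, and submersive source and target maps $s,t$; it is an orbifold groupoid if $s$ is a local diffeomorphism and $(s,t):\mathcal G_1\to\mathcal G_0\times\mathcal G_0$ is proper. Let $\mathcal G_{\mathrm{top}}=\mathcal G_0/\mathcal G$ be its topological quotient; $\mathcal G$ is connected if $\mathcal G_{\mathrm{top}}$ is. An arrow $g:x\to x$ is ineffective if the germ at $x$ of the diffeomorphism $t\circ (s|_U)^{-1}$ ($U$ a small neighbourhood of $g$) is the germ of the identity; the ineffective arrows form a local system of groups $S^0_{\mathcal G}\to\mathcal G_0$ with fibres $S^0_{\mathcal G}(x)$. An orbifold groupoid is purely ineffective if all its stabilizer arrows are ineffective; it has trivial abelian band $A$ if $S^0_{\mathcal G}$ is $\mathcal G$-equivariantly isomorphic (for conjugation) to the constant local system $\mathcal G_0\times A$. For a Lie group $K$ acting smoothly on the right of $\mathcal H$ by groupoid automorphisms, the quotient $\mathcal H/K$ is represented by the semidirect product $\mathcal H\rtimes K$, with objects $\mathcal H_0$, arrows $\mathcal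 H_1\times K$, $s(g,k)=s(g)\cdot k$, $t(g,k)=t(g)$ and $(g,k)(g',k')=(g\,(g'\cdot k^{-1}),kk')$. Groupoids are equivalent ($\cong$) if there is a Hilsum–Skandalis equivalence between them, i.e. a manifold with commuting left and right actions of the two groupoids such that each base map is a principal bundle for the action of the other groupoid. Theorem. Let $\mathcal G$ be a connected orbifold groupoid of dimension $n$, let $x\in\mathcal G_0$ and let $T=S^0_{\mathcal G}(x)$ be its ineffective stabilizer. Then there are a purely ineffective orbifold groupoid $\mathcal H$, a compact Lie group $K$ and a smooth right action of $K$ on $\mathcal H$ such that $$\mathcal G\;\cong\;\mathcal H/K=\mathcal H\rtimes K ,$$ $\mathcal H$ has trivial abelian band $A$ for a finite abelian group $A\cong Z(T)$, and every stabilizer group of $\mathcal H$ is isomorphic to the centre $Z(T)$. Moreover $\mathcal H$ is a manifold together with a gerbe on it: $P=\mathcal H_{\mathrm{top}}$ is a smooth manifold, $\mathcal H_0\to P$ is a local diffeomorphism, and the presheaf of groupoids on $P$ that sends an open $U$ to the smooth sections of $\mathcal H_0\to P$ over $U$, with the smooth maps $U\to\mathcal H_1$ between them as arrows, is locally non-empty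 with any two objects locally isomorphic (so that its associated stack is a gerbe on $P$). -/

import Mathlib

open scoped Manifold ContDiff Topology

universe u

/-- A smooth manifold of dimension `n` (without boundary): Hausdorff, second countable, with a
`C^∞` atlas modelled on Euclidean `n`-space. -/
class IsSmoothMfd (n : ℕ) (M : Type*) [TopologicalSpace M]
    [ChartedSpace (EuclideanSpace ℝ (Fin n)) M] : Prop
    extends IsManifold (𝓡 n) ∞ M, T2Space M, SecondCountableTopology M

section Groupoids

variable {E₀ : Type*} [NormedAddCommGroup E₀] [NormedSpace ℝ E₀] {B₀ : Type*} [TopologicalSpace B₀]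
  {E₁ : Type*} [NormedAddCommGroup E₁] [NormedSpace ℝ E₁] {B₁ : Type*} [TopologicalSpace B₁]

/-- A smooth submersion: a smooth map whose differential is surjective at every point. -/
structure IsSmoothSubmersion (I₀ : ModelWithCorners ℝ E₀ B₀) (I₁ : ModelWithCorners ℝ E₁ B₁)
    {M N : Type*} [TopologicalSpace M] [ChartedSpace B₀ M] [TopologicalSpace N] [ChartedSpace B₁ N]
    (f : M → N) : Prop where
  smooth : ContMDiff I₀ I₁ ∞ f
  surjective_mfderiv : ∀ x, Function.Surjective (mfderiv I₀ I₁ f x)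

/-- A smooth groupoid with manifold of objects `G₀` and manifold of arrows `G₁`.
An arrow `g` goes from `src g` to `tgt g`; the product `comp g h` ("first `h`, then `g`") is
meaningful when `src g = tgt h`, and its values for other pairs play no role. Smoothness of the
product is smoothness on the submanifold of composable pairs. -/
structure SmoothGroupoid (I₀ : ModelWithCorners ℝ E₀ B₀) (I₁ : ModelWithCorners ℝ E₁ B₁)
    (G₀ G₁ : Type*) [TopologicalSpace G₀] [ChartedSpace B₀ G₀]
    [TopologicalSpace G₁] [ChartedSpace B₁ G₁] where
  src : G₁ → G₀
  tgt : G₁ → G₀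
  unit : G₀ → G₁
  inv : G₁ → G₁
  comp : G₁ → G₁ → G₁
  src_submersion : IsSmoothSubmersion I₁ I₀ src
  tgt_smooth : ContMDiff I₁ I₀ ∞ tgt
  unit_smooth : ContMDiff I₀ I₁ ∞ unit
  inv_smooth : ContMDiff I₁ I₁ ∞ inv
  comp_smooth : ContMDiffOn (I₁.prod I₁) I₁ ∞ (fun p : G₁ × G₁ => comp p.1 p.2)
    {p | src p.1 = tgt p.2}
  src_unit : ∀ x, src (unit x) = x
  tgt_unit : ∀ x, tgt (unit x) = x
  src_inv : ∀ g, src (inv g) = tgt g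
  tgt_inv : ∀ g, tgt (inv g) = src g
  src_comp : ∀ g h, src g = tgt h → src (comp g h) = src h
  tgt_comp : ∀ g h, src g = tgt h → tgt (comp g h) = tgt g
  assoc : ∀ g h k, src g = tgt h → src h = tgt k → comp g (comp h k) = comp (comp g h) k
  comp_unit : ∀ g, comp g (unit (src g)) = g
  unit_comp : ∀ g, comp (unit (tgt g)) g = g
  inv_comp : ∀ g, comp (inv g) g = unit (src g)
  comp_inv : ∀ g, comp g (inv g) = unit (tgt g)

namespace SmoothGroupoid

variable {I₀ : ModelWithCorners ℝ E₀ B₀} {I₁ : ModelWithCorners ℝ E₁ B₁}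
  {G₀ G₁ : Type*} [TopologicalSpace G₀] [ChartedSpace B₀ G₀]
  [TopologicalSpace G₁] [ChartedSpace B₁ G₁]

/-- The groupoid is étale: the source map (hence the target map) is a local diffeomorphism. -/
def IsEtale (G : SmoothGroupoid I₀ I₁ G₀ G₁) : Prop :=
  IsLocalDiffeomorph I₁ I₀ ∞ G.src

/-- An orbifold groupoid: étale and proper. -/
structure IsOrbifold (G : SmoothGroupoid I₀ I₁ G₀ G₁) : Prop where
  etale : G.IsEtale
  proper : IsProperMap (fun g : G₁ => (G.src g, G.tgt g))

/-- Two objects are equivalent when there is an arrow from the first to the second. -/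
def orbitRel (G : SmoothGroupoid I₀ I₁ G₀ G₁) : Setoid G₀ where
  r x y := ∃ g, G.src g = x ∧ G.tgt g = y
  iseqv :=
    { refl := fun x => ⟨G.unit x, G.src_unit x, G.tgt_unit x⟩
      symm := by
        rintro x y ⟨g, rfl, rfl⟩
        exact ⟨G.inv g, G.src_inv g, G.tgt_inv g⟩
      trans := by
        rintro x y z ⟨g, rfl, rfl⟩ ⟨h, hs, rfl⟩
        exact ⟨G.comp h g, G.src_comp h g hs, G.tgt_comp h g hs⟩ }

/-- The topological (coarse) quotient, with the quotient topology. -/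
abbrev Coarse (G : SmoothGroupoid I₀ I₁ G₀ G₁) : Type _ := Quotient G.orbitRel

/-- The projection of the objects onto the coarse quotient. -/
def proj (G : SmoothGroupoid I₀ I₁ G₀ G₁) (x : G₀) : G.Coarse := Quotient.mk G.orbitRel x

/-- The stabilizer of `x`: the arrows from `x` to `x`. -/
def Stab (G : SmoothGroupoid I₀ I₁ G₀ G₁) (x : G₀) : Type _ :=
  {g : G₁ // G.src g = x ∧ G.tgt g = x}

/-- The stabilizer of `x` is a group under composition. -/
instance (G : SmoothGroupoid I₀ I₁ G₀ G₁) (x : G₀) : Group (G.Stab x) where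
  mul g h := ⟨G.comp g.1 h.1,
    (G.src_comp _ _ (g.2.1.trans h.2.2.symm)).trans h.2.1,
    (G.tgt_comp _ _ (g.2.1.trans h.2.2.symm)).trans g.2.2⟩
  one := ⟨G.unit x, G.src_unit x, G.tgt_unit x⟩
  inv g := ⟨G.inv g.1, (G.src_inv _).trans g.2.2, (G.tgt_inv _).trans g.2.1⟩
  mul_assoc g h k := Subtype.ext
    (G.assoc _ _ _ (g.2.1.trans h.2.2.symm) (h.2.1.trans k.2.2.symm)).symm
  one_mul g := Subtype.ext (by
    have := G.unit_comp g.1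
    rw [g.2.2] at this
    exact this)
  mul_one g := Subtype.ext (by
    have := G.comp_unit g.1
    rw [g.2.1] at this
    exact this)
  inv_mul_cancel g := Subtype.ext (by
    have := G.inv_comp g.1
    rw [g.2.1] at this
    exact this)

/-- The arrow `g` lies over the trivial germ: with `σ` the local section of the source map through
`g` (for an étale groupoid, the local inverse of the source map at `g`, which is unique as a germ),
the germ `φ_g = tgt ∘ σ` induced by `g` is the germ of the identity at `src g`.
In particular `g` is a stabilizer arrow. -/
def IsIneffective (G : SmoothGroupoid I₀ I₁ G₀ G₁) (g : G₁) : Prop :=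
  ∃ σ : G₀ → G₁, σ (G.src g) = g ∧ ContinuousAt σ (G.src g) ∧
    (∀ᶠ y in 𝓝 (G.src g), G.src (σ y) = y) ∧ ∀ᶠ y in 𝓝 (G.src g), G.tgt (σ y) = y

/-- The group of ineffective stabilizers at `x`. -/
def IneffStab (G : SmoothGroupoid I₀ I₁ G₀ G₁) (x : G₀) : Subgroup (G.Stab x) where
  carrier := {g | G.IsIneffective g.1}
  one_mem' := by
    change G.IsIneffective (G.unit x)
    refine ⟨G.unit, by rw [G.src_unit], G.unit_smooth.continuous.continuousAt,
      Filter.Eventually.of_forall G.src_unit, Filter.Eventually.of_forall G.tgt_unit⟩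
  mul_mem' := by
    rintro ⟨g, hg, hg'⟩ ⟨h, hh, hh'⟩ ⟨σ, σ1, σ2, σ3, σ4⟩ ⟨τ, τ1, τ2, τ3, τ4⟩
    have hgh : G.src g = G.tgt h := hg.trans hh'.symm
    have hx : G.src (G.comp g h) = x := (G.src_comp g h hgh).trans hh
    simp only at σ1 σ2 σ3 σ4 τ1 τ2 τ3 τ4
    rw [hg] at σ1 σ2 σ3 σ4
    rw [hh] at τ1 τ2 τ3 τ4
    change G.IsIneffective (G.comp g h)
    have hc : ∀ᶠ y in 𝓝 x, (σ y, τ y) ∈ {p : G₁ × G₁ | G.src p.1 = G.tgt p.2} := by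
      filter_upwards [σ3, τ4] with y h1 h2 using h1.trans h2.symm
    refine ⟨fun y => G.comp (σ y) (τ y), ?_, ?_, ?_, ?_⟩
    · simp only [hx, σ1, τ1]
    · rw [hx]
      have h1 := G.comp_smooth.continuousOn (σ x, τ x) (by
        rw [σ1, τ1]; exact hgh)
      exact h1.tendsto.comp (tendsto_nhdsWithin_iff.2 ⟨σ2.prodMk_nhds τ2, hc⟩)
    · rw [hx]
      filter_upwards [hc, τ3] with y h1 h2 using (G.src_comp _ _ h1).trans h2
    · rw [hx]
      filter_upwards [hc, σ4] with y h1 h2 using (G.tgt_comp _ _ h1).trans h2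
  inv_mem' := by
    rintro ⟨g, hg, hg'⟩ ⟨σ, σ1, σ2, σ3, σ4⟩
    have hx : G.src (G.inv g) = x := (G.src_inv g).trans hg'
    simp only at σ1 σ2 σ3 σ4
    rw [hg] at σ1 σ2 σ3 σ4
    change G.IsIneffective (G.inv g)
    refine ⟨fun y => G.inv (σ y), ?_, ?_, ?_, ?_⟩
    · simp only [hx, σ1]
    · rw [hx]
      exact G.inv_smooth.continuous.continuousAt.comp σ2
    · rw [hx]
      filter_upwards [σ4] with y h1 using (G.src_inv _).trans h1
    · rw [hx]
      filter_upwards [σ3] with y h1 using (G.tgt_inv _).trans h1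

/-- Purely ineffective: every stabilizer arrow induces the germ of the identity. -/
def IsPurelyIneffective (G : SmoothGroupoid I₀ I₁ G₀ G₁) : Prop :=
  ∀ g, G.src g = G.tgt g → G.IsIneffective g

/-- The groupoid `G` is a smooth manifold together with a gerbe on it: the coarse quotient `P` is
a smooth manifold (for the quotient topology), the projection `G₀ → P` is étale, and the
presheaf of groupoids on `P` which sends an open `U` to the groupoid of smooth sections of
`G₀ → P` over `U` (objects) and smooth maps `U → G₁` (arrows between sections) is locally
non-empty, and any two of its objects over `U` are locally isomorphic. The last two conditions
say that the stack associated with this presheaf of groupoids is a gerbe on `P`. -/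
def IsManifoldWithGerbe {n : ℕ} {G₀ G₁ : Type*} [TopologicalSpace G₀]
    [ChartedSpace (EuclideanSpace ℝ (Fin n)) G₀] [TopologicalSpace G₁]
    [ChartedSpace (EuclideanSpace ℝ (Fin n)) G₁] (G : SmoothGroupoid (𝓡 n) (𝓡 n) G₀ G₁) : Prop :=
  ∃ _ : ChartedSpace (EuclideanSpace ℝ (Fin n)) G.Coarse,
    IsSmoothMfd n G.Coarse ∧
    IsLocalDiffeomorph (𝓡 n) (𝓡 n) ∞ G.proj ∧
    (∀ p : G.Coarse, ∃ (U : Set G.Coarse) (σ : G.Coarse → G₀), IsOpen U ∧ p ∈ U ∧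
      ContMDiffOn (𝓡 n) (𝓡 n) ∞ σ U ∧ ∀ q ∈ U, G.proj (σ q) = q) ∧
    (∀ (U : Set G.Coarse) (σ τ : G.Coarse → G₀), IsOpen U →
      ContMDiffOn (𝓡 n) (𝓡 n) ∞ σ U → (∀ q ∈ U, G.proj (σ q) = q) →
      ContMDiffOn (𝓡 n) (𝓡 n) ∞ τ U → (∀ q ∈ U, G.proj (τ q) = q) →
      ∀ p ∈ U, ∃ (V : Set G.Coarse) (γ : G.Coarse → G₁), IsOpen V ∧ p ∈ V ∧ V ⊆ U ∧
        ContMDiffOn (𝓡 n) (𝓡 n) ∞ γ V ∧ ∀ q ∈ V, G.src (γ q) = σ q ∧ G.tgt (γ q) = τ q)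

/-- For an abelian group `A`, a `G`-equivariant isomorphism `c` from the constant local system `G₀ × A` to the local system
of ineffective stabilizers: `c x` is a group isomorphism from `A` onto the ineffective
stabilizers at `x`, `c` and its inverse are smooth (`A` being discrete, the `A`-component of the
inverse has to be locally constant), and conjugation by `g : x ⟶ y` takes `c x a` to `c y a`. -/
structure BandTrivialization (G : SmoothGroupoid I₀ I₁ G₀ G₁) (A : Type*) [CommGroup A] where
  toFun : G₀ → A → G₁
  src_toFun : ∀ x a, G.src (toFun x a) = x
  tgt_toFun : ∀ x a, G.tgt (toFun x a) = x
  ineffective : ∀ x a, G.IsIneffective (toFun x a)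
  map_mul : ∀ x a b, toFun x (a * b) = G.comp (toFun x a) (toFun x b)
  bijective : ∀ g, G.IsIneffective g → ∃! a, toFun (G.src g) a = g
  smooth : ∀ a, ContMDiff I₀ I₁ ∞ (fun x => toFun x a)
  inverse_smooth : ∀ x a, ∀ᶠ g in 𝓝 (toFun x a), G.IsIneffective g → toFun (G.src g) a = g
  equivariant : ∀ g a, G.comp (G.comp g (toFun (G.src g) a)) (G.inv g) = toFun (G.tgt g) a

/-- The band of `G` is trivial with abelian fibre `A`: the stabilizer local system of `G` is
`G`-equivariantly isomorphic to `G₀ × A`. -/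
def HasTrivialBand (G : SmoothGroupoid I₀ I₁ G₀ G₁) (A : Type*) [CommGroup A] : Prop :=
  Nonempty (G.BandTrivialization A)

section Action

variable {EK : Type*} [NormedAddCommGroup EK] [NormedSpace ℝ EK] {BK : Type*} [TopologicalSpace BK]

/-- A (strict) smooth right action of a Lie group `K` on a smooth groupoid `G`. -/
structure GroupAction (G : SmoothGroupoid I₀ I₁ G₀ G₁) (IK : ModelWithCorners ℝ EK BK)
    (K : Type*) [Group K] [TopologicalSpace K] [ChartedSpace BK K] where
  act₀ : G₀ → K → G₀
  act₁ : G₁ → K → G₁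
  act₀_smooth : ContMDiff (I₀.prod IK) I₀ ∞ (fun p : G₀ × K => act₀ p.1 p.2)
  act₁_smooth : ContMDiff (I₁.prod IK) I₁ ∞ (fun p : G₁ × K => act₁ p.1 p.2)
  act₀_one : ∀ x, act₀ x 1 = x
  act₁_one : ∀ g, act₁ g 1 = g
  act₀_mul : ∀ x k l, act₀ x (k * l) = act₀ (act₀ x k) l
  act₁_mul : ∀ g k l, act₁ g (k * l) = act₁ (act₁ g k) l
  act_unit : ∀ x k, act₁ (G.unit x) k = G.unit (act₀ x k)
  src_act : ∀ g k, G.src (act₁ g k) = act₀ (G.src g) k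
  tgt_act : ∀ g k, G.tgt (act₁ g k) = act₀ (G.tgt g) k
  comp_act : ∀ g h k, G.src g = G.tgt h →
    act₁ (G.comp g h) k = G.comp (act₁ g k) (act₁ h k)

namespace GroupAction

variable {G : SmoothGroupoid I₀ I₁ G₀ G₁} {IK : ModelWithCorners ℝ EK BK}
  {K : Type*} [Group K] [TopologicalSpace K] [ChartedSpace BK K]

theorem act₀_inv_act₀ (α : GroupAction G IK K) (x : G₀) (k : K) :
    α.act₀ (α.act₀ x k) k⁻¹ = x := by
  rw [← α.act₀_mul, mul_inv_cancel, α.act₀_one]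

theorem act₁_inv_act₁ (α : GroupAction G IK K) (g : G₁) (k : K) :
    α.act₁ (α.act₁ g k) k⁻¹ = g := by
  rw [← α.act₁_mul, mul_inv_cancel, α.act₁_one]

theorem act₁_act₁_inv (α : GroupAction G IK K) (g : G₁) (k : K) :
    α.act₁ (α.act₁ g k⁻¹) k = g := by
  rw [← α.act₁_mul, inv_mul_cancel, α.act₁_one]

theorem act₀_act₀_inv (α : GroupAction G IK K) (x : G₀) (k : K) :
    α.act₀ (α.act₀ x k⁻¹) k = x := by
  rw [← α.act₀_mul, inv_mul_cancel, α.act₀_one]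

theorem act₀_slice_smooth (α : GroupAction G IK K) (k : K) :
    ContMDiff I₀ I₀ ∞ (fun x => α.act₀ x k) :=
  α.act₀_smooth.comp (contMDiff_id.prodMk contMDiff_const)

theorem surjective_mfderiv_act₀ (α : GroupAction G IK K) (k : K) (x : G₀) :
    Function.Surjective (mfderiv I₀ I₀ (fun y => α.act₀ y k) x) := by
  have h1 : MDifferentiableAt I₀ I₀ (fun y => α.act₀ y k⁻¹) (α.act₀ x k) :=
    (α.act₀_slice_smooth k⁻¹).mdifferentiableAt (by simp)
  have h2 : ∀ z, MDifferentiableAt I₀ I₀ (fun y => α.act₀ y k) z := fun z =>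
    (α.act₀_slice_smooth k).mdifferentiableAt (by simp)
  have h3 := mfderiv_comp (α.act₀ x k) (h2 _) h1
  have h4 : ((fun y => α.act₀ y k) ∘ fun y => α.act₀ y k⁻¹) = id := by
    funext y
    exact α.act₀_act₀_inv y k
  rw [h4, mfderiv_id, α.act₀_inv_act₀] at h3
  intro v
  exact ⟨_, (DFunLike.congr_fun h3 v).symm⟩

theorem comp_condition (α : GroupAction G IK K) {g g' : G₁} {k : K}
    (h : α.act₀ (G.src g) k = G.tgt g') : G.src g = G.tgt (α.act₁ g' k⁻¹) := by
  rw [α.tgt_act, ← h, α.act₀_inv_act₀]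

end GroupAction

/-- The semidirect product `G ⋊ K`, the model of the quotient `G/K`: objects `G₀`, arrows
`G₁ × K`, with `s(g,k) = s(g)·k`, `t(g,k) = t(g)`, `(g,k)(g',k') = (g (g'·k⁻¹), kk')`. -/
def semidirect (G : SmoothGroupoid I₀ I₁ G₀ G₁) {IK : ModelWithCorners ℝ EK BK}
    {K : Type*} [Group K] [TopologicalSpace K] [ChartedSpace BK K] [LieGroup IK ∞ K]
    (α : GroupAction G IK K) : SmoothGroupoid I₀ (I₁.prod IK) G₀ (G₁ × K) where
  src p := α.act₀ (G.src p.1) p.2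
  tgt p := G.tgt p.1
  unit x := (G.unit x, 1)
  inv p := (α.act₁ (G.inv p.1) p.2, p.2⁻¹)
  comp p q := (G.comp p.1 (α.act₁ q.1 p.2⁻¹), p.2 * q.2)
  src_submersion := by
    have hs : ContMDiff (I₁.prod IK) I₀ ∞ (fun p : G₁ × K => α.act₀ (G.src p.1) p.2) :=
      α.act₀_smooth.comp ((G.src_submersion.smooth.comp contMDiff_fst).prodMk contMDiff_snd)
    refine ⟨hs, ?_⟩
    rintro ⟨g, k⟩
    have h1 : MDifferentiableAt I₁ (I₁.prod IK) (fun h : G₁ => (h, k)) g :=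
      (contMDiff_id.prodMk contMDiff_const : ContMDiff I₁ (I₁.prod IK) ∞
        (fun h : G₁ => (h, k))).mdifferentiableAt (by simp)
    have h2 : MDifferentiableAt (I₁.prod IK) I₀ (fun p : G₁ × K => α.act₀ (G.src p.1) p.2) (g, k) :=
      hs.mdifferentiableAt (by simp)
    have h3 := mfderiv_comp g h2 h1
    have h4 := mfderiv_comp g
      ((α.act₀_slice_smooth k).mdifferentiableAt (by simp) (x := G.src g))
      (G.src_submersion.smooth.mdifferentiableAt (by simp))
    intro v
    obtain ⟨w, hw⟩ := α.surjective_mfderiv_act₀ k (G.src g) v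
    obtain ⟨z, hz⟩ := G.src_submersion.surjective_mfderiv g w
    have h5 := DFunLike.congr_fun (h3.symm.trans h4) z
    refine ⟨_, h5.trans ?_⟩
    change mfderiv I₀ I₀ (fun y => α.act₀ y k) (G.src g) (mfderiv I₁ I₀ G.src g z) = v
    rw [hz, hw]
  tgt_smooth := G.tgt_smooth.comp contMDiff_fst
  unit_smooth := G.unit_smooth.prodMk contMDiff_const
  inv_smooth := (α.act₁_smooth.comp ((G.inv_smooth.comp contMDiff_fst).prodMk contMDiff_snd)).prodMk
    ((contMDiff_inv IK ∞).comp contMDiff_snd)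
  comp_smooth := by
    have hk : ContMDiff ((I₁.prod IK).prod (I₁.prod IK)) I₁ ∞
        (fun p : (G₁ × K) × (G₁ × K) => α.act₁ p.2.1 p.1.2⁻¹) :=
      α.act₁_smooth.comp ((contMDiff_fst.comp contMDiff_snd).prodMk
        ((contMDiff_inv IK ∞).comp (contMDiff_snd.comp contMDiff_fst)))
    have hp : ContMDiff ((I₁.prod IK).prod (I₁.prod IK)) (I₁.prod I₁) ∞
        (fun p : (G₁ × K) × (G₁ × K) => (p.1.1, α.act₁ p.2.1 p.1.2⁻¹)) :=
      (contMDiff_fst.comp contMDiff_fst).prodMk hk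
    have hm : ContMDiff ((I₁.prod IK).prod (I₁.prod IK)) IK ∞
        (fun p : (G₁ × K) × (G₁ × K) => p.1.2 * p.2.2) :=
      (contMDiff_snd.comp contMDiff_fst).mul (contMDiff_snd.comp contMDiff_snd)
    exact (G.comp_smooth.comp hp.contMDiffOn (fun p hp => α.comp_condition hp)).prodMk
      hm.contMDiffOn
  src_unit x := by simp only [G.src_unit, α.act₀_one]
  tgt_unit x := G.tgt_unit x
  src_inv p := by simp only [α.src_act, G.src_inv, α.act₀_inv_act₀]
  tgt_inv p := by simp only [α.tgt_act, G.tgt_inv]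
  src_comp p q h := by
    simp only
    rw [G.src_comp _ _ (α.comp_condition h), α.src_act, ← α.act₀_mul, inv_mul_cancel_left]
  tgt_comp p q h := G.tgt_comp _ _ (α.comp_condition h)
  assoc p q r h h' := by
    have h1 := α.comp_condition h
    have h2 := α.comp_condition h'
    refine Prod.ext ?_ (mul_assoc _ _ _).symm
    simp only
    rw [α.comp_act _ _ _ h2, ← α.act₁_mul, ← mul_inv_rev]
    refine G.assoc _ _ _ h1 ?_
    rw [α.src_act, h2, mul_inv_rev, α.act₁_mul, ← α.tgt_act]
  comp_unit p := by
    rw [α.act_unit, α.act₀_inv_act₀, G.comp_unit, mul_one]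
  unit_comp p := by
    simp only [inv_one, α.act₁_one, G.unit_comp, one_mul]
  inv_comp p := by
    simp only
    rw [inv_inv, ← α.comp_act _ _ _ (G.src_inv _), G.inv_comp, α.act_unit, inv_mul_cancel]
  comp_inv p := by
    simp only [α.act₁_inv_act₁, G.comp_inv, mul_inv_cancel]

end Action

section Bundles

variable {EX : Type*} [NormedAddCommGroup EX] [NormedSpace ℝ EX] {BX : Type*} [TopologicalSpace BX]
  {EB : Type*} [NormedAddCommGroup EB] [NormedSpace ℝ EB] {BB : Type*} [TopologicalSpace BB]

/-- A smooth left action of `G` on a manifold `X` with base map `base`; `act g x` is meaningful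
when `src g = base x`. -/
structure LeftAction (G : SmoothGroupoid I₀ I₁ G₀ G₁) (J : ModelWithCorners ℝ EX BX)
    (X : Type*) [TopologicalSpace X] [ChartedSpace BX X] where
  base : X → G₀
  act : G₁ → X → X
  base_smooth : ContMDiff J I₀ ∞ base
  act_smooth : ContMDiffOn (I₁.prod J) J ∞ (fun p : G₁ × X => act p.1 p.2)
    {p | G.src p.1 = base p.2}
  base_act : ∀ g x, G.src g = base x → base (act g x) = G.tgt g
  unit_act : ∀ x, act (G.unit (base x)) x = x
  comp_act : ∀ g h x, G.src h = base x → G.src g = G.tgt h →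
    act g (act h x) = act (G.comp g h) x

/-- A smooth right action of `G` on a manifold `X` with base map `base`; `act x g` is meaningful
when `base x = tgt g`. -/
structure RightAction (G : SmoothGroupoid I₀ I₁ G₀ G₁) (J : ModelWithCorners ℝ EX BX)
    (X : Type*) [TopologicalSpace X] [ChartedSpace BX X] where
  base : X → G₀
  act : X → G₁ → X
  base_smooth : ContMDiff J I₀ ∞ base
  act_smooth : ContMDiffOn (J.prod I₁) J ∞ (fun p : X × G₁ => act p.1 p.2)
    {p | base p.1 = G.tgt p.2}
  base_act : ∀ x g, base x = G.tgt g → base (act x g) = G.src g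
  act_unit : ∀ x, act x (G.unit (base x)) = x
  act_comp : ∀ x g h, base x = G.tgt g → G.src g = G.tgt h →
    act (act x g) h = act x (G.comp g h)

variable {J : ModelWithCorners ℝ EX BX} {X : Type*} [TopologicalSpace X] [ChartedSpace BX X]

/-- The map `p : X → B` is a principal bundle for the left action: `p` is an invariant surjective
submersion and `(g, x) ↦ (g x, x)` is a diffeomorphism from the pairs with `src g = base x` onto
`X ×_B X`. The last condition is expressed by the smooth map `(y, x) ↦ div y x`, the arrow
component of the inverse. -/
structure LeftAction.IsPrincipal {G : SmoothGroupoid I₀ I₁ G₀ G₁} (L : LeftAction G J X)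
    (JB : ModelWithCorners ℝ EB BB) {B : Type*} [TopologicalSpace B] [ChartedSpace BB B]
    (p : X → B) : Prop where
  submersion : IsSmoothSubmersion J JB p
  surjective : Function.Surjective p
  invariant : ∀ g x, G.src g = L.base x → p (L.act g x) = p x
  exists_div : ∃ div : X → X → G₁,
    ContMDiffOn (J.prod J) I₁ ∞ (fun q : X × X => div q.1 q.2) {q | p q.1 = p q.2} ∧
    (∀ y x, p y = p x → G.src (div y x) = L.base x ∧ L.act (div y x) x = y) ∧
    ∀ g x, G.src g = L.base x → div (L.act g x) x = g

/-- The map `p : X → B` is a principal bundle for the right action: `p` is an invariant surjective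
submersion and `(x, g) ↦ (x, x g)` is a diffeomorphism from the pairs with `base x = tgt g` onto
`X ×_B X`. The last condition is expressed by the smooth map `(x, y) ↦ div x y`, the arrow
component of the inverse. -/
structure RightAction.IsPrincipal {G : SmoothGroupoid I₀ I₁ G₀ G₁} (R : RightAction G J X)
    (JB : ModelWithCorners ℝ EB BB) {B : Type*} [TopologicalSpace B] [ChartedSpace BB B]
    (p : X → B) : Prop where
  submersion : IsSmoothSubmersion J JB p
  surjective : Function.Surjective p
  invariant : ∀ x g, R.base x = G.tgt g → p (R.act x g) = p x
  exists_div : ∃ div : X → X → G₁,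
    ContMDiffOn (J.prod J) I₁ ∞ (fun q : X × X => div q.1 q.2) {q | p q.1 = p q.2} ∧
    (∀ x y, p x = p y → R.base x = G.tgt (div x y) ∧ R.act x (div x y) = y) ∧
    ∀ x g, R.base x = G.tgt g → div x (R.act x g) = g

end Bundles

end SmoothGroupoid

variable {E₂ : Type*} [NormedAddCommGroup E₂] [NormedSpace ℝ E₂] {B₂ : Type*} [TopologicalSpace B₂]
  {E₃ : Type*} [NormedAddCommGroup E₃] [NormedSpace ℝ E₃] {B₃ : Type*} [TopologicalSpace B₃]
  {I₀ : ModelWithCorners ℝ E₀ B₀} {I₁ : ModelWithCorners ℝ E₁ B₁}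
  {I₂ : ModelWithCorners ℝ E₂ B₂} {I₃ : ModelWithCorners ℝ E₃ B₃}

/-- A Hilsum–Skandalis equivalence from `G` to `H` carried by the manifold `P`: commuting smooth
actions of `G` (left) and `H` (right) on `P`, such that the base map of the `G`-action is a
principal `H`-bundle over `G₀` and the base map of the `H`-action is a principal `G`-bundle
over `H₀`. -/
structure HSEquivalence {G₀ G₁ H₀ H₁ : Type*}
    [TopologicalSpace G₀] [ChartedSpace B₀ G₀] [TopologicalSpace G₁] [ChartedSpace B₁ G₁]
    [TopologicalSpace H₀] [ChartedSpace B₂ H₀] [TopologicalSpace H₁] [ChartedSpace B₃ H₁]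
    (G : SmoothGroupoid I₀ I₁ G₀ G₁) (H : SmoothGroupoid I₂ I₃ H₀ H₁)
    (d : ℕ) (P : Type*) [TopologicalSpace P] [ChartedSpace (EuclideanSpace ℝ (Fin d)) P] where
  left : G.LeftAction (𝓡 d) P
  right : H.RightAction (𝓡 d) P
  commute : ∀ g p h, G.src g = left.base p → right.base p = H.tgt h →
    right.act (left.act g p) h = left.act g (right.act p h)
  right_principal : right.IsPrincipal I₀ left.base
  left_principal : left.IsPrincipal I₂ right.base

/-- Two smooth groupoids are equivalent if there is a Hilsum–Skandalis equivalence between them. -/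
def HSEquivalent {G₀ G₁ H₀ H₁ : Type u}
    [TopologicalSpace G₀] [ChartedSpace B₀ G₀] [TopologicalSpace G₁] [ChartedSpace B₁ G₁]
    [TopologicalSpace H₀] [ChartedSpace B₂ H₀] [TopologicalSpace H₁] [ChartedSpace B₃ H₁]
    (G : SmoothGroupoid I₀ I₁ G₀ G₁) (H : SmoothGroupoid I₂ I₃ H₀ H₁) : Prop :=
  ∃ (d : ℕ) (P : Type u) (_ : TopologicalSpace P) (_ : ChartedSpace (EuclideanSpace ℝ (Fin d)) P)
    (_ : IsSmoothMfd d P), Nonempty (HSEquivalence G H d P)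

end Groupoids

/-! The groupoid `H` is a frame bundle. An orbifold groupoid acts on its tangent bundle, through the
differentials of the germs of its arrows and preserving a metric, and it acts by conjugation on the
local system of ineffective stabilizers. Framing both bundles at once gives a principal bundle with
the compact group K = O(n) × Aut(T). An arrow fixes a point of this bundle only if it acts trivially
on both frames, and dividing by K gives back the original groupoid.

To make the frame bundle a product, `G` is pulled back along a countable étale cover π : M → G₀ with
étale coordinates χ : M → ℝⁿ and a trivialization θ of the ineffective stabilizers with one fibre T
(`IsOrbifold.exists_cover`); connectedness makes all these stabilizers isomorphic. Write R for the
arrows of the pullback. Read in χ, the differentials form a smooth cocycle J on R with invertible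
values (`IsOrbifold.exists_jacobian`). Stabilizers are finite, and a germ of finite order with
identity differential is the identity (`eventually_eq_self_of_iterate`), so the stabilizer arrows
killed by J are exactly the ineffective ones. Averaging against a cutoff function gives an invariant
metric (`IsOrbifold.exists_invariant_metric`), and Gram–Schmidt turns J into an orthogonal cocycle
(`IsOrbifold.exists_orthogonal_hom`). Conjugation on θ is a locally constant cocycle with values in
Aut(T) (`IneffTrivOn.exists_conj_hom`). The pair is a smooth homomorphism ρ : R → K. A stabilizer
arrow in its kernel is ineffective and centralizes T, and conversely the central elements of T are
killed; so on each stabilizer the kernel is Z(T).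

Let `H` be the action groupoid of R on M × K through ρ. The stabilizer of (m, a) is the kernel of ρ
on the stabilizer of m, so `H` is purely ineffective. The identification z ↦ θ_m(ψ(a) z) of Z(T)
with it, ψ being the projection K → Aut(T), is twisted by a so as to absorb the conjugation action,
and this makes the band trivial (`hasTrivialBand_actionGroupoid`). Right translation by K acts on
`H`. The arrows of `G` with a lift of their target to M, times K, form a bimodule that exhibits H ⋊
K as equivalent to `G` in one step (`liftEquivalence`).

Finally, in a purely ineffective orbifold groupoid properness forces all arrows between points close
to a given point to be ineffective, hence to have equal ends. The projection to the coarse space is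
therefore a local homeomorphism, the coarse space inherits a smooth structure, and lifting arrows
along the étale source map gives the local isomorphisms of sections
(`IsOrbifold.isManifoldWithGerbe`). -/

set_option linter.unusedSectionVars false

/-! ### Smooth structures transported along local homeomorphisms -/

section ManifoldTools

variable {E : Type*} [NormedAddCommGroup E] [NormedSpace ℝ E] {B : Type*} [TopologicalSpace B]
  {I : ModelWithCorners ℝ E B} {N : Type*} [TopologicalSpace N] [ChartedSpace B N]
  {E' : Type*} [NormedAddCommGroup E'] [NormedSpace ℝ E'] {B' : Type*} [TopologicalSpace B']
  {I' : ModelWithCorners ℝ E' B'} {X : Type*} [TopologicalSpace X] [ChartedSpace B' X]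
  {EZ : Type*} [NormedAddCommGroup EZ] [NormedSpace ℝ EZ] {BZ : Type*} [TopologicalSpace BZ]
  {I'' : ModelWithCorners ℝ EZ BZ} {Z : Type*} [TopologicalSpace Z] [ChartedSpace BZ Z]

/-- A family of open partial homeomorphisms into a manifold, with smooth changes of coordinates and
with sources covering the space, defines a smooth structure for which its members are smooth
together with their inverses. -/
theorem exists_chartedSpace_of_openPartialHomeomorph [IsManifold I ∞ N] {d : ℕ}
    (e : B ≃ₜ EuclideanSpace ℝ (Fin d)) (he : ContMDiff I (𝓡 d) ∞ e)
    (he' : ContMDiff (𝓡 d) I ∞ e.symm) {X : Type*} [TopologicalSpace X] {ι : Type*}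
    (φ : ι → OpenPartialHomeomorph X N) (hφ : ∀ x, ∃ i, x ∈ (φ i).source)
    (hφφ : ∀ i j, ContMDiffOn I I ∞ ((φ i).symm.trans (φ j)) ((φ i).symm.trans (φ j)).source) :
    ∃ _ : ChartedSpace (EuclideanSpace ℝ (Fin d)) X, IsManifold (𝓡 d) ∞ X ∧
      ∀ i, ContMDiffOn (𝓡 d) I ∞ (φ i) (φ i).source ∧
        ContMDiffOn I (𝓡 d) ∞ (φ i).symm (φ i).target := by
  choose ix hix using hφ
  let c : ι → N → OpenPartialHomeomorph X (EuclideanSpace ℝ (Fin d)) := fun i z =>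
    ((φ i).trans (chartAt B z)).trans e.toOpenPartialHomeomorph
  -- The atlas consists of all composites of a `φ i`, a chart of `N` and `e`; the last factor only
  -- changes the model space `B` into Euclidean space.
  let cs : ChartedSpace (EuclideanSpace ℝ (Fin d)) X :=
    { atlas := Set.range fun p : ι × N => c p.1 p.2
      chartAt := fun x => c (ix x) (φ (ix x) x)
      mem_chart_source := fun x => by
        simp [c, hix]
      chart_mem_atlas := fun x => ⟨(ix x, φ (ix x) x), rfl⟩ }
  have hm : IsManifold (𝓡 d) ∞ X := by
    apply isManifold_of_contDiffOn
    rintro _ _ ⟨⟨i, z⟩, rfl⟩ ⟨⟨j, w⟩, rfl⟩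
    simp only [modelWithCornersSelf_coe, modelWithCornersSelf_coe_symm, Function.comp_id,
      Function.id_comp, Set.preimage_id, Set.range_id, Set.inter_univ]
    rw [← contMDiffOn_iff_contDiffOn]
    have h : ContMDiffOn (𝓡 d) (𝓡 d) ∞
        (e ∘ chartAt B w ∘ ((φ i).symm.trans (φ j)) ∘ (chartAt B z).symm ∘ e.symm)
        ((c i z).symm.trans (c j w)).source := by
      refine he.comp_contMDiffOn ?_
      refine (contMDiffOn_chart (I := I) (x := w)).comp ?_ ?_
      · refine (hφφ i j).comp ?_ ?_
        · refine (contMDiffOn_chart_symm (I := I) (x := z)).comp he'.contMDiffOn ?_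
          intro y hy
          simp [c] at hy
          simp [hy]
        · intro y hy
          simp [c] at hy
          simp [hy]
      · intro y hy
        simp [c] at hy
        simp [hy]
    exact h
  refine ⟨cs, hm, fun i => ⟨?_, ?_⟩⟩
  · intro x hx
    apply ContMDiffAt.contMDiffWithinAt
    have h1 := contMDiffOn_chart (I := 𝓡 d) (n := ∞) (x := x)
    have hsrc : (chartAt (EuclideanSpace ℝ (Fin d)) x).source =
        (φ (ix x)).source ∩ φ (ix x) ⁻¹' (chartAt B (φ (ix x) x)).source := by
      change (c _ _).source = _
      simp [c]
    have h : ContMDiffOn (𝓡 d) I ∞ (((φ (ix x)).symm.trans (φ i)) ∘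
        (chartAt B (φ (ix x) x)).symm ∘ e.symm ∘ chartAt (EuclideanSpace ℝ (Fin d)) x)
        ((chartAt (EuclideanSpace ℝ (Fin d)) x).source ∩ (φ i).source) := by
      refine (hφφ _ _).comp ((contMDiffOn_chart_symm (I := I)).comp (he'.comp_contMDiffOn
        (h1.mono Set.inter_subset_left)) ?_) ?_
      · intro y hy
        rw [hsrc] at hy
        have h2 := (chartAt B (φ (ix x) x)).map_source hy.1.2
        change e.symm (e (chartAt B (φ (ix x) x) (φ (ix x) y))) ∈ (chartAt B (φ (ix x) x)).target
        rwa [e.symm_apply_apply]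
      · intro y hy
        rw [hsrc] at hy
        change (chartAt B (φ (ix x) x)).symm (e.symm (e (chartAt B (φ (ix x) x) (φ (ix x) y)))) ∈
          ((φ (ix x)).symm.trans (φ i)).source
        rw [e.symm_apply_apply, (chartAt B (φ (ix x) x)).left_inv hy.1.2]
        simp [hy.1.1, hy.2]
    refine (h.contMDiffAt (((chartAt (EuclideanSpace ℝ (Fin d)) x).open_source.inter (φ i).open_source).mem_nhds
      ⟨mem_chart_source (EuclideanSpace ℝ (Fin d)) x, hx⟩)).congr_of_eventuallyEq ?_
    filter_upwards [((chartAt (EuclideanSpace ℝ (Fin d)) x).open_source.inter (φ i).open_source).mem_nhds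
      ⟨mem_chart_source (EuclideanSpace ℝ (Fin d)) x, hx⟩] with y hy
    rw [hsrc] at hy
    change _ = φ i ((φ (ix x)).symm ((chartAt B (φ (ix x) x)).symm
      (e.symm (e (chartAt B (φ (ix x) x) (φ (ix x) y))))))
    rw [e.symm_apply_apply, (chartAt B (φ (ix x) x)).left_inv hy.1.2, (φ (ix x)).left_inv hy.1.1]
  · intro z hz
    apply ContMDiffAt.contMDiffWithinAt
    set x := (φ i).symm z with hxz
    have hxs : x ∈ (φ i).source := (φ i).map_target hz
    have h1 := contMDiffOn_chart_symm (I := 𝓡 d) (n := ∞) (x := x)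
    have hsrc : (chartAt (EuclideanSpace ℝ (Fin d)) x).source =
        (φ (ix x)).source ∩ φ (ix x) ⁻¹' (chartAt B (φ (ix x) x)).source := by
      change (c _ _).source = _
      simp [c]
    set s : Set N := (φ i).target ∩ (φ i).symm ⁻¹' (chartAt (EuclideanSpace ℝ (Fin d)) x).source
    have hs : s ∈ 𝓝 z := ((φ i).isOpen_inter_preimage_symm (chartAt _ x).open_source).mem_nhds
      ⟨hz, mem_chart_source (EuclideanSpace ℝ (Fin d)) x⟩
    have hev : Set.EqOn (φ i).symm ((chartAt (EuclideanSpace ℝ (Fin d)) x).symm ∘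
        e ∘ chartAt B (φ (ix x) x) ∘ ((φ i).symm.trans (φ (ix x)))) s := by
      intro y hy
      change _ = (chartAt (EuclideanSpace ℝ (Fin d)) x).symm
        (chartAt (EuclideanSpace ℝ (Fin d)) x ((φ i).symm y))
      rw [(chartAt (EuclideanSpace ℝ (Fin d)) x).left_inv hy.2]
    refine ContMDiffOn.contMDiffAt (s := s) (ContMDiffOn.congr ?_ hev) hs
    refine h1.comp (he.comp_contMDiffOn ((contMDiffOn_chart (I := I)).comp ((hφφ _ _).mono ?_) ?_))
      ?_
    · intro y hy
      have := hy.2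
      simp only [Set.mem_preimage] at this
      rw [hsrc] at this
      simp [hy.1, this.1]
    · intro y hy
      have := hy.2
      simp only [Set.mem_preimage] at this
      rw [hsrc] at this
      exact this.2
    · intro y hy
      exact (chartAt (EuclideanSpace ℝ (Fin d)) x).map_source hy.2

/-- A local inverse of a local diffeomorphism. -/
theorem IsLocalDiffeomorphAt.exists_section {f : X → N} {x : X}
    (hf : IsLocalDiffeomorphAt I' I ∞ f x) :
    ∃ (σ : N → X) (U : Set N), IsOpen U ∧ f x ∈ U ∧ ContMDiffOn I I' ∞ σ U ∧ σ (f x) = x ∧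
      (∀ y ∈ U, f (σ y) = y) ∧ ∀ᶠ x' in 𝓝 x, σ (f x') = x' := by
  refine ⟨hf.localInverse, hf.localInverse.source, hf.localInverse_open_source,
    hf.localInverse_mem_source, hf.localInverse_contMDiffOn,
    hf.localInverse_left_inv hf.localInverse_mem_target,
    fun y hy => hf.localInverse_right_inv hy, hf.localInverse_eventuallyEq_left⟩

theorem IsLocalDiffeomorphAt.of_openPartialHomeomorph {f : X → N} {x : X}
    (e : OpenPartialHomeomorph X N) (hx : x ∈ e.source) (hfe : Set.EqOn f e e.source)
    (h : ContMDiffOn I' I ∞ e e.source) (h' : ContMDiffOn I I' ∞ e.symm e.target) :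
    IsLocalDiffeomorphAt I' I ∞ f x :=
  ⟨{ e.toPartialEquiv with
      open_source := e.open_source
      open_target := e.open_target
      contMDiffOn_toFun := h
      contMDiffOn_invFun := h' }, hx, hfe⟩

/-- Near the point `f` equals `σ ∘ p ∘ f` for a smooth local inverse `σ` of `p`; continuity keeps
`f` on the branch of `σ`. Together with its global forms this is the standard test below for
smoothness into a manifold whose structure is pulled back along `p`. -/
theorem IsLocalDiffeomorphAt.contMDiffWithinAt_of_comp {p : X → N} {f : Z → X} {s : Set Z} {z : Z}
    (hp : IsLocalDiffeomorphAt I' I ∞ p (f z)) (hf : ContinuousWithinAt f s z)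
    (h : ContMDiffWithinAt I'' I ∞ (p ∘ f) s z) : ContMDiffWithinAt I'' I' ∞ f s z := by
  obtain ⟨σ, U, hU, hxU, hσ, hσx, hr, hl⟩ := hp.exists_section
  have h1 : ContMDiffWithinAt I'' I' ∞ (σ ∘ p ∘ f) s z :=
    ContMDiffAt.comp_contMDiffWithinAt z (hσ.contMDiffAt (hU.mem_nhds hxU)) h
  exact h1.congr_of_eventuallyEq ((hf.eventually hl).mono fun _ h => h.symm) hσx.symm

theorem IsLocalDiffeomorph.contMDiffOn_of_comp {p : X → N} {f : Z → X} {s : Set Z}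
    (hp : IsLocalDiffeomorph I' I ∞ p) (hf : ContinuousOn f s)
    (h : ContMDiffOn I'' I ∞ (p ∘ f) s) : ContMDiffOn I'' I' ∞ f s := fun z hz =>
  (hp (f z)).contMDiffWithinAt_of_comp (hf z hz) (h z hz)

theorem IsLocalDiffeomorph.contMDiff_of_comp {p : X → N} {f : Z → X}
    (hp : IsLocalDiffeomorph I' I ∞ p) (hf : Continuous f)
    (h : ContMDiff I'' I ∞ (p ∘ f)) : ContMDiff I'' I' ∞ f := by
  rw [← contMDiffOn_univ] at h ⊢
  exact hp.contMDiffOn_of_comp hf.continuousOn h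

theorem IsLocalDiffeomorph.comp {p : X → N} {f : Z → X} (hp : IsLocalDiffeomorph I' I ∞ p)
    (hf : IsLocalDiffeomorph I'' I' ∞ f) : IsLocalDiffeomorph I'' I ∞ (p ∘ f) := fun z =>
  (hf z).comp _ _ (hp (f z))

/-- The map is already a local homeomorphism. Its local inverses are smooth because composing them
with the local diffeomorphism `p ∘ f` gives `p`. -/
theorem IsLocalDiffeomorph.of_comp {p : X → N} {f : Z → X} (hp : IsLocalDiffeomorph I' I ∞ p)
    (hpf : IsLocalDiffeomorph I'' I ∞ (p ∘ f)) (hf : Continuous f) :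
    IsLocalDiffeomorph I'' I' ∞ f := by
  have hl : IsLocalHomeomorph f := hpf.isLocalHomeomorph.of_comp hp.isLocalHomeomorph hf
  intro z
  obtain ⟨e, hz, rfl⟩ := hl z
  refine .of_openPartialHomeomorph e hz (fun _ _ => rfl)
    (hp.contMDiff_of_comp hf hpf.contMDiff).contMDiffOn ?_
  refine hpf.contMDiffOn_of_comp e.symm.continuousOn (hp.contMDiff.contMDiffOn.congr ?_)
  intro x hx
  change p (e (e.symm x)) = _
  rw [e.right_inv hx]

theorem IsLocalDiffeomorph.surjective_mfderiv {p : X → N} (hp : IsLocalDiffeomorph I' I ∞ p)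
    (x : X) : Function.Surjective (mfderiv I' I p x) := by
  have h : (∞ : WithTop ℕ∞) ≠ 0 := by simp
  have := ((hp x).mfderivToContinuousLinearEquiv h).surjective
  rwa [← ContinuousLinearEquiv.coe_coe, IsLocalDiffeomorphAt.mfderivToContinuousLinearEquiv_coe] at this

theorem IsLocalDiffeomorph.prodMap {E₃ : Type*} [NormedAddCommGroup E₃] [NormedSpace ℝ E₃]
    {B₃ : Type*} [TopologicalSpace B₃] {I₃ : ModelWithCorners ℝ E₃ B₃} {W : Type*}
    [TopologicalSpace W] [ChartedSpace B₃ W] {p : X → N} {f : Z → W}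
    (hp : IsLocalDiffeomorph I' I ∞ p) (hf : IsLocalDiffeomorph I'' I₃ ∞ f) :
    IsLocalDiffeomorph (I'.prod I'') (I.prod I₃) ∞ (Prod.map p f) := by
  rintro ⟨x, z⟩
  obtain ⟨Φ, hx, hΦ⟩ := hp x
  obtain ⟨Ψ, hz, hΨ⟩ := hf z
  refine .of_openPartialHomeomorph
    (Φ.toOpenPartialHomeomorph.prod Ψ.toOpenPartialHomeomorph) ⟨hx, hz⟩ ?_ ?_ ?_
  · rintro ⟨a, b⟩ ⟨ha, hb⟩
    exact Prod.ext (hΦ ha) (hΨ hb)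
  · exact Φ.contMDiffOn_toFun.prodMap Ψ.contMDiffOn_toFun
  · exact Φ.contMDiffOn_invFun.prodMap Ψ.contMDiffOn_invFun

theorem IsLocalDiffeomorph.of_contMDiff {f : X → N} (g : N → X) (hf : ContMDiff I' I ∞ f)
    (hg : ContMDiff I I' ∞ g) (hgf : ∀ x, g (f x) = x) (hfg : ∀ y, f (g y) = y) :
    IsLocalDiffeomorph I' I ∞ f :=
  Diffeomorph.isLocalDiffeomorph
    ({ toFun := f, invFun := g, left_inv := hgf, right_inv := hfg, contMDiff_toFun := hf,
       contMDiff_invFun := hg } : Diffeomorph I' I X N ∞)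

theorem isLocalDiffeomorph_id : IsLocalDiffeomorph I I ∞ (id : N → N) :=
  (Diffeomorph.refl I N ∞).isLocalDiffeomorph

/-- The smooth structure pulled back along a local homeomorphism. -/
theorem IsLocalHomeomorph.exists_chartedSpace [IsManifold I ∞ N] {d : ℕ}
    (e : B ≃ₜ EuclideanSpace ℝ (Fin d)) (he : ContMDiff I (𝓡 d) ∞ e)
    (he' : ContMDiff (𝓡 d) I ∞ e.symm) {X : Type*} [TopologicalSpace X] {p : X → N}
    (hp : IsLocalHomeomorph p) :
    ∃ _ : ChartedSpace (EuclideanSpace ℝ (Fin d)) X, IsManifold (𝓡 d) ∞ X ∧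
      IsLocalDiffeomorph (𝓡 d) I ∞ p := by
  choose φ hφ hpφ using hp
  -- All `φ i` are restrictions of the same map `p`, so every change of coordinates is the identity
  -- on its domain.
  obtain ⟨cs, hm, h⟩ := exists_chartedSpace_of_openPartialHomeomorph e he he' φ
    (fun x => ⟨x, hφ x⟩) (fun i j => contMDiffOn_id.congr (by
      intro y hy
      simp only [OpenPartialHomeomorph.trans_source, OpenPartialHomeomorph.symm_source,
        Set.mem_inter_iff] at hy
      simp only [OpenPartialHomeomorph.coe_trans, Function.comp, ← hpφ j]
      rw [hpφ i, (φ i).right_inv hy.1, id]))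
  exact ⟨cs, hm, fun x => .of_openPartialHomeomorph (φ x) (hφ x) (fun y _ => by rw [← hpφ x])
    (h x).1 (h x).2⟩

/-- Products of manifolds carry the product model, whereas the manifolds of the theorem are modelled
on a single Euclidean space; this is the smooth change of model. -/
theorem exists_homeomorph_euclideanSpace_prod (n k : ℕ) :
    ∃ e : ModelProd (EuclideanSpace ℝ (Fin n)) (EuclideanSpace ℝ (Fin k)) ≃ₜ
      EuclideanSpace ℝ (Fin (n + k)), ContMDiff ((𝓡 n).prod (𝓡 k)) (𝓡 (n + k)) ∞ e ∧
      ContMDiff (𝓡 (n + k)) ((𝓡 n).prod (𝓡 k)) ∞ e.symm := by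
  let L : (EuclideanSpace ℝ (Fin n) × EuclideanSpace ℝ (Fin k)) ≃L[ℝ]
      EuclideanSpace ℝ (Fin (n + k)) := ContinuousLinearEquiv.ofFinrankEq (by simp)
  refine ⟨L.toHomeomorph, ?_, ?_⟩
  · exact L.contDiff.contMDiff.comp ((𝓡 n).prod (𝓡 k)).contMDiff
  · have h := ((𝓡 n).prod (𝓡 k)).contMDiffOn_symm (n := ∞)
    exact contMDiffOn_univ.1 (h.comp L.symm.contDiff.contMDiff.contMDiffOn (fun y _ =>
      ⟨L.symm y, rfl⟩))

end ManifoldTools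

/-! ### The unitary group as a compact Lie group, by Cayley charts -/

section UnitaryLieGroup

variable {A : Type*} [NormedRing A] [NormedAlgebra ℝ A] [StarRing A]

/-- The Cayley transform, meaningful where `1 + a` is invertible. -/
noncomputable def cayleyTransform (a : A) : A := (1 - a) * Ring.inverse (1 + a)

theorem one_add_cayleyTransform {a : A} (h : IsUnit (1 + a)) :
    1 + cayleyTransform a = 2 * Ring.inverse (1 + a) := by
  have h1 : (1 : A) = (1 + a) * Ring.inverse (1 + a) := (Ring.mul_inverse_cancel _ h).symm
  calc 1 + cayleyTransform a
      = (1 + a) * Ring.inverse (1 + a) + (1 - a) * Ring.inverse (1 + a) := by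
        rw [← h1, cayleyTransform]
    _ = _ := by rw [← add_mul]; congr 1; rw [add_add_sub_cancel, one_add_one_eq_two]

theorem isUnit_two_real_algebra : IsUnit (2 : A) := by
  have := (IsUnit.mk0 (2 : ℝ) two_ne_zero).map (algebraMap ℝ A)
  rwa [map_ofNat] at this

theorem isUnit_one_add_cayleyTransform {a : A} (h : IsUnit (1 + a)) :
    IsUnit (1 + cayleyTransform a) := by
  rw [one_add_cayleyTransform h]
  exact isUnit_two_real_algebra.mul h.ringInverse

/-- With c the transform of a, the relation (1 + a) c = 1 - a is symmetric in a and c: it rearranges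
to a (1 + c) = 1 - c. -/
theorem cayleyTransform_cayleyTransform {a : A} (h : IsUnit (1 + a)) :
    cayleyTransform (cayleyTransform a) = a := by
  have h1 : a * (1 + cayleyTransform a) = 1 - cayleyTransform a := by
    have hc : cayleyTransform a * (1 + a) = 1 - a := by
      rw [cayleyTransform, mul_assoc, Ring.inverse_mul_cancel _ h, mul_one]
    have hc' : (1 + a) * cayleyTransform a = 1 - a := by
      rw [cayleyTransform, ← mul_assoc, show (1 + a) * (1 - a) = (1 - a) * (1 + a) by noncomm_ring,
        mul_assoc, Ring.mul_inverse_cancel _ h, mul_one]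
    rw [add_mul, one_mul] at hc'
    rw [mul_add, mul_one, ← sub_eq_zero]
    have := sub_eq_zero.2 hc'
    rw [← this]
    abel
  rw [cayleyTransform, ← h1, mul_assoc,
    Ring.mul_inverse_cancel _ (isUnit_one_add_cayleyTransform h), mul_one]

/-- For unitary a one has (1 - a*)(1 + a) = -(1 + a*)(1 - a); dividing by 1 + a* on the left and 1 +
a on the right gives the claim. -/
theorem star_cayleyTransform_of_mem_unitary {a : A} (ha : a ∈ unitary A) (h : IsUnit (1 + a)) :
    star (cayleyTransform a) = -cayleyTransform a := by
  have hs : IsUnit (1 + star a) := by simpa using h.star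
  have h1 : star (cayleyTransform a) * (1 + a) = -(1 - a) := by
    have e1 : star (cayleyTransform a) = Ring.inverse (1 + star a) * (1 - star a) := by
      rw [cayleyTransform, star_mul, ← Ring.inverse_star, star_sub, star_one, star_add, star_one]
    have e2 : (1 - star a) * (1 + a) = (1 + star a) * (-(1 - a)) := by
      have := Unitary.star_mul_self_of_mem ha
      calc (1 - star a) * (1 + a) = 1 + a - star a - star a * a := by noncomm_ring
        _ = -1 + a - star a + star a * a := by rw [this]; noncomm_ring
        _ = _ := by noncomm_ring
    rw [e1, mul_assoc, e2, ← mul_assoc, Ring.inverse_mul_cancel _ hs, one_mul]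
  have h2 : -cayleyTransform a * (1 + a) = -(1 - a) := by
    rw [cayleyTransform, neg_mul, mul_assoc, Ring.inverse_mul_cancel _ h, mul_one]
  exact h.mul_right_cancel (h1.trans h2.symm)

/-- The adjoint of 1 + a is 1 - a, so both are invertible; they commute, and the factors of the
transform and of its adjoint cancel. -/
theorem cayleyTransform_mem_unitary {a : A} (ha : star a = -a) (h : IsUnit (1 + a)) :
    cayleyTransform a ∈ unitary A := by
  have hs : IsUnit (1 - a) := by simpa [ha, sub_eq_add_neg] using h.star
  have hc : (1 + a) * (1 - a) = (1 - a) * (1 + a) := by noncomm_ring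
  have e1 : star (cayleyTransform a) = Ring.inverse (1 - a) * (1 + a) := by
    rw [cayleyTransform, star_mul, ← Ring.inverse_star, star_sub, star_one, star_add, star_one, ha,
      sub_neg_eq_add, ← sub_eq_add_neg]
  rw [Unitary.mem_iff, e1, cayleyTransform]
  constructor
  · calc _ = Ring.inverse (1 - a) * ((1 + a) * (1 - a)) * Ring.inverse (1 + a) := by
          simp only [mul_assoc]
      _ = Ring.inverse (1 - a) * (1 - a) * ((1 + a) * Ring.inverse (1 + a)) := by
          rw [hc]; simp only [mul_assoc]
      _ = 1 := by rw [Ring.inverse_mul_cancel _ hs, Ring.mul_inverse_cancel _ h, one_mul]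
  · have h3 : Ring.inverse (1 + a) * Ring.inverse (1 - a) =
        Ring.inverse (1 - a) * Ring.inverse (1 + a) := by
      rw [← Ring.mul_inverse_rev' hc, ← Ring.mul_inverse_rev' hc.symm, hc]
    calc _ = (1 - a) * (Ring.inverse (1 + a) * Ring.inverse (1 - a)) * (1 + a) := by
          simp only [mul_assoc]
      _ = (1 - a) * Ring.inverse (1 - a) * (Ring.inverse (1 + a) * (1 + a)) := by
          rw [h3]; simp only [mul_assoc]
      _ = 1 := by rw [Ring.inverse_mul_cancel _ h, Ring.mul_inverse_cancel _ hs, one_mul]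

theorem contDiffAt_cayleyTransform [CompleteSpace A] {a : A} (h : IsUnit (1 + a)) :
    ContDiffAt ℝ ∞ (cayleyTransform : A → A) a := by
  obtain ⟨v, hv⟩ := h
  have h1 : ContDiffAt ℝ ∞ (Ring.inverse : A → A) (1 + a) := hv ▸ contDiffAt_ringInverse ℝ v
  have h2 : ContDiffAt ℝ ∞ (fun b : A => Ring.inverse (1 + b)) a :=
    ContDiffAt.comp a h1 (contDiffAt_const.add contDiffAt_id)
  exact (contDiffAt_const.sub contDiffAt_id).mul h2

variable [CompleteSpace A] [StarModule ℝ A] [ContinuousStar A]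

/-- The linear projection onto the skew-adjoint elements. -/
noncomputable def skewProj : A →L[ℝ] skewAdjoint.submodule ℝ A where
  toFun a := ⟨(2⁻¹ : ℝ) • (a - star a), by
    change star _ = - _
    rw [star_smul, star_sub, star_star, star_trivial, ← smul_neg, neg_sub]⟩
  map_add' a b := by ext; simp [← smul_add]; abel_nf
  map_smul' c a := by ext; simp [smul_sub, smul_comm c]
  cont := by
    refine Continuous.subtype_mk ?_ _
    fun_prop

theorem skewProj_of_star_eq {a : A} (ha : star a = -a) : (skewProj a : A) = a := by
  change (2⁻¹ : ℝ) • (a - star a) = a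
  rw [ha, sub_neg_eq_add, ← two_smul ℝ a, smul_smul]
  norm_num

open Classical in
/-- The chart of the unitary group around `q` given by the Cayley transform. -/
noncomputable def cayleyChart (q : unitary A) :
    OpenPartialHomeomorph (unitary A) (skewAdjoint.submodule ℝ A) where
  toFun v := skewProj (cayleyTransform (star (q : A) * v))
  -- On the target the transform is unitary, so the default value 1 is never used there.
  invFun X := if h : cayleyTransform (X : A) ∈ unitary A then q * ⟨_, h⟩ else 1
  source := {v | IsUnit (1 + star (q : A) * v)}
  target := {X | IsUnit (1 + (X : A))}
  map_source' v hv := by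
    have hm : star (q : A) * v ∈ unitary A := (star q * v).2
    rw [Set.mem_ofPred_eq, skewProj_of_star_eq (star_cayleyTransform_of_mem_unitary hm hv)]
    exact isUnit_one_add_cayleyTransform hv
  map_target' X hX := by
    have h := cayleyTransform_mem_unitary X.2 hX
    rw [dif_pos h]
    have : star (q : A) * (q * cayleyTransform (X : A)) = cayleyTransform (X : A) := by
      rw [← mul_assoc, Unitary.star_mul_self_of_mem q.2, one_mul]
    change IsUnit (1 + star (q : A) * (q * cayleyTransform (X : A)))
    rw [this]
    exact isUnit_one_add_cayleyTransform hX
  left_inv' v hv := by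
    have hm : star (q : A) * v ∈ unitary A := (star q * v).2
    have h1 := skewProj_of_star_eq (star_cayleyTransform_of_mem_unitary hm hv)
    have h2 : cayleyTransform (skewProj (cayleyTransform (star (q : A) * v)) : A) =
        star (q : A) * v := by
      rw [h1, cayleyTransform_cayleyTransform hv]
    rw [dif_pos (by rw [h2]; exact hm)]
    ext
    change (q : A) * cayleyTransform _ = _
    rw [h2, ← mul_assoc, Unitary.mul_star_self_of_mem q.2, one_mul]
  right_inv' X hX := by
    have h := cayleyTransform_mem_unitary X.2 hX
    rw [dif_pos h]
    have : star (q : A) * (q * cayleyTransform (X : A)) = cayleyTransform (X : A) := by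
      rw [← mul_assoc, Unitary.star_mul_self_of_mem q.2, one_mul]
    ext
    change (skewProj (cayleyTransform (star (q : A) * (q * cayleyTransform (X : A)))) : A) = _
    rw [this, cayleyTransform_cayleyTransform hX, skewProj_of_star_eq X.2]
  open_source := Units.isOpen.preimage (by fun_prop : Continuous fun v : unitary A =>
    1 + star (q : A) * v)
  open_target := Units.isOpen.preimage (by fun_prop :
    Continuous fun X : skewAdjoint.submodule ℝ A => 1 + (X : A))
  continuousOn_toFun v hv := by
    refine ContinuousAt.continuousWithinAt ?_
    refine skewProj.continuous.continuousAt.comp ?_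
    exact ContinuousAt.comp (f := fun v : unitary A => star (q : A) * v)
      (contDiffAt_cayleyTransform hv).continuousAt (by fun_prop)
  continuousOn_invFun := by
    rw [Topology.IsInducing.subtypeVal.continuousOn_iff]
    refine ContinuousOn.congr (f := fun X : skewAdjoint.submodule ℝ A =>
      (q : A) * cayleyTransform (X : A)) ?_ ?_
    · intro X hX
      refine ContinuousAt.continuousWithinAt (continuousAt_const.mul ?_)
      exact ContinuousAt.comp (f := fun X : skewAdjoint.submodule ℝ A => (X : A))
        (contDiffAt_cayleyTransform hX).continuousAt (by fun_prop)
    · intro X hX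
      have h := cayleyTransform_mem_unitary X.2 hX
      simp only [Function.comp, dif_pos h]
      rfl

open Classical in
theorem coe_cayleyChart_symm (q : unitary A) {X : skewAdjoint.submodule ℝ A}
    (hX : IsUnit (1 + (X : A))) :
    ((cayleyChart q).symm X : A) = q * cayleyTransform (X : A) := by
  have h := cayleyTransform_mem_unitary X.2 hX
  change ((if h : cayleyTransform (X : A) ∈ unitary A then q * ⟨_, h⟩ else 1 : unitary A) : A) = _
  rw [dif_pos h]
  rfl

theorem mem_cayleyChart_source (q : unitary A) : q ∈ (cayleyChart q).source := by
  change IsUnit (1 + star (q : A) * q)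
  rw [Unitary.star_mul_self_of_mem q.2, one_add_one_eq_two]
  exact isUnit_two_real_algebra

theorem contDiffAt_coe_cayleyChart_symm (q : unitary A) {X : skewAdjoint.submodule ℝ A}
    (hX : IsUnit (1 + (X : A))) :
    ContDiffAt ℝ ∞ (fun X => ((cayleyChart q).symm X : A)) X := by
  have h1 : ContDiffAt ℝ ∞ (fun X : skewAdjoint.submodule ℝ A =>
      (q : A) * cayleyTransform (X : A)) X :=
    contDiffAt_const.mul (ContDiffAt.comp (f := fun X : skewAdjoint.submodule ℝ A => (X : A)) X
      (contDiffAt_cayleyTransform hX) (skewAdjoint.submodule ℝ A).subtypeL.contDiff.contDiffAt)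
  refine h1.congr_of_eventuallyEq ?_
  filter_upwards [(cayleyChart q).open_target.mem_nhds hX] with Y hY
  exact coe_cayleyChart_symm q hY

theorem contDiffAt_skewProj_cayleyTransform (q : unitary A) {a : A}
    (ha : IsUnit (1 + star (q : A) * a)) :
    ContDiffAt ℝ ∞ (fun b : A => skewProj (cayleyTransform (star (q : A) * b))) a :=
  (skewProj (A := A)).contDiff.contDiffAt.comp a (ContDiffAt.comp (f := fun b : A => star (q : A) * b) a
    (contDiffAt_cayleyTransform ha) (contDiffAt_const.mul contDiffAt_id))

/-- The unitary group of a finite-dimensional real star algebra is an embedded submanifold: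
the inclusion is smooth and has local smooth left inverses. -/
theorem exists_chartedSpace_unitary [FiniteDimensional ℝ A] :
    ∃ (k : ℕ) (_ : ChartedSpace (EuclideanSpace ℝ (Fin k)) (unitary A)),
      IsManifold (𝓡 k) ∞ (unitary A) ∧
      ContMDiff (𝓡 k) 𝓘(ℝ, A) ∞ (Subtype.val : unitary A → A) ∧
      ∀ q : unitary A, ∃ r : A → unitary A, ContMDiffAt 𝓘(ℝ, A) (𝓡 k) ∞ r q ∧
        ∀ᶠ v : unitary A in 𝓝 q, r (v : A) = v := by
  let L : skewAdjoint.submodule ℝ A ≃L[ℝ]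
      EuclideanSpace ℝ (Fin (Module.finrank ℝ (skewAdjoint.submodule ℝ A))) :=
    ContinuousLinearEquiv.ofFinrankEq (by simp)
  obtain ⟨cs, hm, h⟩ := exists_chartedSpace_of_openPartialHomeomorph
    (I := 𝓘(ℝ, skewAdjoint.submodule ℝ A)) L.toHomeomorph L.contDiff.contMDiff
    L.symm.contDiff.contMDiff (fun q : unitary A => cayleyChart q)
    (fun q => ⟨q, mem_cayleyChart_source q⟩) (by
      intro p q
      rw [contMDiffOn_iff_contDiffOn]
      intro X hX
      refine ContDiffAt.contDiffWithinAt ?_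
      rw [OpenPartialHomeomorph.trans_source] at hX
      -- The chart at `q` is the restriction of a map defined and smooth on an open set of the
      -- ambient algebra, so changes of charts are composites of smooth maps of vector spaces.
      exact ContDiffAt.comp (f := fun X => ((cayleyChart p).symm X : A)) X
        (contDiffAt_skewProj_cayleyTransform q hX.2) (contDiffAt_coe_cayleyChart_symm p hX.1))
  refine ⟨_, cs, hm, ?_, ?_⟩
  · intro q
    have h1 : ContMDiffAt (𝓡 _) 𝓘(ℝ, A) ∞
        ((fun X => ((cayleyChart q).symm X : A)) ∘ cayleyChart q) q :=
      (contDiffAt_coe_cayleyChart_symm q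
        ((cayleyChart q).map_source (mem_cayleyChart_source q))).contMDiffAt.comp q
        ((h q).1.contMDiffAt ((cayleyChart q).open_source.mem_nhds (mem_cayleyChart_source q)))
    refine h1.congr_of_eventuallyEq ?_
    filter_upwards [(cayleyChart q).open_source.mem_nhds (mem_cayleyChart_source q)] with v hv
    simp [(cayleyChart q).left_inv hv]
  · intro q
    refine ⟨(cayleyChart q).symm ∘ fun b : A => skewProj (cayleyTransform (star (q : A) * b)),
      ?_, ?_⟩
    · refine ContMDiffAt.comp (x := (q : A)) (g := (cayleyChart q).symm) ?_
        (contDiffAt_skewProj_cayleyTransform q (mem_cayleyChart_source q)).contMDiffAt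
      exact (h q).2.contMDiffAt ((cayleyChart q).open_target.mem_nhds
        ((cayleyChart q).map_source (mem_cayleyChart_source q)))
    · filter_upwards [(cayleyChart q).open_source.mem_nhds (mem_cayleyChart_source q)] with v hv
      exact (cayleyChart q).left_inv hv

/-- Composing the ambient-valued map with a local smooth retraction recovers `f`, so smoothness can
be tested in the algebra, where multiplication and adjoint are smooth. -/
theorem contMDiffAt_unitary_of_coe {k : ℕ} [ChartedSpace (EuclideanSpace ℝ (Fin k)) (unitary A)]
    (hr : ∀ q : unitary A, ∃ r : A → unitary A, ContMDiffAt 𝓘(ℝ, A) (𝓡 k) ∞ r q ∧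
        ∀ᶠ v : unitary A in 𝓝 q, r (v : A) = v)
    {E : Type*} [NormedAddCommGroup E] [NormedSpace ℝ E] {B : Type*} [TopologicalSpace B]
    {I : ModelWithCorners ℝ E B} {N : Type*} [TopologicalSpace N] [ChartedSpace B N]
    {f : N → unitary A} (hf : ContMDiff I 𝓘(ℝ, A) ∞ (fun x => (f x : A))) :
    ContMDiff I (𝓡 k) ∞ f := by
  intro x
  obtain ⟨r, hr1, hr2⟩ := hr (f x)
  have hc : Continuous f := Topology.IsInducing.subtypeVal.continuous_iff.2 hf.continuous
  have h1 : ContMDiffAt I (𝓡 k) ∞ (r ∘ fun x => (f x : A)) x :=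
    ContMDiffAt.comp (x := x) (g := r) hr1 (hf x)
  exact h1.congr_of_eventuallyEq ((hc.continuousAt.eventually hr2).mono fun y hy => hy.symm)

theorem isCompact_unitary [CStarRing A] [FiniteDimensional ℝ A] : CompactSpace (unitary A) := by
  have hc : IsClosed (unitary A : Set A) := by
    have : (unitary A : Set A) = {a | star a * a = 1} ∩ {a | a * star a = 1} := rfl
    rw [this]
    exact (isClosed_eq (by fun_prop) continuous_const).inter
      (isClosed_eq (by fun_prop) continuous_const)
  have hb : Bornology.IsBounded (unitary A : Set A) := by
    -- The C*-identity gives ‖a‖² = ‖1‖, and t² = s forces t ≤ s + 1.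
    refine (Metric.isBounded_iff_subset_closedBall 0).2 ⟨‖(1 : A)‖ + 1, fun a ha => ?_⟩
    rw [mem_closedBall_zero_iff]
    have h1 := CStarRing.norm_star_mul_self (x := a)
    rw [Unitary.star_mul_self_of_mem ha] at h1
    nlinarith [norm_nonneg a, norm_nonneg (1 : A)]
  have : ProperSpace A := FiniteDimensional.proper ℝ A
  exact isCompact_iff_compactSpace.1 (Metric.isCompact_of_isClosed_isBounded hc hb)

/-- The product of the unitary group of a finite-dimensional real star algebra with a finite
discrete group is a compact Lie group. -/
theorem exists_lieGroup_unitary_prod [CStarRing A] [FiniteDimensional ℝ A] (F : Type*)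
    [Group F] [Finite F] [TopologicalSpace F] [DiscreteTopology F] :
    ∃ (k : ℕ) (_ : ChartedSpace (EuclideanSpace ℝ (Fin k)) (unitary A))
      (_ : ChartedSpace (EuclideanSpace ℝ (Fin k)) (unitary A × F)),
      LieGroup (𝓡 k) ∞ (unitary A × F) ∧ CompactSpace (unitary A × F) ∧
      IsLocalDiffeomorph (𝓡 k) (𝓡 k) ∞ (Prod.fst : unitary A × F → unitary A) ∧
      ∀ q : unitary A, ∃ r : A → unitary A, ContMDiffAt 𝓘(ℝ, A) (𝓡 k) ∞ r q ∧
        ∀ᶠ v : unitary A in 𝓝 q, r (v : A) = v := by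
  obtain ⟨k, cs, hm, hval, hr⟩ := exists_chartedSpace_unitary (A := A)
  have hloc : IsLocalHomeomorph (Prod.fst : unitary A × F → unitary A) := by
    -- Discreteness makes each slice open, and on a slice the projection inverts the inclusion.
    refine IsLocalHomeomorph.mk _ fun p => ?_
    have hp : Topology.IsOpenEmbedding (fun v : unitary A => (v, p.2)) := by
      refine ⟨Topology.IsEmbedding.of_leftInverse (f := Prod.fst) (fun _ => rfl) (by fun_prop)
        (by fun_prop), ?_⟩
      have : Set.range (fun v : unitary A => (v, p.2)) = Prod.snd ⁻¹' {p.2} := by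
        ext ⟨v, f⟩
        simp [eq_comm]
      rw [this]
      exact (isOpen_discrete _).preimage continuous_snd
    have : Nonempty (unitary A) := ⟨1⟩
    refine ⟨(hp.toOpenPartialHomeomorph _).symm, ?_, ?_⟩
    · exact ⟨p.1, trivial, rfl⟩
    · rintro _ ⟨v, -, rfl⟩
      exact ((hp.toOpenPartialHomeomorph _).left_inv (x := v) trivial).symm
  obtain ⟨cs', hm', hfst⟩ := hloc.exists_chartedSpace (I := 𝓡 k)
    (Homeomorph.refl (EuclideanSpace ℝ (Fin k))) contMDiff_id contMDiff_id
  have := isCompact_unitary (A := A)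
  have hcoe : ContMDiff (𝓡 k) 𝓘(ℝ, A) ∞ (fun p : unitary A × F => (p.1 : A)) :=
    hval.comp hfst.contMDiff
  refine ⟨k, cs, cs', ?_, inferInstance, hfst, hr⟩
  refine { hm' with contMDiff_mul := ?_, contMDiff_inv := ?_ }
  -- The first projection is a local diffeomorphism, so continuity takes care of the discrete factor
  -- and only the unitary component has to be smooth.
  · refine hfst.contMDiff_of_comp continuous_mul (contMDiffAt_unitary_of_coe hr ?_)
    exact ((contDiff_fst.mul contDiff_snd).contMDiff).comp
      ((hcoe.comp contMDiff_fst).prodMk_space (hcoe.comp contMDiff_snd))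
  · refine hfst.contMDiff_of_comp continuous_inv (contMDiffAt_unitary_of_coe hr ?_)
    exact (starL' ℝ : A ≃L[ℝ] A).contDiff.contMDiff.comp hcoe

end UnitaryLieGroup

/-! ### Local homeomorphisms and closed maps -/

section Topology

variable {X Y : Type*} [TopologicalSpace X] [TopologicalSpace Y]

/-- A section of a local homeomorphism which is continuous at a point inverts the map near the
value of the section. -/
theorem IsLocalHomeomorph.eventually_section_apply {p : X → Y} (hp : IsLocalHomeomorph p) {x : X}
    {σ : Y → X} (hσx : σ (p x) = x) (hσ : ContinuousAt σ (p x))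
    (hpσ : ∀ᶠ y in 𝓝 (p x), p (σ y) = y) : ∀ᶠ x' in 𝓝 x, σ (p x') = x' := by
  obtain ⟨e, hx, rfl⟩ := hp x
  have h1 : ∀ᶠ x' in 𝓝 x, σ (e x') ∈ e.source := by
    refine (ContinuousAt.tendsto (hσ.comp (e.continuousAt hx))).eventually ?_
    rw [Function.comp, hσx]
    exact e.open_source.mem_nhds hx
  filter_upwards [h1, e.open_source.mem_nhds hx, (e.continuousAt hx).eventually hpσ] with x' h h' h2
  exact e.injOn h h' h2

/-- Both lifts eventually enter one neighbourhood of `x` on which `p` is injective. Used with `p`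
the source map, it turns identities between arrows into identities between their sources. -/
theorem IsLocalHomeomorph.eventually_unique_lift {p : X → Y} (hp : IsLocalHomeomorph p)
    {Z : Type*} [TopologicalSpace Z] {f g : Z → X} {l : Filter Z} {x : X}
    (hf : Filter.Tendsto f l (𝓝 x)) (hg : Filter.Tendsto g l (𝓝 x))
    (h : ∀ᶠ z in l, p (f z) = p (g z)) : ∀ᶠ z in l, f z = g z := by
  obtain ⟨e, hx, rfl⟩ := hp x
  filter_upwards [hf (e.open_source.mem_nhds hx), hg (e.open_source.mem_nhds hx), h] with z h1 h2 h3
  exact e.injOn h1 h2 h3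

/-- A fibre meets each injectivity neighbourhood in at most one point, and compactness leaves
finitely many of these. -/
theorem IsLocalHomeomorph.finite_of_isCompact_fiber {p : X → Y} (hp : IsLocalHomeomorph p)
    {s : Set X} (hs : IsCompact s) {y : Y} (hy : ∀ x ∈ s, p x = y) : s.Finite := by
  choose e he hpe using hp
  obtain ⟨t, -, ht⟩ := hs.elim_nhds_subcover (fun x => (e x).source)
    (fun x _ => (e x).open_source.mem_nhds (he x))
  refine (t.finite_toSet.biUnion (t := fun x => (e x).source ∩ s) fun x _ => ?_).subset
    fun z hz => ?_
  · refine Set.Subsingleton.finite fun a ha b hb => (e x).injOn ha.1 hb.1 ?_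
    rw [← hpe, hy a ha.2, hy b hb.2]
  · have := ht hz
    simp only [Set.mem_iUnion] at this ⊢
    obtain ⟨x, hx, hz'⟩ := this
    exact ⟨x, hx, hz', hz⟩

/-- The tube lemma for a closed map: the image of the complement of `W` is closed and misses `y`.
Applied to (s, t), it is how properness enters. -/
theorem IsClosedMap.eventually_fiber_subset {f : X → Y} (hf : IsClosedMap f) {y : Y} {W : Set X}
    (hW : IsOpen W) (h : ∀ x, f x = y → x ∈ W) : ∀ᶠ y' in 𝓝 y, ∀ x, f x = y' → x ∈ W := by
  have h1 := (hf _ hW.isClosed_compl).isOpen_compl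
  have h2 : y ∈ (f '' Wᶜ)ᶜ := by
    rintro ⟨x, hx, hxy⟩
    exact hx (h x hxy)
  filter_upwards [h1.mem_nhds h2] with y' hy' x hx
  by_contra hc
  exact hy' ⟨x, hc, hx⟩

end Topology

/-! ### Étale groupoids and their ineffective arrows -/

namespace SmoothGroupoid

variable {E₀ : Type*} [NormedAddCommGroup E₀] [NormedSpace ℝ E₀] {B₀ : Type*} [TopologicalSpace B₀]
  {E₁ : Type*} [NormedAddCommGroup E₁] [NormedSpace ℝ E₁] {B₁ : Type*} [TopologicalSpace B₁]
  {I₀ : ModelWithCorners ℝ E₀ B₀} {I₁ : ModelWithCorners ℝ E₁ B₁}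
  {G₀ G₁ : Type*} [TopologicalSpace G₀] [ChartedSpace B₀ G₀]
  [TopologicalSpace G₁] [ChartedSpace B₁ G₁] (G : SmoothGroupoid I₀ I₁ G₀ G₁)

theorem continuous_src : Continuous G.src := G.src_submersion.smooth.continuous

theorem continuous_tgt : Continuous G.tgt := G.tgt_smooth.continuous

theorem continuous_unit : Continuous G.unit := G.unit_smooth.continuous

theorem continuous_inv : Continuous G.inv := G.inv_smooth.continuous

theorem tendsto_comp {Z : Type*} {l : Filter Z} {a b : Z → G₁} {g h : G₁}
    (ha : Filter.Tendsto a l (𝓝 g)) (hb : Filter.Tendsto b l (𝓝 h)) (hgh : G.src g = G.tgt h)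
    (hab : ∀ᶠ z in l, G.src (a z) = G.tgt (b z)) :
    Filter.Tendsto (fun z => G.comp (a z) (b z)) l (𝓝 (G.comp g h)) := by
  have h1 := G.comp_smooth.continuousOn (g, h) hgh
  exact h1.tendsto.comp (tendsto_nhdsWithin_iff.2 ⟨ha.prodMk_nhds hb, hab⟩)

theorem comp_inv_cancel_right {g h : G₁} (e : G.src g = G.tgt h) :
    G.comp (G.comp g h) (G.inv h) = g := by
  rw [← G.assoc _ _ _ e (G.tgt_inv h).symm, G.comp_inv, ← e, G.comp_unit]

theorem inv_comp_cancel_left {g h : G₁} (e : G.src g = G.tgt h) :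
    G.comp (G.inv g) (G.comp g h) = h := by
  rw [G.assoc _ _ _ (G.src_inv g) e, G.inv_comp, e, G.unit_comp]

theorem comp_inv_cancel_left {g h : G₁} (e : G.tgt g = G.tgt h) :
    G.comp g (G.comp (G.inv g) h) = h := by
  rw [G.assoc _ _ _ (G.tgt_inv g).symm ((G.src_inv g).trans e), G.comp_inv, e, G.unit_comp]

theorem inv_comp_cancel_right {g h : G₁} (e : G.src g = G.src h) :
    G.comp (G.comp g (G.inv h)) h = g := by
  rw [← G.assoc _ _ _ (e.trans (G.tgt_inv h).symm) (G.src_inv h), G.inv_comp, ← e, G.comp_unit]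

theorem comp_right_cancel {g g' h : G₁} (e : G.src g = G.tgt h) (e' : G.src g' = G.tgt h)
    (hh : G.comp g h = G.comp g' h) : g = g' := by
  rw [← G.comp_inv_cancel_right e, hh, G.comp_inv_cancel_right e']

theorem inv_inv (g : G₁) : G.inv (G.inv g) = g := by
  have h1 : G.src (G.inv (G.inv g)) = G.tgt (G.inv g) := G.src_inv _
  have h2 : G.src g = G.tgt (G.inv g) := (G.tgt_inv g).symm
  refine G.comp_right_cancel h1 h2 ?_
  rw [G.inv_comp, G.comp_inv, G.src_inv]

variable {G}

section Etale

variable (hG : G.IsEtale)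
include hG

theorem IsEtale.isLocalHomeomorph_src : IsLocalHomeomorph G.src :=
  IsLocalDiffeomorph.isLocalHomeomorph hG

/-- Inversion is a smooth involution that exchanges source and target. -/
theorem IsEtale.isLocalDiffeomorph_tgt : IsLocalDiffeomorph I₁ I₀ ∞ G.tgt := by
  have h1 : IsLocalDiffeomorph I₁ I₁ ∞ G.inv :=
    .of_contMDiff G.inv G.inv_smooth G.inv_smooth G.inv_inv G.inv_inv
  have h2 : G.src ∘ G.inv = G.tgt := funext G.src_inv
  rw [← h2]
  exact IsLocalDiffeomorph.comp hG h1

theorem IsEtale.isLocalHomeomorph_tgt : IsLocalHomeomorph G.tgt :=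
  hG.isLocalDiffeomorph_tgt.isLocalHomeomorph

/-- In an étale groupoid, the ineffective arrows are those near which source and target agree. -/
theorem IsEtale.isIneffective_iff {g : G₁} :
    G.IsIneffective g ↔ ∀ᶠ g' in 𝓝 g, G.src g' = G.tgt g' := by
  constructor
  · rintro ⟨σ, h1, h2, h3, h4⟩
    have h5 := hG.isLocalHomeomorph_src.eventually_section_apply h1 h2 h3
    filter_upwards [h5, G.continuous_src.continuousAt.eventually h4] with g' e1 e2
    rw [e1] at e2
    exact e2.symm
  · intro h
    obtain ⟨σ, U, hU, hxU, hσ, hσx, hr, -⟩ := (hG g).exists_section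
    have hc : ContinuousAt σ (G.src g) := hσ.continuousOn.continuousAt (hU.mem_nhds hxU)
    refine ⟨σ, hσx, hc, (hU.eventually_mem hxU).mono hr, ?_⟩
    have h' := hc.tendsto
    rw [hσx] at h'
    filter_upwards [h'.eventually h, hU.eventually_mem hxU] with y h1 h2
    rw [← h1, hr y h2]

theorem IsEtale.isOpen_setOf_isIneffective : IsOpen {g | G.IsIneffective g} := by
  rw [isOpen_iff_eventually]
  intro g hg
  have hg' := (hG.isIneffective_iff).1 hg
  filter_upwards [hg'.eventually_nhds] with g' h
  exact hG.isIneffective_iff.2 h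

omit hG in
theorem IsIneffective.tgt_eq {g : G₁} (hg : G.IsIneffective g) : G.tgt g = G.src g := by
  obtain ⟨σ, h1, -, -, h4⟩ := hg
  simpa [h1] using h4.self_of_nhds

theorem IsEtale.exists_tgt_section (k : G₁) : ∃ (τ : G₀ → G₁) (U : Set G₀), IsOpen U ∧
    G.tgt k ∈ U ∧ ContMDiffOn I₀ I₁ ∞ τ U ∧ τ (G.tgt k) = k ∧ ∀ y ∈ U, G.tgt (τ y) = y := by
  obtain ⟨τ, U, hU, hxU, hσ, hσx, hr, -⟩ := (hG.isLocalDiffeomorph_tgt k).exists_section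
  exact ⟨τ, U, hU, hxU, hσ, hσx, hr⟩

/-- Ineffective arrows are stable under conjugation. -/
theorem IsEtale.isIneffective_conj {g k : G₁} (hg : G.IsIneffective g) (hk : G.src k = G.src g) :
    G.IsIneffective (G.comp (G.comp k g) (G.inv k)) := by
  have htg := hg.tgt_eq
  obtain ⟨σ, h1, h2, h3, h4⟩ := hg
  obtain ⟨τ, U, hU, hkU, hτ, hτk, hτt⟩ := hG.exists_tgt_section k
  have hkg : G.src k = G.tgt g := hk.trans htg.symm
  have hkgk : G.src (G.comp k g) = G.tgt (G.inv k) := by rw [G.src_comp _ _ hkg, G.tgt_inv, hk]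
  have hsrc : G.src (G.comp (G.comp k g) (G.inv k)) = G.tgt k := by
    rw [G.src_comp _ _ hkgk, G.src_inv]
  have hτc : Filter.Tendsto τ (𝓝 (G.tgt k)) (𝓝 k) := by
    have := (hτ.continuousOn.continuousAt (hU.mem_nhds hkU)).tendsto
    rwa [hτk] at this
  have hsτ : Filter.Tendsto (fun y => G.src (τ y)) (𝓝 (G.tgt k)) (𝓝 (G.src g)) := by
    have := (G.continuous_src.tendsto k).comp hτc
    rwa [hk] at this
  have hσc : Filter.Tendsto σ (𝓝 (G.src g)) (𝓝 g) := by
    have := h2.tendsto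
    rwa [h1] at this
  have e1 : ∀ᶠ y in 𝓝 (G.tgt k), G.src (τ y) = G.tgt (σ (G.src (τ y))) := by
    filter_upwards [hsτ.eventually h4] with y hy using hy.symm
  have e2 : ∀ᶠ y in 𝓝 (G.tgt k), G.src (G.comp (τ y) (σ (G.src (τ y)))) = G.tgt (G.inv (τ y)) := by
    filter_upwards [hsτ.eventually h3, e1] with y hy hy'
    rw [G.src_comp _ _ hy', hy, G.tgt_inv]
  -- With `τ` a local section of the target map through `k`, the section `σ` is conjugated
  -- pointwise; its ends remain equal because those of `σ` are.
  refine ⟨fun y => G.comp (G.comp (τ y) (σ (G.src (τ y)))) (G.inv (τ y)), ?_, ?_, ?_, ?_⟩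
  · rw [hsrc]
    simp only [hτk, hk, h1]
  · rw [hsrc]
    have := G.tendsto_comp (G.tendsto_comp hτc (hσc.comp hsτ) hkg e1)
      ((G.continuous_inv.tendsto k).comp hτc) hkgk e2
    rw [ContinuousAt]
    simp only [hτk, hk, h1]
    exact this
  · rw [hsrc]
    filter_upwards [e2, hU.eventually_mem hkU] with y hy hyU
    rw [G.src_comp _ _ hy, G.src_inv, hτt y hyU]
  · rw [hsrc]
    filter_upwards [e1, e2, hU.eventually_mem hkU] with y hy hy' hyU
    rw [G.tgt_comp _ _ hy', G.tgt_comp _ _ hy, hτt y hyU]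

end Etale

/-- The conjugation isomorphism between the ineffective stabilizers of two objects connected
by an arrow. -/
theorem IsEtale.nonempty_ineffStab_mulEquiv (hG : G.IsEtale) (k : G₁) :
    Nonempty (G.IneffStab (G.src k) ≃* G.IneffStab (G.tgt k)) := by
  have key : ∀ (k : G₁) (g : G₁), G.src g = G.src k → G.tgt g = G.src k →
      G.src (G.comp k g) = G.tgt (G.inv k) ∧
      G.src (G.comp (G.comp k g) (G.inv k)) = G.tgt k ∧
      G.tgt (G.comp (G.comp k g) (G.inv k)) = G.tgt k := by
    intro k g h1 h2
    have h3 : G.src (G.comp k g) = G.tgt (G.inv k) := by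
      rw [G.src_comp _ _ h2.symm, G.tgt_inv, h1]
    exact ⟨h3, by rw [G.src_comp _ _ h3, G.src_inv], by
      rw [G.tgt_comp _ _ h3, G.tgt_comp _ _ h2.symm]⟩
  have cancel : ∀ (k g : G₁), G.src g = G.src k → G.tgt g = G.src k →
      G.comp (G.comp (G.inv k) (G.comp (G.comp k g) (G.inv k))) k = g := by
    intro k g h1 h2
    obtain ⟨h3, h4, h5⟩ := key k g h1 h2
    rw [← G.assoc _ _ _ (by rw [G.src_inv, h5]) h4, G.inv_comp_cancel_right (by
      rw [G.src_comp _ _ h2.symm, h1]), G.inv_comp_cancel_left h2.symm]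
  refine ⟨
    { toFun := fun g => ⟨⟨G.comp (G.comp k g.1.1) (G.inv k), (key k _ g.1.2.1 g.1.2.2).2⟩,
        hG.isIneffective_conj g.2 g.1.2.1.symm⟩
      invFun := fun g => ⟨⟨G.comp (G.comp (G.inv k) g.1.1) k, by
          have := (key (G.inv k) g.1.1 (by rw [G.src_inv]; exact g.1.2.1)
            (by rw [G.src_inv]; exact g.1.2.2)).2
          rwa [G.inv_inv, G.tgt_inv] at this⟩, by
          have := hG.isIneffective_conj (k := G.inv k) g.2 (by
            rw [G.src_inv]; exact g.1.2.1.symm)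
          rwa [G.inv_inv] at this⟩
      left_inv := fun g => by
        apply Subtype.ext
        apply Subtype.ext
        exact cancel k g.1.1 g.1.2.1 g.1.2.2
      right_inv := fun g => by
        apply Subtype.ext
        apply Subtype.ext
        have := cancel (G.inv k) g.1.1 (by rw [G.src_inv]; exact g.1.2.1)
            (by rw [G.src_inv]; exact g.1.2.2)
        rwa [G.inv_inv] at this
      map_mul' := fun g h => by
        apply Subtype.ext
        apply Subtype.ext
        change G.comp (G.comp k (G.comp g.1.1 h.1.1)) (G.inv k) =
          G.comp (G.comp (G.comp k g.1.1) (G.inv k)) (G.comp (G.comp k h.1.1) (G.inv k))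
        have e1 : G.src k = G.tgt g.1.1 := g.1.2.2.symm
        have e2 : G.src g.1.1 = G.tgt h.1.1 := g.1.2.1.trans h.1.2.2.symm
        have e3 : G.src k = G.tgt h.1.1 := h.1.2.2.symm
        obtain ⟨h3, h4, h5⟩ := key k g.1.1 g.1.2.1 g.1.2.2
        obtain ⟨h3', h4', h5'⟩ := key k h.1.1 h.1.2.1 h.1.2.2
        have e4 : G.src (G.comp (G.comp k g.1.1) (G.inv k)) = G.tgt (G.comp k h.1.1) := by
          rw [h4, G.tgt_comp _ _ e3]
        rw [G.assoc _ _ _ e4 h3', G.assoc _ _ _ (h4.trans rfl) e3, G.inv_comp_cancel_right (by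
          rw [G.src_comp _ _ e1]; exact g.1.2.1), G.assoc _ _ _ e1 e2] }⟩

section Proper

variable (hG : G.IsOrbifold)
include hG

/-- The stabilizer is compact by properness and lies in a fibre of the étale source map. -/
theorem IsOrbifold.finite_stab [T2Space G₀] (x : G₀) : Finite (G.Stab x) := by
  have h1 : IsCompact ((fun g : G₁ => (G.src g, G.tgt g)) ⁻¹' {(x, x)}) :=
    hG.proper.isCompact_preimage isCompact_singleton
  have h2 := hG.etale.isLocalHomeomorph_src.finite_of_isCompact_fiber h1 (y := x) (by
    intro g hg
    exact (Prod.ext_iff.1 hg).1)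
  have h3 : {g | G.src g = x ∧ G.tgt g = x}.Finite := by
    refine h2.subset ?_
    rintro g ⟨e1, e2⟩
    simp [e1, e2]
  exact h3.to_subtype

end Proper

end SmoothGroupoid

/-! ### Germs of arrows and their differentials -/

/-- A germ of finite order with identity differential is the identity. -/
theorem eventually_eq_self_of_iterate {E : Type*} [NormedAddCommGroup E] [NormedSpace ℝ E]
    {f : E → E} {p : E} (hf : HasStrictFDerivAt f (1 : E →L[ℝ] E) p) (hp : f p = p) {m : ℕ}
    (hm : 0 < m) (h : ∀ᶠ y in 𝓝 p, f^[m] y = y) : ∀ᶠ y in 𝓝 p, f y = y := by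
  -- Averaging over the cyclic group: `ψ` is invariant under `f` near `p`, while its differential at
  -- `p` is m times the identity, so it is injective near `p`; hence f y = y.
  set ψ : E → E := fun y => ∑ j ∈ Finset.range m, f^[j] y with hψ
  have h1 : HasStrictFDerivAt ψ ((m : ℝ) • (1 : E →L[ℝ] E)) p := by
    have : HasStrictFDerivAt ψ (∑ j ∈ Finset.range m, (1 : E →L[ℝ] E) ^ j) p :=
      HasStrictFDerivAt.fun_sum fun j _ => hf.iterate hp j
    simpa [Nat.cast_smul_eq_nsmul] using this
  have hψf : ∀ᶠ y in 𝓝 p, ψ (f y) = ψ y := by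
    filter_upwards [h] with y hy
    have e1 := Finset.sum_range_succ (fun j => f^[j] y) m
    have e2 := Finset.sum_range_succ' (fun j => f^[j] y) m
    rw [e1, hy] at e2
    simp only [Function.iterate_succ_apply, Function.iterate_zero_apply] at e2
    exact (add_right_cancel e2).symm
  have hm' : (0 : ℝ) < m := by exact_mod_cast hm
  -- Any constant below m serves: the estimate becomes m ‖f y - y‖ ≤ (m/2) ‖f y - y‖.
  have h2 := (hasStrictFDerivAt_iff_isLittleO.1 h1).def (c := (m : ℝ) / 2) (by positivity)
  have h3 : Filter.Tendsto (fun y => (f y, y)) (𝓝 p) (𝓝 (p, p)) := by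
    have := hf.continuousAt.tendsto
    rw [hp] at this
    exact this.prodMk_nhds Filter.tendsto_id
  filter_upwards [h3.eventually h2, hψf] with y hy hy'
  simp only [hy', sub_self, zero_sub, norm_neg] at hy
  have : ‖((m : ℝ) • (1 : E →L[ℝ] E)) (f y - y)‖ = m * ‖f y - y‖ := by
    simp [norm_smul]
  rw [this] at hy
  have h4 : ‖f y - y‖ = 0 := by
    have := norm_nonneg (f y - y)
    nlinarith
  exact sub_eq_zero.1 (norm_eq_zero.1 h4)

namespace SmoothGroupoid

section Germs

variable {E₀ : Type*} [NormedAddCommGroup E₀] [NormedSpace ℝ E₀] {B₀ : Type*} [TopologicalSpace B₀]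
  {E₁ : Type*} [NormedAddCommGroup E₁] [NormedSpace ℝ E₁] {B₁ : Type*} [TopologicalSpace B₁]
  {I₀ : ModelWithCorners ℝ E₀ B₀} {I₁ : ModelWithCorners ℝ E₁ B₁}
  {G₀ G₁ : Type*} [TopologicalSpace G₀] [ChartedSpace B₀ G₀]
  [TopologicalSpace G₁] [ChartedSpace B₁ G₁]
  {E : Type*} [NormedAddCommGroup E] [NormedSpace ℝ E]

/-- In the coordinates `χ`, the map `f` represents the germ induced by the arrow `g`. -/
def IsGerm (G : SmoothGroupoid I₀ I₁ G₀ G₁) (χ : G₀ → E) (f : E → E) (g : G₁) : Prop :=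
  ∀ᶠ g' in 𝓝 g, f (χ (G.src g')) = χ (G.tgt g')

variable {G : SmoothGroupoid I₀ I₁ G₀ G₁} {χ : G₀ → E}

theorem IsGerm.eventually {f : E → E} {g : G₁} (h : G.IsGerm χ f g) :
    ∀ᶠ g' in 𝓝 g, G.IsGerm χ f g' := h.eventually_nhds

variable (hG : G.IsEtale)
include hG

/-- The map `χ ∘ src` is a local diffeomorphism at `g`, so a property of arrows near `g` that
depends only on this coordinate is a property of points of `E`. -/
theorem IsEtale.map_nhds_coord {g : G₁} (hχ : IsLocalDiffeomorphAt I₀ 𝓘(ℝ, E) ∞ χ (G.src g)) :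
    Filter.map (fun g' => χ (G.src g')) (𝓝 g) = 𝓝 (χ (G.src g)) := by
  obtain ⟨Φ, hx, hΦ⟩ := (hG g).comp _ _ hχ
  have h1 := Φ.toOpenPartialHomeomorph.map_nhds_eq hx
  have h2 : (fun g' => χ (G.src g')) =ᶠ[𝓝 g] Φ.toOpenPartialHomeomorph := by
    filter_upwards [Φ.open_source.mem_nhds hx] with y hy using hΦ hy
  rw [Filter.map_congr h2, h1]
  congr 1
  exact (hΦ hx).symm

theorem IsGerm.eventuallyEq {f f' : E → E} {g : G₁}
    (hχ : IsLocalDiffeomorphAt I₀ 𝓘(ℝ, E) ∞ χ (G.src g)) (hf : G.IsGerm χ f g)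
    (hf' : G.IsGerm χ f' g) : f =ᶠ[𝓝 (χ (G.src g))] f' := by
  rw [Filter.EventuallyEq, ← hG.map_nhds_coord hχ, Filter.eventually_map]
  filter_upwards [hf, hf'] with g' h1 h2 using h1.trans h2.symm

/-- The germ is `χ ∘ tgt ∘ σ`, where `σ` is a smooth local inverse of `χ ∘ src`. -/
theorem IsEtale.exists_isGerm {g : G₁} (hχ : IsLocalDiffeomorphAt I₀ 𝓘(ℝ, E) ∞ χ (G.src g))
    (hχ' : ContMDiffAt I₀ 𝓘(ℝ, E) ∞ χ (G.tgt g)) :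
    ∃ f : E → E, G.IsGerm χ f g ∧ ContDiffAt ℝ ∞ f (χ (G.src g)) := by
  obtain ⟨σ, U, hU, hxU, hσ, hσx, hr, hl⟩ := ((hG g).comp _ _ hχ).exists_section
  refine ⟨fun y => χ (G.tgt (σ y)), ?_, ?_⟩
  · filter_upwards [hl] with g' h
    rw [show σ (χ (G.src g')) = g' from h]
  · rw [← contMDiffAt_iff_contDiffAt]
    have h1 : ContMDiffAt 𝓘(ℝ, E) I₁ ∞ σ (χ (G.src g)) := hσ.contMDiffAt (hU.mem_nhds hxU)
    have h2 : σ (χ (G.src g)) = g := hσx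
    refine ContMDiffAt.comp (x := χ (G.src g)) (g := fun g' => χ (G.tgt g')) ?_ h1
    rw [h2]
    exact ContMDiffAt.comp (x := g) (g := χ) hχ' (G.tgt_smooth g)

theorem IsEtale.isGerm_unit (x : G₀) : G.IsGerm χ id (G.unit x) := by
  have h : G.IsIneffective (G.unit x) := (1 : G.IneffStab x).2
  filter_upwards [hG.isIneffective_iff.1 h] with g' hg'
  rw [hg', id]

/-- An arrow near the product factors as an arrow near `g` after an arrow near `h`: the second
factor is the value at its source of the local section through `h`, the first is the remaining
quotient. -/
theorem IsGerm.comp {f f' : E → E} {g h : G₁} (hgh : G.src g = G.tgt h) (hf : G.IsGerm χ f g)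
    (hf' : G.IsGerm χ f' h) : G.IsGerm χ (f ∘ f') (G.comp g h) := by
  obtain ⟨σ, U, hU, hxU, hσ, hσx, hr, -⟩ := (hG h).exists_section
  have hs : Filter.Tendsto G.src (𝓝 (G.comp g h)) (𝓝 (G.src h)) := by
    have := G.continuous_src.tendsto (G.comp g h)
    rwa [G.src_comp _ _ hgh] at this
  have hσc : Filter.Tendsto (fun k => σ (G.src k)) (𝓝 (G.comp g h)) (𝓝 h) := by
    have := (hσ.continuousOn.continuousAt (hU.mem_nhds hxU)).tendsto
    rw [hσx] at this
    exact this.comp hs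
  have hsσ : ∀ᶠ k in 𝓝 (G.comp g h), G.src k = G.src (σ (G.src k)) := by
    filter_upwards [hs.eventually (hU.eventually_mem hxU)] with k hk using (hr _ hk).symm
  have hsσ' : ∀ᶠ k in 𝓝 (G.comp g h), G.src k = G.tgt (G.inv (σ (G.src k))) := by
    filter_upwards [hsσ] with k hk
    rwa [G.tgt_inv]
  have hk : Filter.Tendsto (fun k => G.comp k (G.inv (σ (G.src k)))) (𝓝 (G.comp g h)) (𝓝 g) := by
    have := G.tendsto_comp Filter.tendsto_id ((G.continuous_inv.tendsto h).comp hσc)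
      (by rw [G.src_comp _ _ hgh, G.tgt_inv]) hsσ'
    rwa [G.comp_inv_cancel_right hgh] at this
  filter_upwards [hk.eventually hf, hσc.eventually hf', hsσ, hsσ'] with k h1 h2 h3 h4
  rw [Function.comp]
  rw [G.src_comp _ _ h4, G.src_inv, G.tgt_comp _ _ h4] at h1
  rw [h3, h2, h1]

theorem IsGerm.iterate {f : E → E} {x : G₀} {g : G.Stab x} (hf : G.IsGerm χ f g.1) (m : ℕ) :
    G.IsGerm χ f^[m] (g ^ m).1 := by
  induction m with
  | zero => exact hG.isGerm_unit x
  | succ m ih =>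
    rw [pow_succ', Function.iterate_succ']
    exact IsGerm.comp hG (g.2.1.trans (g ^ m).2.2.symm) hf ih

omit hG in
/-- A stabilizer arrow of finite order whose germ has identity differential is ineffective. -/
theorem IsOrbifold.isIneffective_of_fderiv [T2Space G₀] (hG : G.IsOrbifold) {x : G₀}
    (g : G.Stab x) (hχ : IsLocalDiffeomorphAt I₀ 𝓘(ℝ, E) ∞ χ x) {f : E → E}
    (hf : G.IsGerm χ f g.1) (hd : fderiv ℝ f (χ x) = 1) : G.IsIneffective g.1 := by
  have hχs : IsLocalDiffeomorphAt I₀ 𝓘(ℝ, E) ∞ χ (G.src g.1) := by rwa [g.2.1]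
  have hχt : IsLocalDiffeomorphAt I₀ 𝓘(ℝ, E) ∞ χ (G.tgt g.1) := by rwa [g.2.2]
  obtain ⟨f', hf', hc⟩ := hG.etale.exists_isGerm hχs hχt.contMDiffAt
  have hff := IsGerm.eventuallyEq hG.etale hχs hf hf'
  have hc' : ContDiffAt ℝ ∞ f (χ (G.src g.1)) := hc.congr_of_eventuallyEq hff
  rw [g.2.1] at hc'
  have hs : HasStrictFDerivAt f (1 : E →L[ℝ] E) (χ x) := hd ▸ hc'.hasStrictFDerivAt (by simp)
  have hfx : f (χ x) = χ x := by
    have := hf.self_of_nhds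
    rwa [g.2.1, g.2.2] at this
  have := hG.finite_stab x
  -- The stabilizer is finite, so some power of `g` is a unit, whose germ is the identity.
  have hpow : ∀ᶠ y in 𝓝 (χ x), f^[orderOf g] y = y := by
    have h1 := IsGerm.iterate hG.etale hf (orderOf g)
    have hx : G.src (G.unit x) = x := G.src_unit x
    rw [pow_orderOf_eq_one] at h1
    have h2 := IsGerm.eventuallyEq hG.etale (g := G.unit x) (by rwa [hx]) h1
      (hG.etale.isGerm_unit x)
    rwa [hx] at h2
  have hid := eventually_eq_self_of_iterate hs hfx (orderOf_pos g) hpow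
  rw [hG.etale.isIneffective_iff]
  have h1 : ∀ᶠ g' in 𝓝 g.1, χ (G.src g') = χ (G.tgt g') := by
    have h2 : Filter.Tendsto (fun g' => χ (G.src g')) (𝓝 g.1) (𝓝 (χ x)) := by
      have := (hG.etale.map_nhds_coord hχs).le
      rwa [g.2.1] at this
    filter_upwards [hf, h2.eventually hid] with g' h3 h4
    exact h4.symm.trans h3
  obtain ⟨Φ, hx, hΦ⟩ := hχ
  have h3 : Filter.Tendsto G.src (𝓝 g.1) (𝓝 x) := by
    have := G.continuous_src.tendsto g.1
    rwa [g.2.1] at this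
  have h4 : Filter.Tendsto G.tgt (𝓝 g.1) (𝓝 x) := by
    have := G.continuous_tgt.tendsto g.1
    rwa [g.2.2] at this
  filter_upwards [h1, h3 (Φ.open_source.mem_nhds hx), h4 (Φ.open_source.mem_nhds hx)]
    with g' e1 e2 e3
  refine Φ.injOn e2 e3 ?_
  rw [hΦ e2, hΦ e3] at e1
  exact e1

end Germs

/-! ### The local system of ineffective stabilizers -/

section LocalSystem

variable {n : ℕ} {G₀ G₁ : Type*}
    [TopologicalSpace G₀] [ChartedSpace (EuclideanSpace ℝ (Fin n)) G₀]
    [TopologicalSpace G₁] [ChartedSpace (EuclideanSpace ℝ (Fin n)) G₁]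
    {G : SmoothGroupoid (𝓡 n) (𝓡 n) G₀ G₁}

theorem isLocalDiffeomorphAt_chartAt {G₀ : Type*} [TopologicalSpace G₀]
    [ChartedSpace (EuclideanSpace ℝ (Fin n)) G₀] [IsManifold (𝓡 n) ∞ G₀] {x y : G₀}
    (hy : y ∈ (chartAt (EuclideanSpace ℝ (Fin n)) x).source) :
    IsLocalDiffeomorphAt (𝓡 n) (𝓡 n) ∞ (chartAt (EuclideanSpace ℝ (Fin n)) x) y :=
  .of_openPartialHomeomorph _ hy (fun _ _ => rfl) contMDiffOn_chart contMDiffOn_chart_symm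

/-- The ineffective arrows of an orbifold groupoid form a closed set. -/
theorem IsOrbifold.isClosed_setOf_isIneffective [IsManifold (𝓡 n) ∞ G₀] [T2Space G₀]
    (hG : G.IsOrbifold) : IsClosed {g | G.IsIneffective g} := by
  refine isClosed_iff_frequently.2 fun g hg => ?_
  have hst : G.src g = G.tgt g := by
    have hc : IsClosed {g | G.src g = G.tgt g} := isClosed_eq G.continuous_src G.continuous_tgt
    refine (isClosed_iff_frequently.1 hc) g (hg.mono fun g' h => h.tgt_eq.symm)
  set x := G.src g with hx
  set χ : G₀ → EuclideanSpace ℝ (Fin n) := ⇑(chartAt (EuclideanSpace ℝ (Fin n)) x)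
  have hχ : ∀ y ∈ (chartAt (EuclideanSpace ℝ (Fin n)) x).source,
      IsLocalDiffeomorphAt (𝓡 n) (𝓡 n) ∞ χ y := fun y hy => isLocalDiffeomorphAt_chartAt hy
  have hxs := mem_chart_source (EuclideanSpace ℝ (Fin n)) x
  obtain ⟨f, hf, hc⟩ := hG.etale.exists_isGerm (χ := χ) (g := g) (hχ _ hxs)
    (by rw [← hst]; exact (hχ _ hxs).contMDiffAt)
  have hsrc : ∀ᶠ g' in 𝓝 g, G.src g' ∈ (chartAt (EuclideanSpace ℝ (Fin n)) x).source :=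
    G.continuous_src.continuousAt.eventually
      ((chartAt (EuclideanSpace ℝ (Fin n)) x).open_source.mem_nhds hxs)
  -- One map `f` represents the germs of all arrows near `g`. It has identity differential at the
  -- sources of the ineffective ones, which accumulate at `g`, hence also at the source of `g` by
  -- continuity.
  have hfr : ∃ᶠ g' in 𝓝 g, fderiv ℝ f (χ (G.src g')) = 1 := by
    refine (hg.and_eventually (hf.eventually.and hsrc)).mono ?_
    rintro g' ⟨h1, h2, h3⟩
    have h4 : G.IsGerm χ id g' := by
      filter_upwards [hG.etale.isIneffective_iff.1 h1] with g'' h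
      rw [h, id]
    have h5 := IsGerm.eventuallyEq hG.etale (hχ _ h3) h2 h4
    rw [h5.fderiv_eq, fderiv_id]
    rfl
  have hcont : Filter.Tendsto (fun g' => fderiv ℝ f (χ (G.src g'))) (𝓝 g)
      (𝓝 (fderiv ℝ f (χ x))) := by
    have h1 : ContinuousAt (fderiv ℝ f) (χ x) :=
      (hc.fderiv_right (m := 0) (by simp)).continuousAt
    exact h1.tendsto.comp (hG.etale.map_nhds_coord (hχ _ hxs)).le
  have hd : fderiv ℝ f (χ x) = 1 := by
    by_contra hne
    exact hfr (hcont.eventually_ne hne)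
  exact hG.isIneffective_of_fderiv ⟨g, rfl, hst.symm⟩ (hχ x hxs) hf hd

/-- On `V`, the map `θ` is a trivialization with fibre `T` of the local system of ineffective
stabilizers. -/
structure IneffTrivOn {E₀ : Type*} [NormedAddCommGroup E₀] [NormedSpace ℝ E₀] {B₀ : Type*}
    [TopologicalSpace B₀] {E₁ : Type*} [NormedAddCommGroup E₁] [NormedSpace ℝ E₁] {B₁ : Type*}
    [TopologicalSpace B₁] {I₀ : ModelWithCorners ℝ E₀ B₀} {I₁ : ModelWithCorners ℝ E₁ B₁}
    {G₀ G₁ : Type*} [TopologicalSpace G₀] [ChartedSpace B₀ G₀]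
    [TopologicalSpace G₁] [ChartedSpace B₁ G₁] (G : SmoothGroupoid I₀ I₁ G₀ G₁)
    (T : Type*) [Group T] (V : Set G₀) (θ : G₀ → T → G₁) : Prop where
  src : ∀ y ∈ V, ∀ z, G.src (θ y z) = y
  ineffective : ∀ y ∈ V, ∀ z, G.IsIneffective (θ y z)
  map_mul : ∀ y ∈ V, ∀ z w, θ y (z * w) = G.comp (θ y z) (θ y w)
  injective : ∀ y ∈ V, Function.Injective (θ y)
  surjective : ∀ g, G.src g ∈ V → G.IsIneffective g → ∃ z, θ (G.src g) z = g
  continuousOn : ∀ z, ContinuousOn (fun y => θ y z) V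

theorem IneffTrivOn.tgt {T : Type*} [Group T] {V : Set G₀} {θ : G₀ → T → G₁}
    (h : G.IneffTrivOn T V θ) {y : G₀} (hy : y ∈ V) (z : T) : G.tgt (θ y z) = y := by
  rw [(h.ineffective y hy z).tgt_eq, h.src y hy]

theorem IneffTrivOn.precomp {T T' : Type*} [Group T] [Group T'] {V : Set G₀} {θ : G₀ → T → G₁}
    (h : G.IneffTrivOn T V θ) (e : T' ≃* T) : G.IneffTrivOn T' V (fun y z => θ y (e z)) where
  src y hy z := h.src y hy _
  ineffective y hy z := h.ineffective y hy _
  map_mul y hy z w := by rw [_root_.map_mul, h.map_mul y hy]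
  injective y hy := (h.injective y hy).comp e.injective
  surjective g hg hg' := by
    obtain ⟨z, hz⟩ := h.surjective g hg hg'
    exact ⟨e.symm z, by simpa using hz⟩
  continuousOn z := h.continuousOn _

theorem IneffTrivOn.nonempty_mulEquiv {T : Type*} [Group T] {V : Set G₀} {θ : G₀ → T → G₁}
    (h : G.IneffTrivOn T V θ) {y : G₀} (hy : y ∈ V) : Nonempty (T ≃* G.IneffStab y) := by
  let f : T → G.IneffStab y := fun z =>
    ⟨⟨θ y z, h.src y hy z, h.tgt hy z⟩, h.ineffective y hy z⟩
  refine ⟨{ Equiv.ofBijective f ⟨?_, ?_⟩ with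
    map_mul' := fun z w => Subtype.ext (Subtype.ext (h.map_mul y hy z w)) }⟩
  · intro z w hzw
    exact h.injective y hy (congrArg (fun a => a.1.1) hzw)
  · rintro ⟨⟨g, hs, ht⟩, hg⟩
    subst hs
    obtain ⟨z, hz⟩ := h.surjective g hy hg
    exact ⟨z, Subtype.ext (Subtype.ext hz)⟩

/-- The ineffective stabilizers of an orbifold groupoid form a local system of finite groups. -/
theorem IsOrbifold.exists_ineffTrivOn [IsManifold (𝓡 n) ∞ G₀] [T2Space G₀] [T2Space G₁]
    (hG : G.IsOrbifold) (x : G₀) :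
    ∃ (V : Set G₀) (θ : G₀ → G.IneffStab x → G₁), IsOpen V ∧ x ∈ V ∧
      G.IneffTrivOn (G.IneffStab x) V θ := by
  have := hG.finite_stab x
  have hloc := hG.etale.isLocalHomeomorph_src
  have hsec : ∀ g : G.IneffStab x, ∃ σ : G₀ → G₁, σ x = g.1.1 ∧
      (∀ᶠ y in 𝓝 x, ContinuousAt σ y) ∧ (∀ᶠ y in 𝓝 x, G.src (σ y) = y) ∧
      ∀ᶠ y in 𝓝 x, G.IsIneffective (σ y) := by
    intro g
    obtain ⟨σ, U, hU, hxU, hσ, hσx, hr, -⟩ := (hG.etale g.1.1).exists_section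
    have hsg : G.src g.1.1 = x := g.1.2.1
    rw [hsg] at hxU hσx
    have hc : ∀ y ∈ U, ContinuousAt σ y := fun y hy =>
      hσ.continuousOn.continuousAt (hU.mem_nhds hy)
    refine ⟨σ, hσx, (hU.eventually_mem hxU).mono hc, (hU.eventually_mem hxU).mono hr, ?_⟩
    have h1 := (hc x hxU).tendsto
    rw [hσx] at h1
    exact h1.eventually (hG.etale.isOpen_setOf_isIneffective.mem_nhds g.2)
  choose σ hσx hσc hσs hσi using hsec
  have hlim : ∀ g, Filter.Tendsto (σ g) (𝓝 x) (𝓝 g.1.1) := fun g => by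
    have := (hσc g).self_of_nhds.tendsto
    rwa [hσx] at this
  have hmul : ∀ g h, ∀ᶠ y in 𝓝 x, σ (g * h) y = G.comp (σ g y) (σ h y) := by
    intro g h
    have hgh : G.src g.1.1 = G.tgt h.1.1 := g.1.2.1.trans h.1.2.2.symm
    have e1 : ∀ᶠ y in 𝓝 x, G.src (σ g y) = G.tgt (σ h y) := by
      filter_upwards [hσs g, hσs h, hσi h] with y h1 h2 h3
      rw [h1, h3.tgt_eq, h2]
    refine hloc.eventually_unique_lift (x := G.comp g.1.1 h.1.1) (hlim (g * h))
      (G.tendsto_comp (hlim g) (hlim h) hgh e1) ?_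
    filter_upwards [e1, hσs (g * h), hσs h] with y h1 h2 h3
    rw [h2, G.src_comp _ _ h1, h3]
  have hinj : ∀ g h, ∀ᶠ y in 𝓝 x, σ g y = σ h y → g = h := by
    intro g h
    by_cases hgh : g = h
    · exact Filter.Eventually.of_forall fun _ _ => hgh
    · have hne : g.1.1 ≠ h.1.1 := fun e => hgh (Subtype.ext (Subtype.ext e))
      filter_upwards [((hlim g).prodMk_nhds (hlim h)).eventually
        (isOpen_ne_fun continuous_fst continuous_snd |>.mem_nhds hne)] with y h1 h2
      exact absurd h2 h1
  have hsurj : ∀ᶠ y in 𝓝 x, ∀ g, G.src g = y → G.IsIneffective g → ∃ z, σ z y = g := by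
    -- `W` is open since the ineffective arrows form a closed set, and it contains every arrow over
    -- (x, x). By properness it contains every arrow over (y, y) for y near x, so no ineffective
    -- arrow there escapes the sections.
    set W : Set G₁ := {g | G.IsIneffective g}ᶜ ∪ interior {g | ∃ z, σ z (G.src g) = g}
    have hW : IsOpen W := hG.isClosed_setOf_isIneffective.isOpen_compl.union isOpen_interior
    have h1 : ∀ g, (G.src g, G.tgt g) = (x, x) → g ∈ W := by
      intro g hg
      obtain ⟨e1, e2⟩ := Prod.ext_iff.1 hg
      simp only at e1 e2
      by_cases hi : G.IsIneffective g
      · right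
        let z : G.IneffStab x := ⟨⟨g, e1, e2⟩, hi⟩
        have h2 := hloc.eventually_section_apply (x := g) (σ := σ z) (by rw [e1, hσx])
          (by rw [e1]; exact (hσc z).self_of_nhds) (by rw [e1]; exact hσs z)
        rw [mem_interior_iff_mem_nhds]
        filter_upwards [h2] with g' hg' using ⟨z, hg'⟩
      · exact Or.inl hi
    have h2 := hG.proper.isClosedMap.eventually_fiber_subset hW h1
    have h3 : Filter.Tendsto (fun y : G₀ => (y, y)) (𝓝 x) (𝓝 (x, x)) :=
      Filter.tendsto_id.prodMk_nhds Filter.tendsto_id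
    filter_upwards [h3.eventually h2] with y hy g hg hi
    rcases hy g (by rw [hi.tgt_eq, hg]) with h | h
    · exact absurd hi h
    · obtain ⟨z, hz⟩ := interior_subset h
      exact ⟨z, by rw [← hg, hz]⟩
  have hall := (Filter.eventually_all.2 hσc).and <| (Filter.eventually_all.2 hσs).and <|
    (Filter.eventually_all.2 hσi).and <|
    (Filter.eventually_all.2 fun g => Filter.eventually_all.2 (hmul g)).and <|
    (Filter.eventually_all.2 fun g => Filter.eventually_all.2 (hinj g)).and hsurj
  obtain ⟨V, hV, hVo, hxV⟩ := eventually_nhds_iff.1 hall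
  refine ⟨V, fun y z => σ z y, hVo, hxV,
    { src := fun y hy z => (hV y hy).2.1 z
      ineffective := fun y hy z => (hV y hy).2.2.1 z
      map_mul := fun y hy z w => (hV y hy).2.2.2.1 z w
      injective := fun y hy z w h => (hV y hy).2.2.2.2.1 z w h
      surjective := fun g hg hi => (hV _ hg).2.2.2.2.2 g rfl hi
      continuousOn := fun z y hy => ((hV y hy).1 z).continuousWithinAt }⟩

/-- Over a connected coarse space, all ineffective stabilizers are isomorphic. -/
theorem IsOrbifold.nonempty_ineffStab_mulEquiv [IsManifold (𝓡 n) ∞ G₀] [T2Space G₀] [T2Space G₁]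
    (hG : G.IsOrbifold) (hconn : ConnectedSpace G.Coarse) (x y : G₀) :
    Nonempty (G.IneffStab x ≃* G.IneffStab y) := by
  -- This set of orbits is well defined by conjugation and clopen by local triviality.
  let S : Set G.Coarse := {p | ∀ y, G.proj y = p → Nonempty (G.IneffStab x ≃* G.IneffStab y)}
  have hsat : ∀ y, G.proj y ∈ S ↔ Nonempty (G.IneffStab x ≃* G.IneffStab y) := by
    intro y
    refine ⟨fun h => h y rfl, ?_⟩
    rintro ⟨e⟩ z hz
    obtain ⟨g, rfl, rfl⟩ : ∃ g, G.src g = y ∧ G.tgt g = z := Quotient.exact hz.symm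
    obtain ⟨e'⟩ := hG.etale.nonempty_ineffStab_mulEquiv g
    exact ⟨e.trans e'⟩
  have hloc : ∀ y : G₀, ∀ᶠ z in 𝓝 y, Nonempty (G.IneffStab y ≃* G.IneffStab z) := by
    intro y
    obtain ⟨V, θ, hV, hyV, hθ⟩ := hG.exists_ineffTrivOn y
    exact (hV.eventually_mem hyV).mono fun z hz => hθ.nonempty_mulEquiv hz
  have hS : IsClopen S := by
    constructor
    · rw [← isOpen_compl_iff, ← isQuotientMap_quotient_mk'.isOpen_preimage]
      rw [isOpen_iff_eventually]
      intro y hy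
      filter_upwards [hloc y] with z hz
      rintro hz'
      obtain ⟨e⟩ := (hsat z).1 hz'
      obtain ⟨e'⟩ := hz
      exact hy ((hsat y).2 ⟨e.trans e'.symm⟩)
    · rw [← isQuotientMap_quotient_mk'.isOpen_preimage, isOpen_iff_eventually]
      intro y hy
      obtain ⟨e⟩ := (hsat y).1 hy
      filter_upwards [hloc y] with z hz
      obtain ⟨e'⟩ := hz
      exact (hsat z).2 ⟨e.trans e'⟩
  have huniv : S = Set.univ := hS.eq_univ ⟨G.proj x, (hsat x).2 ⟨MulEquiv.refl _⟩⟩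
  exact (hsat y).1 (huniv ▸ Set.mem_univ _)

end LocalSystem

end SmoothGroupoid

/-! ### Base change of local homeomorphisms and of proper maps -/

section Topology

variable {X Y : Type*} [TopologicalSpace X] [TopologicalSpace Y]

/-- Continuous local sections through every point make `p` open; an open continuous map that is
locally injective is a local homeomorphism. -/
theorem isLocalHomeomorph_of_exists_section {p : X → Y} (hp : Continuous p)
    (hinj : ∀ x, ∃ N ∈ 𝓝 x, Set.InjOn p N)
    (hsec : ∀ x, ∃ U : Set Y, IsOpen U ∧ ∃ (h : p x ∈ U) (s : U → X), Continuous s ∧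
      s ⟨p x, h⟩ = x ∧ ∀ u, p (s u) = u) : IsLocalHomeomorph p := by
  have hopen : IsOpenMap p := by
    refine isOpenMap_iff_nhds_le.2 fun x => ?_
    obtain ⟨U, hU, h, s, hs, hsx, hps⟩ := hsec x
    have h1 : Filter.map (Subtype.val : U → Y) (𝓝 ⟨p x, h⟩) = 𝓝 (p x) := by
      rw [map_nhds_subtype_val, hU.nhdsWithin_eq h]
    have h2 : (Subtype.val : U → Y) = p ∘ s := funext fun u => (hps u).symm
    rw [← h1, h2, ← Filter.map_map]
    refine Filter.map_mono ?_
    have := hs.tendsto ⟨p x, h⟩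
    rwa [hsx] at this
  rw [isLocalHomeomorph_iff_isOpenEmbedding_restrict]
  intro x
  obtain ⟨N, hN, hi⟩ := hinj x
  obtain ⟨N', hN', hNo, hx⟩ := mem_nhds_iff.1 hN
  refine ⟨N', hNo.mem_nhds hx, .of_continuous_injective_isOpenMap
    (hp.comp continuous_subtype_val) ?_ (hopen.domRestrict hNo)⟩
  exact Set.injOn_iff_injective.1 (hi.mono hN')

theorem IsLocalHomeomorph.pullback_fst {Z : Type*} [TopologicalSpace Z] {π : Z → Y}
    (hπ : IsLocalHomeomorph π) {f : X → Y} (hf : Continuous f) :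
    IsLocalHomeomorph (fun a : f.Pullback π => a.1.1) := by
  refine isLocalHomeomorph_of_exists_section (by fun_prop) ?_ ?_
  · intro a
    obtain ⟨e, he, rfl⟩ := hπ a.1.2
    refine ⟨{b | b.1.2 ∈ e.source}, (e.open_source.preimage (by fun_prop)).mem_nhds he, ?_⟩
    rintro ⟨⟨x, z⟩, hb⟩ hz ⟨⟨x', z'⟩, hb'⟩ hz' (rfl : x = x')
    have : z = z' := e.injOn hz hz' (hb.symm.trans hb')
    subst this
    rfl
  · intro a
    obtain ⟨e, he, rfl⟩ := hπ a.1.2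
    have hfa : f a.1.1 = e a.1.2 := a.2
    refine ⟨f ⁻¹' e.target, e.open_target.preimage hf, ?_,
      fun u => ⟨(u, e.symm (f u)), (e.right_inv u.2).symm⟩, ?_, ?_, fun _ => rfl⟩
    · change f a.1.1 ∈ e.target
      rw [hfa]
      exact e.map_source he
    · refine Continuous.subtype_mk (continuous_subtype_val.prodMk ?_) _
      exact e.symm.continuousOn.comp_continuous (hf.comp continuous_subtype_val) fun u => u.2
    · apply Subtype.ext
      refine Prod.ext rfl ?_
      change e.symm (f a.1.1) = a.1.2
      rw [hfa, e.left_inv he]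

/-- `hind` and `hsurj` present `X'` as the fibre product topologically. An ultrafilter with
convergent image under `f'` is pushed to `X`, where properness of `f` supplies a limit; the two
limits are matched by a point of `X'`. -/
theorem IsProperMap.of_pullback {X' Y' : Type*} [TopologicalSpace X'] [TopologicalSpace Y']
    {f : X → Y} (hf : IsProperMap f) {f' : X' → Y'} {q : X' → X} {r : Y' → Y} (hf' : Continuous f')
    (hr : Continuous r) (hcomm : ∀ x, f (q x) = r (f' x))
    (hind : Topology.IsInducing (fun x => (q x, f' x)))
    (hsurj : ∀ x y, f x = r y → ∃ x', q x' = x ∧ f' x' = y) : IsProperMap f' := by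
  rw [isProperMap_iff_ultrafilter]
  refine ⟨hf', fun 𝒰 y hy => ?_⟩
  have h1 : Filter.Tendsto f (𝒰.map q) (𝓝 (r y)) := by
    rw [Filter.Tendsto, Ultrafilter.coe_map, Filter.map_map]
    have : f ∘ q = r ∘ f' := funext hcomm
    rw [this]
    exact (hr.tendsto y).comp hy
  obtain ⟨x, hx, hxU⟩ := hf.ultrafilter_le_nhds_of_tendsto h1
  obtain ⟨x', rfl, rfl⟩ := hsurj x y hx
  refine ⟨x', rfl, ?_⟩
  rw [hind.nhds_eq_comap, ← Filter.map_le_iff_le_comap]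
  exact Filter.Tendsto.prodMk_nhds hxU hy

end Topology

namespace SmoothGroupoid

/-! ### The groupoid pulled back along an étale map -/

section Pullback

variable {n : ℕ} {G₀ G₁ M : Type*}
    [TopologicalSpace G₀] [ChartedSpace (EuclideanSpace ℝ (Fin n)) G₀]
    [TopologicalSpace G₁] [ChartedSpace (EuclideanSpace ℝ (Fin n)) G₁]
    [TopologicalSpace M] [ChartedSpace (EuclideanSpace ℝ (Fin n)) M]
    (G : SmoothGroupoid (𝓡 n) (𝓡 n) G₀ G₁) (π : M → G₀)

/-- Pairs of an arrow of `G` and a lift of its target along `π`. -/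
abbrev TgtLift : Type _ := G.tgt.Pullback π

/-- The arrows of the groupoid pulled back along `π`: arrows of `G` with lifts of target and
source. -/
abbrev PullArrow : Type _ := (fun b : G.TgtLift π => G.src b.1.1).Pullback π

variable {G π}

/-- The underlying arrow. -/
def PullArrow.arr (a : G.PullArrow π) : G₁ := a.1.1.1.1

/-- The lift of the target. -/
def PullArrow.top (a : G.PullArrow π) : M := a.1.1.1.2

/-- The lift of the source. -/
def PullArrow.bot (a : G.PullArrow π) : M := a.1.2

theorem PullArrow.tgt_arr (a : G.PullArrow π) : G.tgt a.arr = π a.top := a.1.1.2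

theorem PullArrow.src_arr (a : G.PullArrow π) : G.src a.arr = π a.bot := a.2

/-- The arrow of the pulled back groupoid with given components. -/
def PullArrow.mk (m : M) (g : G₁) (m' : M) (h : G.tgt g = π m) (h' : G.src g = π m') :
    G.PullArrow π := ⟨(⟨(g, m), h⟩, m'), h'⟩

theorem PullArrow.ext {a b : G.PullArrow π} (h1 : a.top = b.top) (h2 : a.arr = b.arr)
    (h3 : a.bot = b.bot) : a = b :=
  Subtype.ext (Prod.ext (Subtype.ext (Prod.ext h2 h1)) h3)

theorem PullArrow.continuous_arr : Continuous (PullArrow.arr : G.PullArrow π → G₁) := by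
  unfold PullArrow.arr; fun_prop

theorem PullArrow.continuous_top : Continuous (PullArrow.top : G.PullArrow π → M) := by
  unfold PullArrow.top; fun_prop

theorem PullArrow.continuous_bot : Continuous (PullArrow.bot : G.PullArrow π → M) := by
  unfold PullArrow.bot; fun_prop

/-- The components are paired as required by `IsProperMap.of_pullback` for the square of `(src,
tgt)` over π × π. -/
theorem PullArrow.isInducing :
    Topology.IsInducing (fun a : G.PullArrow π => (a.arr, (a.bot, a.top))) := by
  have h1 : Topology.IsInducing (fun a : G.PullArrow π => ((a.arr, a.top), a.bot)) :=
    (Topology.IsInducing.subtypeVal.prodMap Topology.IsInducing.id).comp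
      Topology.IsInducing.subtypeVal
  have h2 : Topology.IsInducing (fun q : (G₁ × M) × M => (q.1.1, (q.2, q.1.2))) :=
    (Homeomorph.isInducing ⟨⟨fun q : (G₁ × M) × M => (q.1.1, (q.2, q.1.2)),
      fun q => ((q.1, q.2.2), q.2.1), fun _ => rfl, fun _ => rfl⟩, by fun_prop, by fun_prop⟩)
  exact h2.comp h1

theorem PullArrow.continuousOn_iff {Z : Type*} [TopologicalSpace Z] {s : Set Z}
    {f : Z → G.PullArrow π} : ContinuousOn f s ↔ ContinuousOn (fun z => (f z).arr) s ∧
      ContinuousOn (fun z => (f z).bot) s ∧ ContinuousOn (fun z => (f z).top) s := by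
  constructor
  · intro h
    exact ⟨continuous_arr.comp_continuousOn h, continuous_bot.comp_continuousOn h,
      continuous_top.comp_continuousOn h⟩
  · rintro ⟨h1, h2, h3⟩
    exact PullArrow.isInducing.continuousOn_iff.2 (h1.prodMk (h2.prodMk h3))

theorem PullArrow.continuous_iff {Z : Type*} [TopologicalSpace Z]
    {f : Z → G.PullArrow π} : Continuous f ↔ Continuous (fun z => (f z).arr) ∧
      Continuous (fun z => (f z).bot) ∧ Continuous (fun z => (f z).top) := by
  simp only [← continuousOn_univ, PullArrow.continuousOn_iff]

/-- Forgetting the two lifts one after the other gives two base changes of `π`. -/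
theorem PullArrow.isLocalHomeomorph_arr (hπ : IsLocalHomeomorph π) :
    IsLocalHomeomorph (PullArrow.arr : G.PullArrow π → G₁) :=
  (hπ.pullback_fst G.continuous_tgt).comp (hπ.pullback_fst
    (f := fun b : G.TgtLift π => G.src b.1.1) (G.continuous_src.comp (by fun_prop)))

open Classical in
/-- Composition of arrows of the pulled back groupoid. -/
noncomputable def PullArrow.comp (a b : G.PullArrow π) : G.PullArrow π :=
  -- Composability in `G` is implied by that in the pullback; the value in the other case is
  -- arbitrary.
  if h : G.src a.arr = G.tgt b.arr then
    .mk a.top (G.comp a.arr b.arr) b.bot ((G.tgt_comp _ _ h).trans a.tgt_arr)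
      ((G.src_comp _ _ h).trans b.src_arr)
  else a

theorem PullArrow.src_eq_tgt {a b : G.PullArrow π} (h : a.bot = b.top) :
    G.src a.arr = G.tgt b.arr := by
  rw [a.src_arr, b.tgt_arr, h]

theorem PullArrow.arr_comp {a b : G.PullArrow π} (h : a.bot = b.top) :
    (a.comp b).arr = G.comp a.arr b.arr := by
  rw [PullArrow.comp, dif_pos (src_eq_tgt h)]
  rfl

theorem PullArrow.top_comp {a b : G.PullArrow π} (h : a.bot = b.top) :
    (a.comp b).top = a.top := by
  rw [PullArrow.comp, dif_pos (src_eq_tgt h)]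
  rfl

theorem PullArrow.bot_comp {a b : G.PullArrow π} (h : a.bot = b.top) :
    (a.comp b).bot = b.bot := by
  rw [PullArrow.comp, dif_pos (src_eq_tgt h)]
  rfl

variable [ChartedSpace (EuclideanSpace ℝ (Fin n)) (G.PullArrow π)] (hG : G.IsEtale)
  (hπ : IsLocalDiffeomorph (𝓡 n) (𝓡 n) ∞ π)
  (hA : IsLocalDiffeomorph (𝓡 n) (𝓡 n) ∞ (PullArrow.arr : G.PullArrow π → G₁))

include hG hπ hA in
-- Cancel `π` in π ∘ bot = src ∘ arr. The smooth structure on the arrows enters only through `hA`,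
-- that is, as the one pulled back from `G₁`.
theorem PullArrow.isLocalDiffeomorph_bot :
    IsLocalDiffeomorph (𝓡 n) (𝓡 n) ∞ (PullArrow.bot : G.PullArrow π → M) := by
  refine hπ.of_comp ?_ PullArrow.continuous_bot
  have : π ∘ PullArrow.bot = G.src ∘ (PullArrow.arr : G.PullArrow π → G₁) :=
    funext fun a => a.src_arr.symm
  rw [this]
  exact IsLocalDiffeomorph.comp hG hA

/-- The groupoid pulled back along a local diffeomorphism into its objects. -/
noncomputable def pullback : SmoothGroupoid (𝓡 n) (𝓡 n) M (G.PullArrow π) where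
  src := PullArrow.bot
  tgt := PullArrow.top
  unit m := .mk m (G.unit (π m)) m (G.tgt_unit _) (G.src_unit _)
  inv a := .mk a.bot (G.inv a.arr) a.top ((G.tgt_inv _).trans a.src_arr)
    ((G.src_inv _).trans a.tgt_arr)
  comp := PullArrow.comp
  src_submersion := ⟨(PullArrow.isLocalDiffeomorph_bot hG hπ hA).contMDiff,
    (PullArrow.isLocalDiffeomorph_bot hG hπ hA).surjective_mfderiv⟩
  tgt_smooth := by
    refine hπ.contMDiff_of_comp PullArrow.continuous_top ?_
    have : π ∘ PullArrow.top = G.tgt ∘ (PullArrow.arr : G.PullArrow π → G₁) :=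
      funext fun a => a.tgt_arr.symm
    rw [this]
    exact G.tgt_smooth.comp hA.contMDiff
  unit_smooth := by
    refine hA.contMDiff_of_comp (PullArrow.continuous_iff.2 ⟨?_, continuous_id, continuous_id⟩)
      (G.unit_smooth.comp hπ.contMDiff)
    exact G.continuous_unit.comp hπ.contMDiff.continuous
  inv_smooth := by
    refine hA.contMDiff_of_comp (PullArrow.continuous_iff.2
      ⟨?_, PullArrow.continuous_top, PullArrow.continuous_bot⟩) (G.inv_smooth.comp hA.contMDiff)
    exact G.continuous_inv.comp PullArrow.continuous_arr
  comp_smooth := by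
    have h1 : ContMDiffOn ((𝓡 n).prod (𝓡 n)) (𝓡 n) ∞
        (fun p : G.PullArrow π × G.PullArrow π => (p.1.comp p.2).arr) {p | p.1.bot = p.2.top} := by
      have h2 := G.comp_smooth.comp
        ((hA.contMDiff.comp contMDiff_fst).prodMk (hA.contMDiff.comp contMDiff_snd)).contMDiffOn
        (s := {p : G.PullArrow π × G.PullArrow π | p.1.bot = p.2.top})
        (fun p hp => PullArrow.src_eq_tgt hp)
      exact h2.congr fun p hp => PullArrow.arr_comp hp
    refine hA.contMDiffOn_of_comp (PullArrow.continuousOn_iff.2 ⟨h1.continuousOn, ?_, ?_⟩) h1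
    · exact (PullArrow.continuous_bot.comp continuous_snd).continuousOn.congr fun p hp =>
        PullArrow.bot_comp hp
    · exact (PullArrow.continuous_top.comp continuous_fst).continuousOn.congr fun p hp =>
        PullArrow.top_comp hp
  src_unit _ := rfl
  tgt_unit _ := rfl
  src_inv _ := rfl
  tgt_inv _ := rfl
  src_comp _ _ h := PullArrow.bot_comp h
  tgt_comp _ _ h := PullArrow.top_comp h
  assoc a b c h h' := by
    have h1 : a.bot = (b.comp c).top := h.trans (PullArrow.top_comp h').symm
    have h2 : (a.comp b).bot = c.top := (PullArrow.bot_comp h).trans h'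
    refine PullArrow.ext ?_ ?_ ?_
    · rw [PullArrow.top_comp h1, PullArrow.top_comp h2, PullArrow.top_comp h]
    · rw [PullArrow.arr_comp h1, PullArrow.arr_comp h2, PullArrow.arr_comp h,
        PullArrow.arr_comp h', G.assoc _ _ _ (PullArrow.src_eq_tgt h) (PullArrow.src_eq_tgt h')]
    · rw [PullArrow.bot_comp h1, PullArrow.bot_comp h2, PullArrow.bot_comp h']
  comp_unit a := by
    set b : G.PullArrow π := .mk a.bot (G.unit (π a.bot)) a.bot (G.tgt_unit _) (G.src_unit _)
    have h : a.bot = b.top := rfl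
    refine PullArrow.ext (PullArrow.top_comp h) ?_ (PullArrow.bot_comp h)
    rw [PullArrow.arr_comp h]
    change G.comp a.arr (G.unit (π a.bot)) = _
    rw [← a.src_arr, G.comp_unit]
  unit_comp a := by
    set b : G.PullArrow π := .mk a.top (G.unit (π a.top)) a.top (G.tgt_unit _) (G.src_unit _)
    have h : b.bot = a.top := rfl
    refine PullArrow.ext (PullArrow.top_comp h) ?_ (PullArrow.bot_comp h)
    rw [PullArrow.arr_comp h]
    change G.comp (G.unit (π a.top)) a.arr = _
    rw [← a.tgt_arr, G.unit_comp]
  inv_comp a := by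
    set b : G.PullArrow π := .mk a.bot (G.inv a.arr) a.top ((G.tgt_inv _).trans a.src_arr)
      ((G.src_inv _).trans a.tgt_arr)
    have h : b.bot = a.top := rfl
    refine PullArrow.ext (PullArrow.top_comp h) ?_ (PullArrow.bot_comp h)
    rw [PullArrow.arr_comp h]
    change G.comp (G.inv a.arr) a.arr = G.unit (π a.bot)
    rw [← a.src_arr, G.inv_comp]
  comp_inv a := by
    set b : G.PullArrow π := .mk a.bot (G.inv a.arr) a.top ((G.tgt_inv _).trans a.src_arr)
      ((G.src_inv _).trans a.tgt_arr)
    have h : a.bot = b.top := rfl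
    refine PullArrow.ext (PullArrow.top_comp h) ?_ (PullArrow.bot_comp h)
    rw [PullArrow.arr_comp h]
    change G.comp a.arr (G.inv a.arr) = G.unit (π a.top)
    rw [← a.tgt_arr, G.comp_inv]

/-- The map `(bot, top)` is the base change of `(src, tgt)` along π × π, so properness is inherited.
-/
theorem isOrbifold_pullback (hGo : G.IsOrbifold) : (pullback hGo.etale hπ hA).IsOrbifold where
  etale := PullArrow.isLocalDiffeomorph_bot hGo.etale hπ hA
  proper := by
    refine hGo.proper.of_pullback (q := PullArrow.arr) (r := Prod.map π π)
      (PullArrow.continuous_bot.prodMk PullArrow.continuous_top)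
      (hπ.contMDiff.continuous.prodMap hπ.contMDiff.continuous) ?_ PullArrow.isInducing ?_
    · intro a
      exact Prod.ext a.src_arr a.tgt_arr
    · rintro g ⟨m', m⟩ hg
      obtain ⟨h1, h2⟩ := Prod.ext_iff.1 hg
      exact ⟨.mk m g m' h2 h1, rfl, rfl⟩

/-- An arrow of the pulled back groupoid with equal end points is ineffective if and only if the
underlying arrow is. -/
theorem isIneffective_pullback_iff {a : G.PullArrow π} (ha : a.bot = a.top) :
    (pullback hG hπ hA).IsIneffective a ↔ G.IsIneffective a.arr := by
  have het : (pullback hG hπ hA).IsEtale := PullArrow.isLocalDiffeomorph_bot hG hπ hA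
  rw [het.isIneffective_iff, hG.isIneffective_iff, ← hA.isLocalHomeomorph.map_nhds_eq,
    Filter.eventually_map]
  constructor
  · intro h
    filter_upwards [h] with b hb
    have hb' : b.bot = b.top := hb
    rw [b.src_arr, b.tgt_arr, hb']
  · intro h
    have h1 : Filter.Tendsto PullArrow.top (𝓝 a) (𝓝 a.bot) := by
      rw [ha]
      exact PullArrow.continuous_top.tendsto a
    -- Near `a` the two ends lift the same point of `G₀` and tend to the same point of `M`, so they
    -- coincide.
    refine hπ.isLocalHomeomorph.eventually_unique_lift (PullArrow.continuous_bot.tendsto a) h1 ?_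
    filter_upwards [h] with b hb
    change π b.bot = π b.top
    rw [← b.src_arr, ← b.tgt_arr, hb]

end Pullback

end SmoothGroupoid

namespace SmoothGroupoid

/-- A smooth homomorphism from a smooth groupoid to a Lie group. -/
structure IsSmoothHom {E₀ : Type*} [NormedAddCommGroup E₀] [NormedSpace ℝ E₀] {B₀ : Type*}
    [TopologicalSpace B₀] {E₁ : Type*} [NormedAddCommGroup E₁] [NormedSpace ℝ E₁] {B₁ : Type*}
    [TopologicalSpace B₁] {I₀ : ModelWithCorners ℝ E₀ B₀} {I₁ : ModelWithCorners ℝ E₁ B₁}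
    {G₀ G₁ : Type*} [TopologicalSpace G₀] [ChartedSpace B₀ G₀]
    [TopologicalSpace G₁] [ChartedSpace B₁ G₁] (G : SmoothGroupoid I₀ I₁ G₀ G₁)
    {EK : Type*} [NormedAddCommGroup EK] [NormedSpace ℝ EK] {BK : Type*} [TopologicalSpace BK]
    (IK : ModelWithCorners ℝ EK BK) {K : Type*} [Group K] [TopologicalSpace K] [ChartedSpace BK K]
    (ρ : G₁ → K) : Prop where
  smooth : ContMDiff I₁ IK ∞ ρ
  map_comp : ∀ g h, G.src g = G.tgt h → ρ (G.comp g h) = ρ g * ρ h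

/-! ### The action groupoid on the trivial K-bundle and its translation action -/

section ActionGroupoid

variable {n k d : ℕ} {M R K : Type*}
    [TopologicalSpace M] [ChartedSpace (EuclideanSpace ℝ (Fin n)) M]
    [TopologicalSpace R] [ChartedSpace (EuclideanSpace ℝ (Fin n)) R]
    [Group K] [TopologicalSpace K] [ChartedSpace (EuclideanSpace ℝ (Fin k)) K]
    [LieGroup (𝓡 k) ∞ K]
    [ChartedSpace (EuclideanSpace ℝ (Fin d)) (M × K)]
    [ChartedSpace (EuclideanSpace ℝ (Fin d)) (R × K)]
    {G : SmoothGroupoid (𝓡 n) (𝓡 n) M R} {ρ : R → K}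

theorem IsSmoothHom.map_unit (hρ : G.IsSmoothHom (𝓡 k) ρ) (m : M) : ρ (G.unit m) = 1 := by
  have h := hρ.map_comp (G.unit m) (G.unit m) (by rw [G.src_unit, G.tgt_unit])
  have h' := G.comp_unit (G.unit m)
  rw [G.src_unit] at h'
  rw [h'] at h
  exact left_eq_mul.1 h

theorem IsSmoothHom.map_inv (hρ : G.IsSmoothHom (𝓡 k) ρ) (g : R) : ρ (G.inv g) = (ρ g)⁻¹ := by
  have h := hρ.map_comp (G.inv g) g (G.src_inv g)
  rw [G.inv_comp, hρ.map_unit] at h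
  exact eq_inv_of_mul_eq_one_left h.symm

variable (hG : G.IsEtale) (hρ : G.IsSmoothHom (𝓡 k) ρ)
    (hM : IsLocalDiffeomorph (𝓡 d) ((𝓡 n).prod (𝓡 k)) ∞ (id : M × K → M × K))
    (hR : IsLocalDiffeomorph (𝓡 d) ((𝓡 n).prod (𝓡 k)) ∞ (id : R × K → R × K))

include hG hM hR in
-- The products carry Euclidean charts, and `hM`, `hR` say that these define the product structures;
-- under this identification the source map is a product of local diffeomorphisms.
theorem isLocalDiffeomorph_src_actionGroupoid :
    IsLocalDiffeomorph (𝓡 d) (𝓡 d) ∞ (fun p : R × K => (G.src p.1, p.2)) := by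
  refine hM.of_comp ?_ (by have := G.continuous_src; fun_prop)
  exact (IsLocalDiffeomorph.prodMap hG isLocalDiffeomorph_id).comp hR

/-- The action groupoid of the left translation action of `G` on the trivial bundle with fibre `K`
through a homomorphism `ρ` to `K`. -/
def actionGroupoid : SmoothGroupoid (𝓡 d) (𝓡 d) (M × K) (R × K) where
  src p := (G.src p.1, p.2)
  tgt p := (G.tgt p.1, ρ p.1 * p.2)
  unit x := (G.unit x.1, x.2)
  inv p := (G.inv p.1, ρ p.1 * p.2)
  comp p q := (G.comp p.1 q.1, q.2)
  src_submersion := ⟨(isLocalDiffeomorph_src_actionGroupoid hG hM hR).contMDiff,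
    (isLocalDiffeomorph_src_actionGroupoid hG hM hR).surjective_mfderiv⟩
  tgt_smooth := by
    have h : ContMDiff ((𝓡 n).prod (𝓡 k)) ((𝓡 n).prod (𝓡 k)) ∞
        (fun p : R × K => (G.tgt p.1, ρ p.1 * p.2)) :=
      (G.tgt_smooth.comp contMDiff_fst).prodMk ((hρ.smooth.comp contMDiff_fst).mul contMDiff_snd)
    exact hM.contMDiff_of_comp h.continuous (h.comp hR.contMDiff)
  unit_smooth := by
    have h : ContMDiff ((𝓡 n).prod (𝓡 k)) ((𝓡 n).prod (𝓡 k)) ∞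
        (fun x : M × K => (G.unit x.1, x.2)) :=
      (G.unit_smooth.comp contMDiff_fst).prodMk contMDiff_snd
    exact hR.contMDiff_of_comp h.continuous (h.comp hM.contMDiff)
  inv_smooth := by
    have h : ContMDiff ((𝓡 n).prod (𝓡 k)) ((𝓡 n).prod (𝓡 k)) ∞
        (fun p : R × K => (G.inv p.1, ρ p.1 * p.2)) :=
      (G.inv_smooth.comp contMDiff_fst).prodMk ((hρ.smooth.comp contMDiff_fst).mul contMDiff_snd)
    exact hR.contMDiff_of_comp h.continuous (h.comp hR.contMDiff)
  comp_smooth := by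
    have h : ContMDiffOn (((𝓡 n).prod (𝓡 k)).prod ((𝓡 n).prod (𝓡 k))) ((𝓡 n).prod (𝓡 k)) ∞
        (fun p : (R × K) × (R × K) => (G.comp p.1.1 p.2.1, p.2.2))
        {p | (G.src p.1.1, p.1.2) = (G.tgt p.2.1, ρ p.2.1 * p.2.2)} :=
      (G.comp_smooth.comp ((contMDiff_fst.comp contMDiff_fst).prodMk
        (contMDiff_fst.comp contMDiff_snd)).contMDiffOn
        (fun p hp => by have h := congrArg Prod.fst hp; exact h)).prodMk (contMDiff_snd.comp contMDiff_snd).contMDiffOn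
    exact hR.contMDiffOn_of_comp h.continuousOn
      (h.comp (hR.contMDiff.prodMap hR.contMDiff).contMDiffOn fun p hp => hp)
  src_unit x := by simp only [G.src_unit]
  tgt_unit x := by simp only [G.tgt_unit, hρ.map_unit, one_mul]
  src_inv p := by simp only [G.src_inv]
  tgt_inv p := by simp only [G.tgt_inv, hρ.map_inv, inv_mul_cancel_left]
  src_comp p q h := by simp only [G.src_comp _ _ (Prod.ext_iff.1 h).1]
  tgt_comp p q h := by
    obtain ⟨h1, h2⟩ := Prod.ext_iff.1 h
    simp only at h1 h2
    simp only [G.tgt_comp _ _ h1, hρ.map_comp _ _ h1, h2, mul_assoc]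
  assoc p q r h h' := by
    simp only [G.assoc _ _ _ (Prod.ext_iff.1 h).1 (Prod.ext_iff.1 h').1]
  comp_unit p := by simp only [G.comp_unit]
  unit_comp p := by simp only [G.unit_comp]
  inv_comp p := by simp only [G.inv_comp]
  comp_inv p := by simp only [G.comp_inv]

theorem isEtale_actionGroupoid : (actionGroupoid hG hρ hM hR).IsEtale :=
  isLocalDiffeomorph_src_actionGroupoid hG hM hR

/-- Forgetting the `K`-component of the target turns (s, t) into the product of the proper map of
`G` with the identity of `K`; a map into a Hausdorff space with proper composite is proper. -/
theorem isOrbifold_actionGroupoid [T2Space M] [T2Space K] (hGo : G.IsOrbifold) :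
    (actionGroupoid hGo.etale hρ hM hR).IsOrbifold where
  etale := isEtale_actionGroupoid hGo.etale hρ hM hR
  proper := by
    have hc : Continuous (fun p : R × K => ((G.src p.1, p.2), (G.tgt p.1, ρ p.1 * p.2))) := by
      have h1 := G.continuous_src
      have h2 := G.continuous_tgt
      have h3 : Continuous (fun p : R × K => ρ p.1 * p.2) :=
        ((hρ.smooth.comp contMDiff_fst).mul contMDiff_snd :
          ContMDiff ((𝓡 n).prod (𝓡 k)) (𝓡 k) ∞ (fun p : R × K => ρ p.1 * p.2)).continuous
      fun_prop
    refine isProperMap_of_comp_of_t2 (g := fun q : (M × K) × (M × K) => ((q.1.1, q.2.1), q.1.2))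
      hc (by fun_prop) ?_
    exact hGo.proper.prodMap isProperMap_id

/-- An arrow of the action groupoid with equal end points is ineffective as soon as the underlying
arrow is ineffective and `ρ` takes it, and all nearby arrows, to the identity. -/
theorem isIneffective_actionGroupoid {p : R × K} (h : G.IsIneffective p.1)
    (h' : ∀ᶠ g in 𝓝 p.1, ρ g = 1) : (actionGroupoid hG hρ hM hR).IsIneffective p := by
  rw [(isEtale_actionGroupoid hG hρ hM hR).isIneffective_iff]
  filter_upwards [continuous_fst.continuousAt.eventually (hG.isIneffective_iff.1 h),
    continuous_fst.continuousAt.eventually h'] with q h1 h2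
  change (G.src q.1, q.2) = (G.tgt q.1, ρ q.1 * q.2)
  rw [h1, h2, one_mul]

/-- Right translation by `K` on the action groupoid. -/
def translationAction : (actionGroupoid hG hρ hM hR).GroupAction (𝓡 k) K where
  act₀ x l := (x.1, x.2 * l)
  act₁ p l := (p.1, p.2 * l)
  act₀_smooth := by
    have h : ContMDiff (((𝓡 n).prod (𝓡 k)).prod (𝓡 k)) ((𝓡 n).prod (𝓡 k)) ∞
        (fun q : (M × K) × K => (q.1.1, q.1.2 * q.2)) :=
      (contMDiff_fst.comp contMDiff_fst).prodMk
        ((contMDiff_snd.comp contMDiff_fst).mul contMDiff_snd)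
    exact hM.contMDiff_of_comp h.continuous (h.comp (hM.contMDiff.prodMap contMDiff_id))
  act₁_smooth := by
    have h : ContMDiff (((𝓡 n).prod (𝓡 k)).prod (𝓡 k)) ((𝓡 n).prod (𝓡 k)) ∞
        (fun q : (R × K) × K => (q.1.1, q.1.2 * q.2)) :=
      (contMDiff_fst.comp contMDiff_fst).prodMk
        ((contMDiff_snd.comp contMDiff_fst).mul contMDiff_snd)
    exact hR.contMDiff_of_comp h.continuous (h.comp (hR.contMDiff.prodMap contMDiff_id))
  act₀_one x := by simp
  act₁_one g := by simp
  act₀_mul x l l' := by simp [mul_assoc]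
  act₁_mul x l l' := by simp [mul_assoc]
  act_unit x l := rfl
  src_act g l := rfl
  tgt_act g l := by
    change (G.tgt g.1, ρ g.1 * (g.2 * l)) = (G.tgt g.1, ρ g.1 * g.2 * l)
    rw [mul_assoc]
  comp_act g h l _ := rfl

end ActionGroupoid

/-! ### The bimodule of arrows with lifted target, times K -/

section HilsumSkandalis

variable {n k d : ℕ} {G₀ G₁ M K : Type*}
    [TopologicalSpace G₀] [ChartedSpace (EuclideanSpace ℝ (Fin n)) G₀]
    [TopologicalSpace G₁] [ChartedSpace (EuclideanSpace ℝ (Fin n)) G₁]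
    [TopologicalSpace M] [ChartedSpace (EuclideanSpace ℝ (Fin n)) M]
    {G : SmoothGroupoid (𝓡 n) (𝓡 n) G₀ G₁} {π : M → G₀}
    [ChartedSpace (EuclideanSpace ℝ (Fin n)) (G.PullArrow π)]
    [ChartedSpace (EuclideanSpace ℝ (Fin n)) (G.TgtLift π)]
    [Group K] [TopologicalSpace K] [ChartedSpace (EuclideanSpace ℝ (Fin k)) K]
    [LieGroup (𝓡 k) ∞ K]
    [ChartedSpace (EuclideanSpace ℝ (Fin d)) (M × K)]
    [ChartedSpace (EuclideanSpace ℝ (Fin d)) (G.PullArrow π × K)]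
    [ChartedSpace (EuclideanSpace ℝ (Fin d)) (G.TgtLift π × K)]
    (hG : G.IsEtale)
    (hπ : IsLocalDiffeomorph (𝓡 n) (𝓡 n) ∞ π) (hπs : Function.Surjective π)
    (hA : IsLocalDiffeomorph (𝓡 n) (𝓡 n) ∞ (PullArrow.arr : G.PullArrow π → G₁))
    (hY : IsLocalDiffeomorph (𝓡 n) (𝓡 n) ∞ (fun b : G.TgtLift π => b.1.1))
    {ρ : G.PullArrow π → K} (hρ : (pullback hG hπ hA).IsSmoothHom (𝓡 k) ρ)
    (hM : IsLocalDiffeomorph (𝓡 d) ((𝓡 n).prod (𝓡 k)) ∞ (id : M × K → M × K))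
    (hR : IsLocalDiffeomorph (𝓡 d) ((𝓡 n).prod (𝓡 k)) ∞
      (id : G.PullArrow π × K → G.PullArrow π × K))
    (hX : IsLocalDiffeomorph (𝓡 d) ((𝓡 n).prod (𝓡 k)) ∞
      (id : G.TgtLift π × K → G.TgtLift π × K))

open Classical in
/-- The arrow `g`, acting on an arrow with a lifted target. -/
noncomputable def PullArrow.actLift (a : G.PullArrow π) (b : G.TgtLift π) : G.TgtLift π :=
  if h : G.src a.arr = G.tgt b.1.1 then
    ⟨(G.comp a.arr b.1.1, a.top), (G.tgt_comp _ _ h).trans a.tgt_arr⟩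
  else b

omit [ChartedSpace (EuclideanSpace ℝ (Fin n)) (G.PullArrow π)]
    [ChartedSpace (EuclideanSpace ℝ (Fin n)) (G.TgtLift π)] in
theorem PullArrow.src_eq_tgt_lift {a : G.PullArrow π} {b : G.TgtLift π} (h : a.bot = b.1.2) :
    G.src a.arr = G.tgt b.1.1 := by
  rw [a.src_arr, h]
  exact b.2.symm

omit [ChartedSpace (EuclideanSpace ℝ (Fin n)) (G.PullArrow π)]
    [ChartedSpace (EuclideanSpace ℝ (Fin n)) (G.TgtLift π)] in
theorem PullArrow.actLift_coe {a : G.PullArrow π} {b : G.TgtLift π} (h : a.bot = b.1.2) :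
    (a.actLift b).1 = (G.comp a.arr b.1.1, a.top) := by
  rw [PullArrow.actLift, dif_pos (PullArrow.src_eq_tgt_lift h)]

omit [ChartedSpace (EuclideanSpace ℝ (Fin n)) (G.PullArrow π)]
    [ChartedSpace (EuclideanSpace ℝ (Fin n)) (G.TgtLift π)] in
theorem PullArrow.actLift_snd {a : G.PullArrow π} {b : G.TgtLift π} (h : a.bot = b.1.2) :
    (a.actLift b).1.2 = a.top := by
  rw [PullArrow.actLift_coe h]

open Classical in
/-- Right multiplication of an arrow with a lifted target. -/
noncomputable def TgtLift.mulRight (b : G.TgtLift π) (g : G₁) : G.TgtLift π :=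
  if h : G.src b.1.1 = G.tgt g then
    ⟨(G.comp b.1.1 g, b.1.2), (G.tgt_comp _ _ h).trans b.2⟩
  else b

theorem TgtLift.mulRight_coe {b : G.TgtLift π} {g : G₁} (h : G.src b.1.1 = G.tgt g) :
    (TgtLift.mulRight b g).1 = (G.comp b.1.1 g, b.1.2) := by
  rw [TgtLift.mulRight, dif_pos h]

theorem TgtLift.mulRight_snd {b : G.TgtLift π} {g : G₁} (h : G.src b.1.1 = G.tgt g) :
    (TgtLift.mulRight b g).1.2 = b.1.2 := by
  rw [TgtLift.mulRight_coe h]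

include hG hπ hA in
theorem isEtale_pullback : (pullback hG hπ hA).IsEtale :=
  PullArrow.isLocalDiffeomorph_bot hG hπ hA

include hG hπ hY in
theorem isLocalDiffeomorph_tgtLift_snd :
    IsLocalDiffeomorph (𝓡 n) (𝓡 n) ∞ (fun b : G.TgtLift π => b.1.2) := by
  refine hπ.of_comp ?_ (by fun_prop)
  have : π ∘ (fun b : G.TgtLift π => b.1.2) = G.tgt ∘ (fun b : G.TgtLift π => b.1.1) :=
    funext fun b => b.2.symm
  rw [this]
  exact hG.isLocalDiffeomorph_tgt.comp hY

theorem contMDiffOn_tgtLift {E : Type*} [NormedAddCommGroup E] [NormedSpace ℝ E] {B : Type*}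
    [TopologicalSpace B] {I : ModelWithCorners ℝ E B} {Z : Type*} [TopologicalSpace Z]
    [ChartedSpace B Z] {s : Set Z} {f : Z → G.TgtLift π}
    (hY : IsLocalDiffeomorph (𝓡 n) (𝓡 n) ∞ (fun b : G.TgtLift π => b.1.1))
    (h1 : ContMDiffOn I (𝓡 n) ∞ (fun z => (f z).1.1) s)
    (h2 : ContinuousOn (fun z => (f z).1.2) s) : ContMDiffOn I (𝓡 n) ∞ f s := by
  refine hY.contMDiffOn_of_comp ?_ h1
  exact Topology.IsInducing.subtypeVal.continuousOn_iff.2 (h1.continuousOn.prodMk h2)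

include hA hY in
theorem contMDiffOn_actLift : ContMDiffOn ((𝓡 n).prod (𝓡 n)) (𝓡 n) ∞
    (fun p : G.PullArrow π × G.TgtLift π => p.1.actLift p.2) {p | p.1.bot = p.2.1.2} := by
  refine contMDiffOn_tgtLift hY ?_ ?_
  · refine (G.comp_smooth.comp ((hA.contMDiff.comp contMDiff_fst).prodMk
      (hY.contMDiff.comp contMDiff_snd)).contMDiffOn
      (fun p hp => PullArrow.src_eq_tgt_lift hp)).congr ?_
    intro p hp
    exact congrArg Prod.fst (PullArrow.actLift_coe hp)
  · refine (PullArrow.continuous_top.comp continuous_fst).continuousOn.congr ?_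
    intro p hp
    exact PullArrow.actLift_snd hp

include hY in
theorem contMDiffOn_mulRight : ContMDiffOn ((𝓡 n).prod (𝓡 n)) (𝓡 n) ∞
    (fun p : G.TgtLift π × G₁ => TgtLift.mulRight p.1 p.2) {p | G.src p.1.1.1 = G.tgt p.2} := by
  refine contMDiffOn_tgtLift hY ?_ ?_
  · refine (G.comp_smooth.comp ((hY.contMDiff.comp contMDiff_fst).prodMk
      contMDiff_snd).contMDiffOn (fun p hp => hp)).congr ?_
    intro p hp
    exact congrArg Prod.fst (TgtLift.mulRight_coe hp)
  · refine ContinuousOn.congr (f := fun p : G.TgtLift π × G₁ => p.1.1.2)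
      (Continuous.continuousOn (by fun_prop)) ?_
    intro p hp
    exact TgtLift.mulRight_snd hp

open Classical in
/-- The arrow of the pulled back groupoid that takes the second argument to the first. -/
noncomputable def TgtLift.quot (b b' : G.TgtLift π) : G.PullArrow π :=
  if h : G.src b.1.1 = G.src b'.1.1 then
    .mk b.1.2 (G.comp b.1.1 (G.inv b'.1.1)) b'.1.2
      ((G.tgt_comp _ _ (h.trans (G.tgt_inv _).symm)).trans b.2)
      ((G.src_comp _ _ (h.trans (G.tgt_inv _).symm)).trans ((G.src_inv _).trans b'.2))
  else .mk b.1.2 (G.unit (π b.1.2)) b.1.2 (G.tgt_unit _) (G.src_unit _)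

theorem TgtLift.quot_eq {b b' : G.TgtLift π} (h : G.src b.1.1 = G.src b'.1.1) :
    TgtLift.quot b b' = .mk b.1.2 (G.comp b.1.1 (G.inv b'.1.1)) b'.1.2
      ((G.tgt_comp _ _ (h.trans (G.tgt_inv _).symm)).trans b.2)
      ((G.src_comp _ _ (h.trans (G.tgt_inv _).symm)).trans ((G.src_inv _).trans b'.2)) := by
  rw [TgtLift.quot, dif_pos h]

theorem TgtLift.actLift_quot {b b' : G.TgtLift π} (h : G.src b.1.1 = G.src b'.1.1) :
    (TgtLift.quot b b').actLift b' = b := by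
  rw [TgtLift.quot_eq h]
  apply Subtype.ext
  rw [PullArrow.actLift_coe rfl]
  exact Prod.ext (G.inv_comp_cancel_right h) rfl

theorem TgtLift.quot_actLift {a : G.PullArrow π} {b : G.TgtLift π} (h : a.bot = b.1.2) :
    TgtLift.quot (a.actLift b) b = a := by
  have h0 := PullArrow.src_eq_tgt_lift h
  have h1 := PullArrow.actLift_coe h
  have h2 : G.src (a.actLift b).1.1 = G.src b.1.1 := by rw [h1, G.src_comp _ _ h0]
  rw [TgtLift.quot_eq h2]
  refine PullArrow.ext ?_ ?_ h.symm
  · exact PullArrow.actLift_snd h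
  · change G.comp (a.actLift b).1.1 (G.inv b.1.1) = a.arr
    rw [h1, G.comp_inv_cancel_right h0]

include hA hY in
theorem contMDiffOn_quot : ContMDiffOn ((𝓡 n).prod (𝓡 n)) (𝓡 n) ∞
    (fun p : G.TgtLift π × G.TgtLift π => TgtLift.quot p.1 p.2)
    {p | G.src p.1.1.1 = G.src p.2.1.1} := by
  have h1 : ContMDiffOn ((𝓡 n).prod (𝓡 n)) (𝓡 n) ∞
      (fun p : G.TgtLift π × G.TgtLift π => (TgtLift.quot p.1 p.2).arr)
      {p | G.src p.1.1.1 = G.src p.2.1.1} := by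
    refine (G.comp_smooth.comp ((hY.contMDiff.comp contMDiff_fst).prodMk
      (G.inv_smooth.comp (hY.contMDiff.comp contMDiff_snd))).contMDiffOn
      (fun p hp => hp.trans (G.tgt_inv _).symm)).congr ?_
    intro p hp
    rw [TgtLift.quot_eq hp]
    rfl
  refine hA.contMDiffOn_of_comp (PullArrow.continuousOn_iff.2 ⟨h1.continuousOn, ?_, ?_⟩) h1
  · refine ContinuousOn.congr (f := fun p : G.TgtLift π × G.TgtLift π => p.2.1.2)
      (Continuous.continuousOn (by fun_prop)) ?_
    intro p hp
    simp only [TgtLift.quot_eq hp]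
    rfl
  · refine ContinuousOn.congr (f := fun p : G.TgtLift π × G.TgtLift π => p.1.1.2)
      (Continuous.continuousOn (by fun_prop)) ?_
    intro p hp
    simp only [TgtLift.quot_eq hp]
    rfl

/-- The quotient by `K` of the action groupoid over the pulled back groupoid. -/
noncomputable abbrev translationQuotient :=
  (actionGroupoid (isEtale_pullback hG hπ hA) hρ hM hR).semidirect
    (translationAction (isEtale_pullback hG hπ hA) hρ hM hR)

/-- The left action of the quotient groupoid on the arrows of `G` with lifted target, times `K`. -/
noncomputable def leftLiftAction :
    (translationQuotient hG hπ hA hρ hM hR).LeftAction (𝓡 d) (G.TgtLift π × K) where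
  base x := (x.1.1.2, x.2)
  act q x := (q.1.1.actLift x.1, ρ q.1.1 * q.1.2)
  base_smooth := by
    have h : ContMDiff ((𝓡 n).prod (𝓡 k)) ((𝓡 n).prod (𝓡 k)) ∞
        (fun x : G.TgtLift π × K => (x.1.1.2, x.2)) :=
      ((isLocalDiffeomorph_tgtLift_snd hG hπ hY).contMDiff.comp contMDiff_fst).prodMk contMDiff_snd
    exact hM.contMDiff_of_comp h.continuous (h.comp hX.contMDiff)
  act_smooth := by
    have h : ContMDiffOn ((((𝓡 n).prod (𝓡 k)).prod (𝓡 k)).prod ((𝓡 n).prod (𝓡 k)))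
        ((𝓡 n).prod (𝓡 k)) ∞
        (fun p : ((G.PullArrow π × K) × K) × (G.TgtLift π × K) =>
          (p.1.1.1.actLift p.2.1, ρ p.1.1.1 * p.1.1.2))
        {p | (p.1.1.1.bot, p.1.1.2 * p.1.2) = (p.2.1.1.2, p.2.2)} := by
      refine ContMDiffOn.prodMk ?_ (ContMDiff.contMDiffOn ?_)
      · exact (contMDiffOn_actLift hA hY).comp
          ((contMDiff_fst.comp (contMDiff_fst.comp contMDiff_fst)).prodMk
            (contMDiff_fst.comp contMDiff_snd)).contMDiffOn (fun p hp => congrArg Prod.fst hp)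
      · exact (hρ.smooth.comp (contMDiff_fst.comp (contMDiff_fst.comp contMDiff_fst))).mul
          (contMDiff_snd.comp (contMDiff_fst.comp contMDiff_fst))
    exact hX.contMDiffOn_of_comp h.continuousOn
      (h.comp ((hR.contMDiff.prodMap contMDiff_id).prodMap hX.contMDiff).contMDiffOn
        fun p hp => hp)
  base_act q x h := by
    have h1 : q.1.1.bot = x.1.1.2 := congrArg Prod.fst h
    exact Prod.ext (PullArrow.actLift_snd h1) rfl
  unit_act x := by
    set b := x.1
    set a : G.PullArrow π := (pullback hG hπ hA).unit b.1.2
    have h1 : a.bot = b.1.2 := rfl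
    refine Prod.ext (Subtype.ext ?_) ?_
    · change (a.actLift b).1 = b.1
      rw [PullArrow.actLift_coe h1]
      refine Prod.ext ?_ rfl
      change G.comp (G.unit (π b.1.2)) b.1.1 = b.1.1
      rw [← b.2, G.unit_comp]
    · change ρ a * x.2 = x.2
      rw [hρ.map_unit, one_mul]
  comp_act p q x h h' := by
    have e1 : q.1.1.bot = x.1.1.2 := congrArg Prod.fst h
    have e2 : p.1.1.bot = q.1.1.top := congrArg Prod.fst h'
    have e3 : p.1.2 * p.2 = ρ q.1.1 * q.1.2 := congrArg Prod.snd h'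
    have e4 : p.1.1.bot = (q.1.1.actLift x.1).1.2 := by rw [PullArrow.actLift_coe e1, e2]
    have e5 : (p.1.1.comp q.1.1).bot = x.1.1.2 := by rw [PullArrow.bot_comp e2, e1]
    refine Prod.ext (Subtype.ext ?_) ?_
    · change (p.1.1.actLift (q.1.1.actLift x.1)).1 = ((p.1.1.comp q.1.1).actLift x.1).1
      rw [PullArrow.actLift_coe e4, PullArrow.actLift_coe e5, PullArrow.actLift_coe e1,
        PullArrow.arr_comp e2, PullArrow.top_comp e2,
        G.assoc _ _ _ (PullArrow.src_eq_tgt e2) (PullArrow.src_eq_tgt_lift e1)]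
    · change ρ p.1.1 * p.1.2 = ρ (p.1.1.comp q.1.1) * (q.1.2 * p.2⁻¹)
      have h6 : ρ (p.1.1.comp q.1.1) = ρ p.1.1 * ρ q.1.1 := hρ.map_comp _ _ e2
      -- Composability `e3` is what cancels the inverse introduced by the twisted product of the
      -- semidirect groupoid.
      rw [h6, mul_assoc, ← mul_assoc (ρ q.1.1), ← e3, mul_inv_cancel_right]

/-- The right action of `G` on its arrows with lifted target, times `K`. -/
noncomputable def rightLiftAction : G.RightAction (𝓡 d) (G.TgtLift π × K) where
  base x := G.src x.1.1.1
  act x g := (TgtLift.mulRight x.1 g, x.2)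
  base_smooth := by
    have h : ContMDiff ((𝓡 n).prod (𝓡 k)) (𝓡 n) ∞ (fun x : G.TgtLift π × K => G.src x.1.1.1) :=
      G.src_submersion.smooth.comp (hY.contMDiff.comp contMDiff_fst)
    exact h.comp hX.contMDiff
  act_smooth := by
    have h : ContMDiffOn (((𝓡 n).prod (𝓡 k)).prod (𝓡 n)) ((𝓡 n).prod (𝓡 k)) ∞
        (fun p : (G.TgtLift π × K) × G₁ => (TgtLift.mulRight p.1.1 p.2, p.1.2))
        {p | G.src p.1.1.1.1 = G.tgt p.2} := by
      refine ContMDiffOn.prodMk ?_ (ContMDiff.contMDiffOn (contMDiff_snd.comp contMDiff_fst))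
      exact (contMDiffOn_mulRight hY).comp
        ((contMDiff_fst.comp contMDiff_fst).prodMk contMDiff_snd).contMDiffOn fun p hp => hp
    exact hX.contMDiffOn_of_comp h.continuousOn
      (h.comp (hX.contMDiff.prodMap contMDiff_id).contMDiffOn fun p hp => hp)
  base_act x g h := by rw [TgtLift.mulRight_coe h, G.src_comp _ _ h]
  act_unit x := by
    refine Prod.ext (Subtype.ext ?_) rfl
    rw [TgtLift.mulRight_coe (G.tgt_unit _).symm, G.comp_unit]
  act_comp x g h e e' := by
    have e1 : G.src (TgtLift.mulRight x.1 g).1.1 = G.tgt h := by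
      rw [TgtLift.mulRight_coe e, G.src_comp _ _ e, e']
    refine Prod.ext (Subtype.ext ?_) rfl
    change (TgtLift.mulRight (TgtLift.mulRight x.1 g) h).1 = (TgtLift.mulRight x.1 (G.comp g h)).1
    rw [TgtLift.mulRight_coe e1, TgtLift.mulRight_coe e,
      TgtLift.mulRight_coe (e.trans (G.tgt_comp _ _ e').symm), G.assoc _ _ _ e e']

end HilsumSkandalis

end SmoothGroupoid

/-! ### Submersions, and principality of both sides of the bimodule -/

theorem IsSmoothSubmersion.comp {E : Type*} [NormedAddCommGroup E] [NormedSpace ℝ E] {B : Type*}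
    [TopologicalSpace B] {I : ModelWithCorners ℝ E B} {N : Type*} [TopologicalSpace N]
    [ChartedSpace B N] {E' : Type*} [NormedAddCommGroup E'] [NormedSpace ℝ E'] {B' : Type*}
    [TopologicalSpace B'] {I' : ModelWithCorners ℝ E' B'} {X : Type*} [TopologicalSpace X]
    [ChartedSpace B' X] {E'' : Type*} [NormedAddCommGroup E''] [NormedSpace ℝ E''] {B'' : Type*}
    [TopologicalSpace B''] {I'' : ModelWithCorners ℝ E'' B''} {Z : Type*} [TopologicalSpace Z]
    [ChartedSpace B'' Z] {p : X → N} {f : Z → X} (hp : IsSmoothSubmersion I' I p)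
    (hf : IsSmoothSubmersion I'' I' f) : IsSmoothSubmersion I'' I (p ∘ f) where
  smooth := hp.smooth.comp hf.smooth
  surjective_mfderiv z := by
    rw [mfderiv_comp z (hp.smooth.mdifferentiableAt (by simp))
      (hf.smooth.mdifferentiableAt (by simp))]
    exact (hp.surjective_mfderiv (f z)).comp (hf.surjective_mfderiv z)

theorem IsLocalDiffeomorph.isSmoothSubmersion {E : Type*} [NormedAddCommGroup E] [NormedSpace ℝ E]
    {B : Type*} [TopologicalSpace B] {I : ModelWithCorners ℝ E B} {N : Type*} [TopologicalSpace N]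
    [ChartedSpace B N] {E' : Type*} [NormedAddCommGroup E'] [NormedSpace ℝ E'] {B' : Type*}
    [TopologicalSpace B'] {I' : ModelWithCorners ℝ E' B'} {X : Type*} [TopologicalSpace X]
    [ChartedSpace B' X] {p : X → N} (hp : IsLocalDiffeomorph I' I ∞ p) :
    IsSmoothSubmersion I' I p :=
  ⟨hp.contMDiff, hp.surjective_mfderiv⟩

theorem isSmoothSubmersion_fst {E : Type*} [NormedAddCommGroup E] [NormedSpace ℝ E]
    {B : Type*} [TopologicalSpace B] {I : ModelWithCorners ℝ E B} {N : Type*} [TopologicalSpace N]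
    [ChartedSpace B N] {E' : Type*} [NormedAddCommGroup E'] [NormedSpace ℝ E'] {B' : Type*}
    [TopologicalSpace B'] {I' : ModelWithCorners ℝ E' B'} {X : Type*} [TopologicalSpace X]
    [ChartedSpace B' X] : IsSmoothSubmersion (I.prod I') I (Prod.fst : N × X → N) where
  smooth := contMDiff_fst
  surjective_mfderiv z := by
    rw [mfderiv_fst]
    exact Prod.fst_surjective

namespace SmoothGroupoid

section HilsumSkandalis

variable {n k d : ℕ} {G₀ G₁ M K : Type*}
    [TopologicalSpace G₀] [ChartedSpace (EuclideanSpace ℝ (Fin n)) G₀]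
    [TopologicalSpace G₁] [ChartedSpace (EuclideanSpace ℝ (Fin n)) G₁]
    [TopologicalSpace M] [ChartedSpace (EuclideanSpace ℝ (Fin n)) M]
    {G : SmoothGroupoid (𝓡 n) (𝓡 n) G₀ G₁} {π : M → G₀}
    [ChartedSpace (EuclideanSpace ℝ (Fin n)) (G.PullArrow π)]
    [ChartedSpace (EuclideanSpace ℝ (Fin n)) (G.TgtLift π)]
    [Group K] [TopologicalSpace K] [ChartedSpace (EuclideanSpace ℝ (Fin k)) K]
    [LieGroup (𝓡 k) ∞ K]
    [ChartedSpace (EuclideanSpace ℝ (Fin d)) (M × K)]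
    [ChartedSpace (EuclideanSpace ℝ (Fin d)) (G.PullArrow π × K)]
    [ChartedSpace (EuclideanSpace ℝ (Fin d)) (G.TgtLift π × K)]
    (hG : G.IsEtale)
    (hπ : IsLocalDiffeomorph (𝓡 n) (𝓡 n) ∞ π) (hπs : Function.Surjective π)
    (hA : IsLocalDiffeomorph (𝓡 n) (𝓡 n) ∞ (PullArrow.arr : G.PullArrow π → G₁))
    (hY : IsLocalDiffeomorph (𝓡 n) (𝓡 n) ∞ (fun b : G.TgtLift π => b.1.1))
    {ρ : G.PullArrow π → K} (hρ : (pullback hG hπ hA).IsSmoothHom (𝓡 k) ρ)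
    (hM : IsLocalDiffeomorph (𝓡 d) ((𝓡 n).prod (𝓡 k)) ∞ (id : M × K → M × K))
    (hR : IsLocalDiffeomorph (𝓡 d) ((𝓡 n).prod (𝓡 k)) ∞
      (id : G.PullArrow π × K → G.PullArrow π × K))
    (hX : IsLocalDiffeomorph (𝓡 d) ((𝓡 n).prod (𝓡 k)) ∞
      (id : G.TgtLift π × K → G.TgtLift π × K))

-- Two points with the same left base share the lifted target and the `K`-component, so their arrows
-- have the same target and differ on the right by the unique factor x⁻¹ y.
include hπs in
theorem rightLiftAction_isPrincipal : (rightLiftAction (G := G) hY hX).IsPrincipal (𝓡 d)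
    (leftLiftAction hG hπ hA hY hρ hM hR hX).base where
  submersion := by
    refine IsLocalDiffeomorph.isSmoothSubmersion ?_
    have h : IsLocalDiffeomorph ((𝓡 n).prod (𝓡 k)) ((𝓡 n).prod (𝓡 k)) ∞
        (fun x : G.TgtLift π × K => (x.1.1.2, x.2)) :=
      (isLocalDiffeomorph_tgtLift_snd hG hπ hY).prodMap isLocalDiffeomorph_id
    exact hM.of_comp (h.comp hX) (leftLiftAction hG hπ hA hY hρ hM hR hX).base_smooth.continuous
  surjective := by
    rintro ⟨m, c⟩
    exact ⟨(⟨(G.unit (π m), m), G.tgt_unit _⟩, c), rfl⟩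
  invariant x g h := by
    refine Prod.ext ?_ rfl
    exact TgtLift.mulRight_snd h
  exists_div := by
    have key : ∀ x y : G.TgtLift π × K, ((x.1.1.2, x.2) : M × K) = (y.1.1.2, y.2) →
        G.tgt x.1.1.1 = G.tgt y.1.1.1 := by
      intro x y h
      have h1 : x.1.1.2 = y.1.1.2 := congrArg Prod.fst h
      exact x.1.2.trans ((congrArg π h1).trans y.1.2.symm)
    refine ⟨fun x y => G.comp (G.inv x.1.1.1) y.1.1.1, ?_, ?_, ?_⟩
    · have h : ContMDiffOn (((𝓡 n).prod (𝓡 k)).prod ((𝓡 n).prod (𝓡 k))) (𝓡 n) ∞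
          (fun q : (G.TgtLift π × K) × (G.TgtLift π × K) => G.comp (G.inv q.1.1.1.1) q.2.1.1.1)
          {q | ((q.1.1.1.2, q.1.2) : M × K) = (q.2.1.1.2, q.2.2)} :=
        G.comp_smooth.comp
          ((G.inv_smooth.comp (hY.contMDiff.comp (contMDiff_fst.comp contMDiff_fst))).prodMk
            (hY.contMDiff.comp (contMDiff_fst.comp contMDiff_snd))).contMDiffOn
          fun q hq => (G.src_inv _).trans (key _ _ hq)
      exact h.comp (hX.contMDiff.prodMap hX.contMDiff).contMDiffOn fun q hq => hq
    · intro x y h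
      have h0 := key x y h
      have h1 : G.src (G.inv x.1.1.1) = G.tgt y.1.1.1 := (G.src_inv _).trans h0
      have h2 : G.src x.1.1.1 = G.tgt (G.comp (G.inv x.1.1.1) y.1.1.1) := by
        rw [G.tgt_comp _ _ h1, G.tgt_inv]
      have h' : ((x.1.1.2, x.2) : M × K) = (y.1.1.2, y.2) := h
      obtain ⟨h3, h4⟩ := Prod.ext_iff.1 h'
      refine ⟨h2, Prod.ext (Subtype.ext ?_) h4⟩
      change (TgtLift.mulRight x.1 _).1 = _
      rw [TgtLift.mulRight_coe h2, G.comp_inv_cancel_left h0]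
      exact Prod.ext rfl h3
    · intro x g h
      change G.comp (G.inv x.1.1.1) (TgtLift.mulRight x.1 g).1.1 = g
      rw [TgtLift.mulRight_coe h, G.inv_comp_cancel_left h]

-- Two points with the same right base have arrows with the same source; they differ on the left by
-- the unique arrow y x⁻¹ of the pullback together with the `K`-data it forces. Surjectivity is that
-- of `π`.
include hπs in
theorem leftLiftAction_isPrincipal :
    (leftLiftAction hG hπ hA hY hρ hM hR hX).IsPrincipal (𝓡 n)
      (rightLiftAction (G := G) hY hX).base where
  submersion := by
    have h : IsSmoothSubmersion (𝓡 n) (𝓡 n) (G.src ∘ fun b : G.TgtLift π => b.1.1) :=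
      (IsLocalDiffeomorph.comp hG hY).isSmoothSubmersion
    exact (h.comp (isSmoothSubmersion_fst (I' := 𝓡 k) (X := K))).comp hX.isSmoothSubmersion
  surjective x := by
    obtain ⟨m, rfl⟩ := hπs x
    exact ⟨(⟨(G.unit (π m), m), G.tgt_unit _⟩, 1), G.src_unit _⟩
  invariant q x h := by
    have h1 : q.1.1.bot = x.1.1.2 := congrArg Prod.fst h
    change G.src (q.1.1.actLift x.1).1.1 = G.src x.1.1.1
    rw [PullArrow.actLift_coe h1, G.src_comp _ _ (PullArrow.src_eq_tgt_lift h1)]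
  exists_div := by
    -- For an arrow ((a, c), l) taking x to y, the target condition is ρ(a) c = y₂ and the source
    -- condition is c l = x₂; these determine c and then l.
    refine ⟨fun y x => ((TgtLift.quot y.1 x.1, (ρ (TgtLift.quot y.1 x.1))⁻¹ * y.2),
      ((ρ (TgtLift.quot y.1 x.1))⁻¹ * y.2)⁻¹ * x.2), ?_, ?_, ?_⟩
    · have hq : ContMDiffOn (((𝓡 n).prod (𝓡 k)).prod ((𝓡 n).prod (𝓡 k))) (𝓡 n) ∞
          (fun q : (G.TgtLift π × K) × (G.TgtLift π × K) => TgtLift.quot q.1.1 q.2.1)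
          {q | G.src q.1.1.1.1 = G.src q.2.1.1.1} :=
        (contMDiffOn_quot hA hY).comp ((contMDiff_fst.comp contMDiff_fst).prodMk
          (contMDiff_fst.comp contMDiff_snd)).contMDiffOn fun q hq => hq
      have hk : ContMDiffOn (((𝓡 n).prod (𝓡 k)).prod ((𝓡 n).prod (𝓡 k))) (𝓡 k) ∞
          (fun q : (G.TgtLift π × K) × (G.TgtLift π × K) =>
            (ρ (TgtLift.quot q.1.1 q.2.1))⁻¹ * q.1.2)
          {q | G.src q.1.1.1.1 = G.src q.2.1.1.1} :=
        ((hρ.smooth.comp_contMDiffOn hq).inv).mul (contMDiff_snd.comp contMDiff_fst).contMDiffOn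
      have hl := hk.inv.mul (contMDiff_snd.comp contMDiff_snd).contMDiffOn
      have hid := hX.contMDiff.prodMap hX.contMDiff
      have h1 := (hq.prodMk hk).comp hid.contMDiffOn
        (s := {q : (G.TgtLift π × K) × (G.TgtLift π × K) | G.src q.1.1.1.1 = G.src q.2.1.1.1})
        fun q hq => hq
      exact (hR.contMDiffOn_of_comp h1.continuousOn h1).prodMk
        (hl.comp hid.contMDiffOn fun q hq => hq)
    · intro y x h
      have h0 : G.src y.1.1.1 = G.src x.1.1.1 := h
      refine ⟨Prod.ext ?_ ?_, Prod.ext (TgtLift.actLift_quot h0) ?_⟩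
      · change (TgtLift.quot y.1 x.1).bot = x.1.1.2
        rw [TgtLift.quot_eq h0]
        rfl
      · exact mul_inv_cancel_left _ _
      · exact mul_inv_cancel_left _ _
    · intro q x h
      have h1 : q.1.1.bot = x.1.1.2 := congrArg Prod.fst h
      have h2 : q.1.2 * q.2 = x.2 := congrArg Prod.snd h
      change ((TgtLift.quot (q.1.1.actLift x.1) x.1,
        (ρ (TgtLift.quot (q.1.1.actLift x.1) x.1))⁻¹ * (ρ q.1.1 * q.1.2)),
        ((ρ (TgtLift.quot (q.1.1.actLift x.1) x.1))⁻¹ * (ρ q.1.1 * q.1.2))⁻¹ * x.2) = q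
      rw [TgtLift.quot_actLift h1, inv_mul_cancel_left, ← h2, inv_mul_cancel_left]

/-- The Hilsum–Skandalis equivalence between the quotient by `K` of the action groupoid and the
original groupoid. -/
noncomputable def liftEquivalence :
    HSEquivalence (translationQuotient hG hπ hA hρ hM hR) G d (G.TgtLift π × K) where
  left := leftLiftAction hG hπ hA hY hρ hM hR hX
  right := rightLiftAction hY hX
  commute q x g h h' := by
    have h1 : q.1.1.bot = x.1.1.2 := congrArg Prod.fst h
    have h0 := PullArrow.src_eq_tgt_lift h1
    have h2 : G.src (q.1.1.actLift x.1).1.1 = G.tgt g := by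
      rw [PullArrow.actLift_coe h1, G.src_comp _ _ h0]
      exact h'
    have h3 : q.1.1.bot = (TgtLift.mulRight x.1 g).1.2 := by rw [TgtLift.mulRight_coe h', h1]
    refine Prod.ext (Subtype.ext ?_) rfl
    change (TgtLift.mulRight (q.1.1.actLift x.1) g).1 = (q.1.1.actLift (TgtLift.mulRight x.1 g)).1
    rw [TgtLift.mulRight_coe h2, PullArrow.actLift_coe h3, PullArrow.actLift_coe h1,
      TgtLift.mulRight_coe h', G.assoc _ _ _ h0 h']
  right_principal := rightLiftAction_isPrincipal hG hπ hπs hA hY hρ hM hR hX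
  left_principal := leftLiftAction_isPrincipal hG hπ hπs hA hY hρ hM hR hX

end HilsumSkandalis

end SmoothGroupoid

namespace SmoothGroupoid

/-! ### The coarse quotient -/

section Coarse

variable {E₀ : Type*} [NormedAddCommGroup E₀] [NormedSpace ℝ E₀] {B₀ : Type*} [TopologicalSpace B₀]
  {E₁ : Type*} [NormedAddCommGroup E₁] [NormedSpace ℝ E₁] {B₁ : Type*} [TopologicalSpace B₁]
  {I₀ : ModelWithCorners ℝ E₀ B₀} {I₁ : ModelWithCorners ℝ E₁ B₁}
  {G₀ G₁ : Type*} [TopologicalSpace G₀] [ChartedSpace B₀ G₀]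
  [TopologicalSpace G₁] [ChartedSpace B₁ G₁] {G : SmoothGroupoid I₀ I₁ G₀ G₁}

theorem proj_eq_iff {x y : G₀} : G.proj x = G.proj y ↔ ∃ g, G.src g = x ∧ G.tgt g = y :=
  Quotient.eq

/-- The saturation of an open set U is t(s⁻¹ U), and the target map is open. -/
theorem IsEtale.isOpenQuotientMap_proj (hG : G.IsEtale) : IsOpenQuotientMap G.proj := by
  refine ⟨Quotient.mk_surjective, continuous_quotient_mk', fun U hU => ?_⟩
  rw [← isQuotientMap_quotient_mk'.isOpen_preimage]
  have : G.proj ⁻¹' (G.proj '' U) = G.tgt '' (G.src ⁻¹' U) := by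
    ext y
    constructor
    · rintro ⟨x, hx, hxy⟩
      obtain ⟨g, rfl, rfl⟩ := proj_eq_iff.1 hxy
      exact ⟨g, hx, rfl⟩
    · rintro ⟨g, hg, rfl⟩
      exact ⟨G.src g, hg, proj_eq_iff.2 ⟨g, rfl, rfl⟩⟩
  change IsOpen (G.proj ⁻¹' (G.proj '' U))
  rw [this]
  exact hG.isLocalHomeomorph_tgt.isOpenMap _ (hU.preimage G.continuous_src)

/-- For an open quotient it suffices that the relation be closed; here it is the range of the proper
map (s, t). -/
theorem IsOrbifold.t2Space_coarse (hG : G.IsOrbifold) : T2Space G.Coarse := by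
  refine t2Space_iff_of_isOpenQuotientMap hG.etale.isOpenQuotientMap_proj |>.2 ?_
  have : {q : G₀ × G₀ | G.proj q.1 = G.proj q.2} =
      Set.range (fun g : G₁ => (G.src g, G.tgt g)) := by
    ext ⟨x, y⟩
    simp only [Set.mem_ofPred_eq, proj_eq_iff, Set.mem_range, Prod.mk.injEq]
  rw [this]
  exact hG.proper.isClosed_range

theorem IsEtale.secondCountableTopology_coarse [SecondCountableTopology G₀] (hG : G.IsEtale) :
    SecondCountableTopology G.Coarse :=
  (hG.isOpenQuotientMap_proj.isQuotientMap).secondCountableTopology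
    hG.isOpenQuotientMap_proj.isOpenMap

/-- The projection of a purely ineffective orbifold groupoid onto its coarse quotient is a local
homeomorphism. -/
theorem IsOrbifold.isLocalHomeomorph_proj (hG : G.IsOrbifold) (hp : G.IsPurelyIneffective) :
    IsLocalHomeomorph G.proj := by
  have hinj : ∀ x : G₀, ∃ N ∈ 𝓝 x, Set.InjOn G.proj N := by
    intro x
    -- Ineffectivity is an open condition satisfied by every arrow over (x, x). Properness extends
    -- it to all arrows between points near x, which therefore have equal ends: nearby points in one
    -- orbit coincide.
    have h1 : ∀ g, (G.src g, G.tgt g) = (x, x) → g ∈ {g | G.IsIneffective g} := by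
      intro g hg
      obtain ⟨e1, e2⟩ := Prod.ext_iff.1 hg
      exact hp g (e1.trans e2.symm)
    have h2 := hG.proper.isClosedMap.eventually_fiber_subset
      hG.etale.isOpen_setOf_isIneffective h1
    rw [nhds_prod_eq] at h2
    obtain ⟨N, hN, h3⟩ := Filter.mem_prod_same_iff.1 h2
    refine ⟨N, hN, fun y hy z hz hyz => ?_⟩
    obtain ⟨g, rfl, rfl⟩ := proj_eq_iff.1 hyz
    exact IsIneffective.tgt_eq (h3 (Set.mk_mem_prod hy hz) g rfl) |>.symm
  rw [isLocalHomeomorph_iff_isOpenEmbedding_restrict]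
  intro x
  obtain ⟨N, hN, hi⟩ := hinj x
  obtain ⟨N', hN', hNo, hx⟩ := mem_nhds_iff.1 hN
  refine ⟨N', hNo.mem_nhds hx, .of_continuous_injective_isOpenMap
    (hG.etale.isOpenQuotientMap_proj.continuous.comp continuous_subtype_val) ?_
    (hG.etale.isOpenQuotientMap_proj.isOpenMap.domRestrict hNo)⟩
  exact Set.injOn_iff_injective.1 (hi.mono hN')

end Coarse

/-! ### Smooth structure on the coarse quotient and the gerbe -/

section Gerbe

variable {d : ℕ} {G₀ G₁ : Type*}
    [TopologicalSpace G₀] [ChartedSpace (EuclideanSpace ℝ (Fin d)) G₀]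
    [TopologicalSpace G₁] [ChartedSpace (EuclideanSpace ℝ (Fin d)) G₁]
    {G : SmoothGroupoid (𝓡 d) (𝓡 d) G₀ G₁}

/-- A purely ineffective orbifold groupoid is a manifold together with a gerbe on it. -/
theorem IsOrbifold.isManifoldWithGerbe [IsSmoothMfd d G₀] (hG : G.IsOrbifold)
    (hp : G.IsPurelyIneffective) : G.IsManifoldWithGerbe := by
  have hloc := hG.isLocalHomeomorph_proj hp
  choose φ hφ hpφ using hloc
  obtain ⟨cs, hm, h⟩ := exists_chartedSpace_of_openPartialHomeomorph (I := 𝓡 d)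
    (Homeomorph.refl (EuclideanSpace ℝ (Fin d))) contMDiff_id contMDiff_id
    (fun x => (φ x).symm) (fun p => by
      obtain ⟨x, rfl⟩ := Quotient.exists_rep p
      refine ⟨x, ?_⟩
      have := (φ x).map_source (hφ x)
      rw [← hpφ x] at this
      exact this) (by
      intro x y z hz
      refine ContMDiffAt.contMDiffWithinAt ?_
      rw [OpenPartialHomeomorph.symm_symm, OpenPartialHomeomorph.trans_source] at hz
      obtain ⟨hz1, hz2⟩ := hz
      simp only [Set.mem_preimage, OpenPartialHomeomorph.symm_source] at hz2
      -- The points `z` and `w` lie in one orbit; near `z` the change of charts is the germ induced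
      -- by an arrow from `z` to `w`, hence smooth.
      set w := (φ y).symm (φ x z) with hw
      have hwz : G.proj z = G.proj w := by
        rw [hpφ y, (φ y).right_inv hz2, ← hpφ y, hpφ x]
      obtain ⟨g, hg1, hg2⟩ := proj_eq_iff.1 hwz
      obtain ⟨σ, U, hU, hxU, hσ, hσx, hr, -⟩ := (hG.etale g).exists_section
      rw [hg1] at hxU hσx
      have hσz : ContMDiffAt (𝓡 d) (𝓡 d) ∞ σ z := hσ.contMDiffAt (hU.mem_nhds hxU)
      have h1 : ContMDiffAt (𝓡 d) (𝓡 d) ∞ (fun z' => G.tgt (σ z')) z :=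
        (G.tgt_smooth (σ z)).comp z hσz
      refine h1.congr_of_eventuallyEq ?_
      have hws : w ∈ (φ y).source := (φ y).map_target hz2
      have e1 : ∀ᶠ z' in 𝓝 z, G.tgt (σ z') ∈ (φ y).source := by
        refine h1.continuousAt.eventually ?_
        simp only [hσx, hg2]
        exact (φ y).open_source.mem_nhds hws
      filter_upwards [e1, hU.eventually_mem hxU, (φ x).open_source.mem_nhds hz1] with z' h2 h3 h4
      change (φ y).symm (φ x z') = G.tgt (σ z')
      have h5 : G.proj z' = G.proj (G.tgt (σ z')) := proj_eq_iff.2 ⟨σ z', hr _ h3, rfl⟩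
      have h6 : φ x z' = φ y (G.tgt (σ z')) := by rw [← hpφ x, h5, hpφ y]
      rw [h6, (φ y).left_inv h2])
  have hproj : IsLocalDiffeomorph (𝓡 d) (𝓡 d) ∞ G.proj := fun x =>
    .of_openPartialHomeomorph (φ x) (hφ x) (fun y _ => by rw [← hpφ x]) (h x).2 (h x).1
  have hT2 := hG.t2Space_coarse
  have hsc := hG.etale.secondCountableTopology_coarse
  refine ⟨cs, { hm, hT2, hsc with }, hproj, ?_, ?_⟩
  · intro p
    obtain ⟨x, rfl⟩ := Quotient.exists_rep p
    obtain ⟨σ, U, hU, hxU, hσ, hσx, hr, -⟩ := (hproj x).exists_section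
    exact ⟨U, σ, hU, hxU, hσ, hr⟩
  · intro U σ τ hU hσ hσp hτ hτp p hpU
    obtain ⟨g, hg1, hg2⟩ := proj_eq_iff.1 ((hσp p hpU).trans (hτp p hpU).symm)
    obtain ⟨κ, W, hW, hxW, hκ, hκx, hr, -⟩ := (hG.etale g).exists_section
    rw [hg1] at hxW hκx
    have hσc : ContinuousAt σ p := hσ.continuousOn.continuousAt (hU.mem_nhds hpU)
    have hτc : ContinuousAt τ p := hτ.continuousOn.continuousAt (hU.mem_nhds hpU)
    have hκc : ContinuousAt κ (σ p) := hκ.continuousOn.continuousAt (hW.mem_nhds hxW)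
    have hlim : Filter.Tendsto (fun q => G.tgt (κ (σ q))) (𝓝 p) (𝓝 (τ p)) := by
      have h1 : ContinuousAt (fun q => G.tgt (κ (σ q))) p :=
        G.continuous_tgt.continuousAt.comp (hκc.comp hσc)
      have h2 := h1.tendsto
      simp only [hκx, hg2] at h2
      exact h2
    have hev1 : ∀ᶠ q in 𝓝 p, σ q ∈ W := hσc.eventually (hW.mem_nhds hxW)
    -- Both sides are lifts along the étale projection that agree at `p`, so the arrow from σ(p) to
    -- τ(p) extends to an isomorphism of sections near `p`.
    have hev : ∀ᶠ q in 𝓝 p, G.tgt (κ (σ q)) = τ q := by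
      refine hproj.isLocalHomeomorph.eventually_unique_lift hlim hτc.tendsto ?_
      filter_upwards [hev1, hU.eventually_mem hpU] with q h1 h2
      rw [hτp q h2]
      exact (proj_eq_iff.2 ⟨κ (σ q), hr _ h1, rfl⟩).symm.trans (hσp q h2)
    obtain ⟨V, hV, hVo, hpV⟩ := eventually_nhds_iff.1
      (hev.and (hev1.and (hU.eventually_mem hpU)))
    refine ⟨V, κ ∘ σ, hVo, hpV, fun q hq => (hV q hq).2.2, ?_, fun q hq => ⟨hr _ (hV q hq).2.1,
      (hV q hq).1⟩⟩
    exact hκ.comp (hσ.mono fun q hq => (hV q hq).2.2) fun q hq => (hV q hq).2.1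

end Gerbe

end SmoothGroupoid

/-! ### Sums over the fibres of a local diffeomorphism -/

section FiberSum

variable {E : Type*} [NormedAddCommGroup E] [NormedSpace ℝ E] {B : Type*} [TopologicalSpace B]
  {I : ModelWithCorners ℝ E B} {N : Type*} [TopologicalSpace N] [ChartedSpace B N]
  {E' : Type*} [NormedAddCommGroup E'] [NormedSpace ℝ E'] {B' : Type*} [TopologicalSpace B']
  {I' : ModelWithCorners ℝ E' B'} {X : Type*} [TopologicalSpace X] [ChartedSpace B' X]
  {V : Type*} [NormedAddCommGroup V] [NormedSpace ℝ V]

theorem IsLocalHomeomorph.finite_fiber_inter {p : X → N} (hp : IsLocalHomeomorph p) {Z : Set X}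
    (hZ : ∀ y, ∃ C ∈ 𝓝 y, IsCompact (p ⁻¹' C ∩ Z)) [T1Space N] (y : N) :
    (p ⁻¹' {y} ∩ Z).Finite := by
  obtain ⟨C, hC, hK⟩ := hZ y
  have h1 : IsCompact (p ⁻¹' {y} ∩ (p ⁻¹' C ∩ Z)) := by
    rw [Set.inter_comm]
    exact hK.inter_right (isClosed_singleton.preimage hp.continuous)
  refine (hp.finite_of_isCompact_fiber (y := y) h1 fun x hx => hx.1).subset ?_
  rintro x ⟨hx, hxZ⟩
  refine ⟨hx, ?_, hxZ⟩
  rw [Set.mem_preimage, Set.mem_singleton_iff.1 hx]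
  exact mem_of_mem_nhds hC

/-- The sum of a smooth function over the fibres of a local diffeomorphism is smooth if the
support of the function is proper over the base. -/
theorem IsLocalDiffeomorph.contMDiff_finsum_fiber [T2Space N] [T2Space X] {p : X → N}
    (hp : IsLocalDiffeomorph I' I ∞ p) {Z : Set X}
    (hZ : ∀ y, ∃ C ∈ 𝓝 y, IsCompact (p ⁻¹' C ∩ Z)) {F : X → V}
    (hF : ContMDiff I' 𝓘(ℝ, V) ∞ F) (hFZ : Function.support F ⊆ Z) :
    ContMDiff I 𝓘(ℝ, V) ∞ (fun y => ∑ᶠ x ∈ p ⁻¹' {y}, F x) := by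
  classical
  intro y
  have hfin := hp.isLocalHomeomorph.finite_fiber_inter hZ y
  -- The finitely many points of `Z` over `y`. Near `y` the fibre sum is the finite sum of `F` along
  -- the local sections through these points.
  set Φ := hfin.toFinset with hΦ
  have hmem : ∀ x ∈ Φ, p x = y := fun x hx => (hfin.mem_toFinset.1 hx).1
  have hsec : ∀ x : X, ∃ σ : N → X, p x = y → σ y = x ∧ ContMDiffAt I I' ∞ σ y ∧
      (∀ᶠ z in 𝓝 y, p (σ z) = z) ∧ ∀ᶠ x' in 𝓝 x, σ (p x') = x' := by
    intro x
    obtain ⟨σ, U, hU, hxU, hσ, hσx, hr, hl⟩ := (hp x).exists_section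
    refine ⟨σ, fun hx => ?_⟩
    rw [hx] at hxU hσx
    exact ⟨hσx, hσ.contMDiffAt (hU.mem_nhds hxU), (hU.eventually_mem hxU).mono hr, hl⟩
  choose σ hσ using hsec
  have hsm : ContMDiffAt I 𝓘(ℝ, V) ∞ (fun z => ∑ x ∈ Φ, F (σ x z)) y := by
    refine contMDiffAt_finsetSum fun x hx => ?_
    exact (hF (σ x y)).comp y (hσ x (hmem x hx)).2.1
  refine hsm.congr_of_eventuallyEq ?_
  have h1 : ∀ᶠ z in 𝓝 y, ∀ x ∈ Φ, p (σ x z) = z :=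
    (Filter.eventually_all_finset Φ).2 fun x hx => (hσ x (hmem x hx)).2.2.1
  have h2 : ∀ᶠ z in 𝓝 y, ∀ x ∈ Φ, ∀ x' ∈ Φ, σ x z = σ x' z → x = x' := by
    refine (Filter.eventually_all_finset Φ).2 fun x hx =>
      (Filter.eventually_all_finset Φ).2 fun x' hx' => ?_
    by_cases hxx : x = x'
    · exact Filter.Eventually.of_forall fun _ _ => hxx
    · obtain ⟨e1, c1, -⟩ := hσ x (hmem x hx)
      obtain ⟨e2, c2, -⟩ := hσ x' (hmem x' hx')
      have hc := c1.continuousAt.prodMk c2.continuousAt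
      filter_upwards [hc.eventually ((isOpen_ne_fun continuous_fst continuous_snd).mem_nhds
        (show σ x y ≠ σ x' y by rw [e1, e2]; exact hxx))] with z h3 h4
      exact absurd h4 h3
  -- Points of `Z` over `C` off the sections lie in a compact set whose image is closed and misses
  -- `y`; so no new point of the support enters the nearby fibres.
  have h3 : ∀ᶠ z in 𝓝 y, ∀ x, p x = z → x ∈ Z → ∃ x' ∈ Φ, σ x' z = x := by
    obtain ⟨C, hC, hK⟩ := hZ y
    set W : Set X := interior {x | ∃ x' ∈ Φ, σ x' (p x) = x}
    have hcl : IsClosed (p '' ((p ⁻¹' C ∩ Z) \ W)) :=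
      ((hK.diff isOpen_interior).image hp.contMDiff.continuous).isClosed
    have hy : y ∉ p '' ((p ⁻¹' C ∩ Z) \ W) := by
      rintro ⟨x, ⟨hx, hxW⟩, hxy⟩
      refine hxW (mem_interior_iff_mem_nhds.2 ?_)
      filter_upwards [(hσ x hxy).2.2.2] with x' hx'
      exact ⟨x, hfin.mem_toFinset.2 ⟨hxy, hx.2⟩, hx'⟩
    filter_upwards [hcl.isOpen_compl.mem_nhds hy, hC] with z hz hzC x hx hxZ
    by_contra hne
    refine hz ⟨x, ⟨⟨by rwa [Set.mem_preimage, hx], hxZ⟩, fun hW => hne ?_⟩, hx⟩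
    obtain ⟨x', hx', he⟩ := interior_subset hW
    exact ⟨x', hx', by rw [← hx, he]⟩
  filter_upwards [h1, h2, h3] with z e1 e2 e3
  rw [finsum_mem_eq_sum_of_inter_support_eq (t := Φ.image fun x => σ x z) F ?_,
    Finset.sum_image fun x hx x' hx' h => e2 x hx x' hx' h]
  ext x
  simp only [Set.mem_inter_iff, Set.mem_preimage, Set.mem_singleton_iff, Finset.coe_image,
    Set.mem_image, Finset.mem_coe]
  constructor
  · rintro ⟨hx, hxF⟩
    exact ⟨e3 x hx (hFZ hxF), hxF⟩
  · rintro ⟨⟨x', hx', rfl⟩, hxF⟩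
    exact ⟨e1 x' hx', hxF⟩

end FiberSum

/-! ### Smooth Gram–Schmidt -/

/-- A smooth family of inner products on Euclidean space has a smooth family of orthonormal
frames. -/
theorem exists_contMDiff_orthonormal_frame {E : Type*} [NormedAddCommGroup E] [NormedSpace ℝ E]
    {B : Type*} [TopologicalSpace B] {I : ModelWithCorners ℝ E B} {M : Type*} [TopologicalSpace M]
    [ChartedSpace B M] {n : ℕ}
    {h : M → EuclideanSpace ℝ (Fin n) →L[ℝ] EuclideanSpace ℝ (Fin n)}
    (hs : ContMDiff I 𝓘(ℝ, EuclideanSpace ℝ (Fin n) →L[ℝ] EuclideanSpace ℝ (Fin n)) ∞ h)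
    (hsym : ∀ m v w, inner ℝ (h m v) w = inner ℝ (h m w) v)
    (hpos : ∀ m v, v ≠ 0 → 0 < inner ℝ (h m v) v) :
    ∃ b : M → EuclideanSpace ℝ (Fin n) →L[ℝ] EuclideanSpace ℝ (Fin n),
      ContMDiff I 𝓘(ℝ, EuclideanSpace ℝ (Fin n) →L[ℝ] EuclideanSpace ℝ (Fin n)) ∞ b ∧
      ∀ m v w, inner ℝ (h m (b m v)) (b m w) = inner ℝ v w := by
  classical
  let e : Fin n → EuclideanSpace ℝ (Fin n) := EuclideanSpace.basisFun (Fin n) ℝ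
  have hin : ∀ {f g : M → EuclideanSpace ℝ (Fin n)}, ContMDiff I (𝓡 n) ∞ f →
      ContMDiff I (𝓡 n) ∞ g → ContMDiff I 𝓘(ℝ, ℝ) ∞ (fun m => inner ℝ (f m) (g m)) := by
    intro f g hf hg
    exact (contDiff_inner.contMDiff (n := ∞)).comp (hf.prodMk_space hg)
  -- Gram–Schmidt in `j` steps, with later entries left as placeholders. The span condition is
  -- carried along to show that the next vector does not vanish.
  have key : ∀ j : ℕ, j ≤ n → ∃ u : Fin n → M → EuclideanSpace ℝ (Fin n),
      (∀ i, ContMDiff I (𝓡 n) ∞ (u i)) ∧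
      (∀ i l : Fin n, i.val < j → l.val < j → ∀ m,
        inner ℝ (h m (u i m)) (u l m) = if i = l then 1 else 0) ∧
      ∀ i : Fin n, i.val < j → ∀ m, u i m ∈ Submodule.span ℝ (e '' {l | l.val < j}) := by
    intro j
    induction j with
    | zero =>
      intro _
      exact ⟨fun _ _ => 0, fun _ => contMDiff_const, fun i l hi => absurd hi (by simp),
        fun i hi => absurd hi (by simp)⟩
    | succ j ih =>
      intro hj
      obtain ⟨u, hu, ho, hsp⟩ := ih (by omega)
      let J : Fin n := ⟨j, by omega⟩
      let S : Finset (Fin n) := Finset.univ.filter fun l => l.val < j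
      let w : M → EuclideanSpace ℝ (Fin n) := fun m =>
        e J - ∑ i ∈ S, (inner ℝ (h m (u i m)) (e J)) • u i m
      have hw : ContMDiff I (𝓡 n) ∞ w := by
        refine contMDiff_const.sub (contMDiff_finsetSum fun i _ => ?_)
        exact (hin (hs.clm_apply (hu i)) contMDiff_const).smul (hu i)
      have hmono : Submodule.span ℝ (e '' {l | l.val < j}) ≤
          Submodule.span ℝ (e '' {l | l.val < j + 1}) :=
        Submodule.span_mono (Set.image_mono fun l (hl : l.val < j) => Nat.lt_succ_of_lt hl)
      have hsum : ∀ m, ∑ i ∈ S, (inner ℝ (h m (u i m)) (e J)) • u i m ∈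
          Submodule.span ℝ (e '' {l | l.val < j}) := fun m =>
        Submodule.sum_mem _ fun i hi => Submodule.smul_mem _ _
          (hsp i (Finset.mem_filter.1 hi).2 m)
      -- Otherwise the j-th basis vector would lie in the span of the earlier ones.
      have hw0 : ∀ m, w m ≠ 0 := by
        intro m h0
        have h1 : e J ∈ Submodule.span ℝ (e '' {l | l.val < j}) := by
          rw [sub_eq_zero.1 h0]
          exact hsum m
        have h2 := (EuclideanSpace.basisFun (Fin n) ℝ).toBasis.linearIndependent
        rw [OrthonormalBasis.coe_toBasis] at h2
        exact h2.notMem_span_image (s := {l : Fin n | l.val < j}) (x := J)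
          (by simp [J]) h1
      have hwsp : ∀ m, w m ∈ Submodule.span ℝ (e '' {l | l.val < j + 1}) := fun m =>
        Submodule.sub_mem _ (Submodule.subset_span ⟨J, by simp [J], rfl⟩) (hmono (hsum m))
      have hwo : ∀ m (l : Fin n), l.val < j → inner ℝ (h m (u l m)) (w m) = 0 := by
        intro m l hl
        have hlS : l ∈ S := Finset.mem_filter.2 ⟨Finset.mem_univ _, hl⟩
        simp only [w, inner_sub_right, inner_sum, inner_smul_right]
        rw [Finset.sum_eq_single l, ho l l hl hl m, if_pos rfl, mul_one, sub_self]
        · intro i hi hil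
          rw [ho l i hl (Finset.mem_filter.1 hi).2 m, if_neg (Ne.symm hil), mul_zero]
        · intro hl'
          exact absurd hlS hl'
      let r : M → ℝ := fun m => (Real.sqrt (inner ℝ (h m (w m)) (w m)))⁻¹
      have hr : ContMDiff I 𝓘(ℝ, ℝ) ∞ r := by
        intro m
        have h1 : ContDiffAt ℝ ∞ (fun t : ℝ => (Real.sqrt t)⁻¹) (inner ℝ (h m (w m)) (w m)) :=
          (Real.contDiffAt_sqrt (hpos m _ (hw0 m)).ne').inv
            (Real.sqrt_ne_zero'.2 (hpos m _ (hw0 m)))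
        exact ContMDiffAt.comp (x := m) (g := fun t : ℝ => (Real.sqrt t)⁻¹) h1.contMDiffAt
          (hin (hs.clm_apply hw) hw m)
      have hrr : ∀ m, r m * (r m * inner ℝ (h m (w m)) (w m)) = 1 := by
        intro m
        have h1 := hpos m _ (hw0 m)
        have h2 := Real.mul_self_sqrt h1.le
        have h3 := (Real.sqrt_pos.2 h1).ne'
        simp only [r]
        nth_rewrite 3 [← h2]
        field_simp
      refine ⟨Function.update u J fun m => r m • w m, ?_, ?_, ?_⟩
      · intro i
        by_cases hi : i = J
        · subst hi
          rw [Function.update_self]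
          exact hr.smul hw
        · rw [Function.update_of_ne hi]
          exact hu i
      · intro i l hi hl m
        have hlt : ∀ i : Fin n, i.val < j + 1 → i ≠ J → i.val < j := by
          intro i hi hiJ
          have : i.val ≠ j := fun hc => hiJ (Fin.ext hc)
          omega
        by_cases hiJ : i = J
        · by_cases hlJ : l = J
          · rw [hiJ, hlJ, if_pos rfl, Function.update_self, map_smul, inner_smul_left,
              inner_smul_right]
            exact hrr m
          · rw [hiJ, if_neg (Ne.symm hlJ), Function.update_self, Function.update_of_ne hlJ,
              map_smul, inner_smul_left, hsym, hwo m l (hlt l hl hlJ), mul_zero]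
        · by_cases hlJ : l = J
          · rw [hlJ, if_neg hiJ, Function.update_self, Function.update_of_ne hiJ,
              inner_smul_right, hwo m i (hlt i hi hiJ), mul_zero]
          · rw [Function.update_of_ne hiJ, Function.update_of_ne hlJ]
            exact ho i l (hlt i hi hiJ) (hlt l hl hlJ) m
      · intro i hi m
        by_cases hiJ : i = J
        · rw [hiJ, Function.update_self]
          exact Submodule.smul_mem _ _ (hwsp m)
        · rw [Function.update_of_ne hiJ]
          have : i.val ≠ j := fun hc => hiJ (Fin.ext hc)
          exact hmono (hsp i (by omega) m)
  obtain ⟨u, hu, ho, -⟩ := key n le_rfl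
  -- The operator that takes the standard basis to the orthonormal frame.
  refine ⟨fun m => ∑ i, ContinuousLinearMap.smulRightL ℝ _ _ (innerSL ℝ (e i)) (u i m), ?_, ?_⟩
  · refine contMDiff_finsetSum fun i _ => ?_
    exact (ContinuousLinearMap.contDiff _).contMDiff.comp (hu i)
  · intro m v w
    have hb : ∀ v : EuclideanSpace ℝ (Fin n),
        (∑ i, ContinuousLinearMap.smulRightL ℝ _ _ (innerSL ℝ (e i)) (u i m)) v =
        ∑ i, v i • u i m := by
      intro v
      rw [sum_apply]
      refine Finset.sum_congr rfl fun i _ => ?_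
      simp [e, EuclideanSpace.inner_single_left]
    rw [hb, hb, map_sum, sum_inner]
    have h1 : ∀ i, inner ℝ (h m (v i • u i m)) (∑ l, w l • u l m) = v i * w i := by
      intro i
      rw [map_smul, inner_smul_left, inner_sum]
      simp only [inner_smul_right]
      rw [Finset.sum_eq_single i, ho i i i.2 i.2 m, if_pos rfl]
      · simp
      · intro l _ hl
        rw [ho i l i.2 l.2 m, if_neg (Ne.symm hl), mul_zero]
      · simp
    simp only [h1]
    simp [PiLp.inner_apply, mul_comm]

namespace SmoothGroupoid

/-! ### The differential cocycle -/

section Jacobian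

variable {E₀ : Type*} [NormedAddCommGroup E₀] [NormedSpace ℝ E₀] {B₀ : Type*} [TopologicalSpace B₀]
  {E₁ : Type*} [NormedAddCommGroup E₁] [NormedSpace ℝ E₁] {B₁ : Type*} [TopologicalSpace B₁]
  {I₀ : ModelWithCorners ℝ E₀ B₀} {I₁ : ModelWithCorners ℝ E₁ B₁}
  {G₀ G₁ : Type*} [TopologicalSpace G₀] [ChartedSpace B₀ G₀]
  [TopologicalSpace G₁] [ChartedSpace B₁ G₁]
  {E : Type*} [NormedAddCommGroup E] [NormedSpace ℝ E]
  {G : SmoothGroupoid I₀ I₁ G₀ G₁} {χ : G₀ → E}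

/-- In global étale coordinates, the differentials of the germs induced by the arrows form a smooth
cocycle, which detects the ineffective arrows among the stabilizer arrows. -/
theorem IsOrbifold.exists_jacobian [T2Space G₀] (hG : G.IsOrbifold)
    (hχ : IsLocalDiffeomorph I₀ 𝓘(ℝ, E) ∞ χ) :
    ∃ J : G₁ → E →L[ℝ] E, ContMDiff I₁ 𝓘(ℝ, E →L[ℝ] E) ∞ J ∧
      (∀ g h, G.src g = G.tgt h → J (G.comp g h) = J g * J h) ∧
      (∀ g, G.IsIneffective g → J g = 1) ∧
      ∀ g, G.src g = G.tgt g → J g = 1 → G.IsIneffective g := by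
  have hex : ∀ g, ∃ f : E → E, G.IsGerm χ f g ∧ ContDiffAt ℝ ∞ f (χ (G.src g)) := fun g =>
    hG.etale.exists_isGerm (hχ _) (hχ _).contMDiffAt
  choose f hf hfc using hex
  -- The differential does not depend on the chosen representative of the germ. Hence one
  -- representative at `g` computes it at all nearby arrows, which gives smoothness, and composites
  -- of representatives give the cocycle rule.
  have key : ∀ {g : G₁} {f' : E → E}, G.IsGerm χ f' g →
      fderiv ℝ (f g) (χ (G.src g)) = fderiv ℝ f' (χ (G.src g)) := fun {g f'} h =>
    (IsGerm.eventuallyEq hG.etale (hχ _) (hf g) h).fderiv_eq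
  have hcoord : ContMDiff I₁ 𝓘(ℝ, E) ∞ (fun g => χ (G.src g)) :=
    hχ.contMDiff.comp G.src_submersion.smooth
  refine ⟨fun g => fderiv ℝ (f g) (χ (G.src g)), ?_, ?_, ?_, ?_⟩
  · intro g
    have h1 : ContDiffAt ℝ ∞ (fderiv ℝ (f g)) (χ (G.src g)) :=
      (hfc g).fderiv_right (m := ∞) (by simp)
    have h2 : ContMDiffAt I₁ 𝓘(ℝ, E →L[ℝ] E) ∞ (fun g' => fderiv ℝ (f g) (χ (G.src g'))) g :=
      ContMDiffAt.comp (x := g) (g := fderiv ℝ (f g)) h1.contMDiffAt (hcoord g)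
    refine h2.congr_of_eventuallyEq ?_
    filter_upwards [(hf g).eventually] with g' hg' using key hg'
  · intro g h hgh
    have hc : f h (χ (G.src h)) = χ (G.src g) := by
      rw [(hf h).self_of_nhds, hgh]
    have h1 := key (IsGerm.comp hG.etale hgh (hf g) (hf h))
    rw [G.src_comp _ _ hgh, fderiv_comp, hc] at h1
    · refine Eq.trans ?_ h1
      rw [← G.src_comp _ _ hgh]
    · rw [hc]
      exact (hfc g).differentiableAt (by simp)
    · exact (hfc h).differentiableAt (by simp)
  · intro g hg
    have h1 : G.IsGerm χ id g := by
      filter_upwards [hG.etale.isIneffective_iff.1 hg] with g' hg'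
      rw [hg', id]
    change fderiv ℝ (f g) (χ (G.src g)) = 1
    rw [key h1, fderiv_id]
    rfl
  · intro g hg h
    exact hG.isIneffective_of_fderiv (x := G.src g) ⟨g, rfl, hg.symm⟩ (hχ _) (hf g) h

end Jacobian

/-! ### Cutoff functions -/

section Cutoff

variable {n : ℕ} {M R : Type*}
  [TopologicalSpace M] [ChartedSpace (EuclideanSpace ℝ (Fin n)) M] [IsSmoothMfd n M]
  [TopologicalSpace R] [ChartedSpace (EuclideanSpace ℝ (Fin n)) R]
  {G : SmoothGroupoid (𝓡 n) (𝓡 n) M R}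

/-- A cutoff function of an orbifold groupoid: a nonnegative smooth function, not identically zero
on any orbit, whose support is proper over the coarse quotient. -/
theorem IsOrbifold.exists_cutoff (hG : G.IsOrbifold) :
    ∃ c : M → ℝ, ContMDiff (𝓡 n) 𝓘(ℝ, ℝ) ∞ c ∧ (∀ m, 0 ≤ c m) ∧
      (∀ m, ∃ g, G.src g = m ∧ 0 < c (G.tgt g)) ∧
      ∀ m, ∃ C ∈ 𝓝 m, IsCompact (G.src ⁻¹' C ∩ G.tgt ⁻¹' tsupport c) := by
  have hq := hG.etale.isOpenQuotientMap_proj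
  have := hG.t2Space_coarse
  have := hG.etale.secondCountableTopology_coarse
  have hlM : LocallyCompactSpace M :=
    ChartedSpace.locallyCompactSpace (EuclideanSpace ℝ (Fin n)) M
  have := hq.locallyCompactSpace
  have hout : ∀ q : G.Coarse, G.proj q.out = q := fun q => Quotient.out_eq q
  -- The projection is open, so the images of supports of bump functions around a representative
  -- form a basis of neighbourhoods in the coarse space.
  have hB : ∀ q : G.Coarse, (𝓝 q).HasBasis
      (fun f : SmoothBumpFunction (𝓡 n) q.out => tsupport f ⊆ Set.univ)
      (fun f => G.proj '' Function.support f) := by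
    intro q
    have h1 := (SmoothBumpFunction.nhds_basis_support (I := 𝓡 n) (c := q.out)
      Filter.univ_mem).map G.proj
    rwa [hq.map_nhds_eq, hout] at h1
  -- Paracompactness is applied to the coarse space, not to `M`: the supports then form a family
  -- locally finite over the coarse space, and their images cover every orbit.
  obtain ⟨ι, q, f, -, hcov, hfin⟩ := refinement_of_locallyCompact_sigmaCompact_of_nhds_basis hB
  have hfinM : LocallyFinite fun a => Function.support (f a) :=
    (hfin.preimage_continuous hq.continuous).subset fun a => Set.subset_preimage_image _ _
  have hsuppfin : ∀ m, (Function.support fun a => f a m).Finite := fun m =>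
    (hfinM.point_finite m).subset fun a ha => ha
  refine ⟨fun m => ∑ᶠ a, f a m, ?_, ?_, ?_, ?_⟩
  · exact contMDiff_finsum (fun a => (f a).contMDiff) hfinM
  · exact fun m => finsum_nonneg fun a => (f a).nonneg
  · intro m
    have hm : G.proj m ∈ ⋃ a, G.proj '' Function.support (f a) := by
      rw [hcov]
      trivial
    obtain ⟨a, m', hm', he⟩ := Set.mem_iUnion.1 hm
    obtain ⟨g, hg, hg'⟩ := proj_eq_iff.1 he.symm
    refine ⟨g, hg, ?_⟩
    rw [hg']
    exact ((f a).nonneg.lt_of_ne (Ne.symm hm')).trans_le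
      (single_le_finsum a (hsuppfin m') fun b => (f b).nonneg)
  · intro m
    obtain ⟨N, hN, hNfin⟩ := hfin.closure (G.proj m)
    obtain ⟨C, hC, hCN, hCc⟩ := local_compact_nhds (hq.continuous.continuousAt hN)
    refine ⟨C, hC, ?_⟩
    -- Only finitely many bump functions have support meeting the orbits through `C`, so the arrows
    -- in question run from a compact set to a compact set.
    have hK : IsCompact (⋃ a ∈ hNfin.toFinset, tsupport (f a)) :=
      hNfin.toFinset.isCompact_biUnion fun a _ => (f a).hasCompactSupport
    refine (hG.proper.isCompact_preimage (hCc.prod hK)).of_isClosed_subset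
      ((hCc.isClosed.preimage G.continuous_src).inter
        ((isClosed_tsupport _).preimage G.continuous_tgt)) ?_
    rintro g ⟨hg, hg'⟩
    refine ⟨hg, ?_⟩
    have h1 : tsupport (fun m => ∑ᶠ a, f a m) ⊆ ⋃ a, tsupport (f a) := by
      refine (closure_mono (t := ⋃ a, Function.support (f a)) fun m hm => by
        obtain ⟨a, ha⟩ : ∃ a, f a m ≠ 0 := by
          by_contra! h0
          exact hm (finsum_eq_zero_of_forall_eq_zero h0)
        exact Set.mem_iUnion.2 ⟨a, ha⟩).trans hfinM.closure_iUnion.le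
    obtain ⟨a, ha⟩ := Set.mem_iUnion.1 (h1 hg')
    refine Set.mem_biUnion (hNfin.mem_toFinset.2 ⟨G.proj (G.src g), ?_, hCN hg⟩) ha
    rw [proj_eq_iff.2 ⟨g, rfl, rfl⟩]
    exact image_closure_subset_closure_image hq.continuous ⟨_, ha, rfl⟩

end Cutoff

/-! ### Invariant metric and orthogonal representation -/

section Metric

variable {n : ℕ} {M R : Type*}
  [TopologicalSpace M] [ChartedSpace (EuclideanSpace ℝ (Fin n)) M] [IsSmoothMfd n M]
  [TopologicalSpace R] [ChartedSpace (EuclideanSpace ℝ (Fin n)) R] [T2Space R]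
  {G : SmoothGroupoid (𝓡 n) (𝓡 n) M R}

/-- Averaging over a cutoff function produces a smooth metric invariant under a smooth cocycle. -/
theorem IsOrbifold.exists_invariant_metric (hG : G.IsOrbifold)
    {J : R → EuclideanSpace ℝ (Fin n) →L[ℝ] EuclideanSpace ℝ (Fin n)}
    (hJ : ContMDiff (𝓡 n) 𝓘(ℝ, EuclideanSpace ℝ (Fin n) →L[ℝ] EuclideanSpace ℝ (Fin n)) ∞ J)
    (hJc : ∀ g h, G.src g = G.tgt h → J (G.comp g h) = J g * J h)
    (hJu : ∀ m, J (G.unit m) = 1) :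
    ∃ h : M → EuclideanSpace ℝ (Fin n) →L[ℝ] EuclideanSpace ℝ (Fin n),
      ContMDiff (𝓡 n) 𝓘(ℝ, EuclideanSpace ℝ (Fin n) →L[ℝ] EuclideanSpace ℝ (Fin n)) ∞ h ∧
      (∀ m v w, inner ℝ (h m v) w = inner ℝ (h m w) v) ∧
      (∀ m v, v ≠ 0 → 0 < inner ℝ (h m v) v) ∧
      ∀ g v w, inner ℝ (h (G.tgt g) (J g v)) (J g w) = inner ℝ (h (G.src g) v) w := by
  obtain ⟨c, hc, hc0, hcpos, hcp⟩ := hG.exists_cutoff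
  have hfin : ∀ m, (G.src ⁻¹' {m} ∩ G.tgt ⁻¹' tsupport c).Finite :=
    hG.etale.isLocalHomeomorph_src.finite_fiber_inter hcp
  -- The standard inner product at the target of `g`, pulled back by J(g) and weighted by the cutoff
  -- there; the metric at m is the sum over all arrows leaving m.
  let F : R → EuclideanSpace ℝ (Fin n) →L[ℝ] EuclideanSpace ℝ (Fin n) :=
    fun g => c (G.tgt g) • (star (J g) * J g)
  have hFs : Function.support F ⊆ G.tgt ⁻¹' tsupport c := by
    intro g hg
    refine subset_tsupport c fun h0 => hg ?_
    exact (congrArg (· • (star (J g) * J g)) h0).trans (zero_smul ℝ (star (J g) * J g))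
  have hFsm : ContMDiff (𝓡 n) 𝓘(ℝ, EuclideanSpace ℝ (Fin n) →L[ℝ] EuclideanSpace ℝ (Fin n)) ∞
      F := by
    refine ContMDiff.smul (hc.comp G.tgt_smooth) ?_
    refine ContMDiff.clm_comp ?_ hJ
    exact (starL' ℝ : (EuclideanSpace ℝ (Fin n) →L[ℝ] EuclideanSpace ℝ (Fin n)) ≃L[ℝ]
      (EuclideanSpace ℝ (Fin n) →L[ℝ] EuclideanSpace ℝ (Fin n))).contDiff.contMDiff.comp hJ
  let q : EuclideanSpace ℝ (Fin n) → EuclideanSpace ℝ (Fin n) → R → ℝ :=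
    fun v w g => c (G.tgt g) * inner ℝ (J g v) (J g w)
  have hq : ∀ m v w, inner ℝ ((∑ᶠ g ∈ G.src ⁻¹' {m}, F g) v) w =
      ∑ᶠ g ∈ G.src ⁻¹' {m}, q v w g := by
    intro m v w
    let L : (EuclideanSpace ℝ (Fin n) →L[ℝ] EuclideanSpace ℝ (Fin n)) →+ ℝ :=
      { toFun := fun a => inner ℝ (a v) w
        map_zero' := by simp
        map_add' := fun a b => by simp [inner_add_left] }
    have h1 := L.map_finsum_mem' (s := G.src ⁻¹' {m}) (f := F)
      ((hfin m).subset fun g hg => ⟨hg.1, hFs hg.2⟩)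
    refine h1.trans (finsum_mem_congr rfl fun g _ => ?_)
    change inner ℝ (c (G.tgt g) • (star (J g) (J g v))) w = _
    rw [inner_smul_left, ContinuousLinearMap.star_eq_adjoint,
      ContinuousLinearMap.adjoint_inner_left]
    rfl
  refine ⟨fun m => ∑ᶠ g ∈ G.src ⁻¹' {m}, F g, ?_, ?_, ?_, ?_⟩
  · exact IsLocalDiffeomorph.contMDiff_finsum_fiber hG.etale hcp hFsm hFs
  · intro m v w
    rw [hq, hq]
    refine finsum_mem_congr rfl fun g _ => ?_
    simp only [q, real_inner_comm]
  · intro m v hv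
    rw [hq]
    have h1 : ∑ᶠ g ∈ G.src ⁻¹' {m}, q v v g = ∑ g ∈ (hfin m).toFinset, q v v g := by
      refine finsum_mem_eq_sum_of_inter_support_eq _ ?_
      ext g
      simp only [Set.mem_inter_iff, Set.Finite.coe_toFinset, Function.mem_support]
      refine ⟨fun h => ⟨⟨h.1, subset_tsupport c fun h0 => h.2 ?_⟩, h.2⟩, fun h => ⟨h.1.1, h.2⟩⟩
      simp only [q, h0, zero_mul]
    rw [h1]
    obtain ⟨g, hg, hgc⟩ := hcpos m
    refine Finset.sum_pos' (fun g _ => mul_nonneg (hc0 _) real_inner_self_nonneg)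
      ⟨g, (hfin m).mem_toFinset.2 ⟨hg, subset_tsupport c hgc.ne'⟩, mul_pos hgc ?_⟩
    -- J(g) is injective since J(g⁻¹) J(g) = 1.
    refine real_inner_self_pos.2 fun h0 => hv ?_
    have h2 := hJc (G.inv g) g (G.src_inv g)
    rw [G.inv_comp, hJu] at h2
    have h3 := DFunLike.congr_fun h2 v
    rw [mul_apply_eq_comp, h0, map_zero] at h3
    exact h3
  · intro k v w
    rw [hq, hq]
    -- Invariance is reindexing: right multiplication by `k` carries the arrows leaving its target
    -- onto those leaving its source, without changing their targets.
    refine finsum_mem_eq_of_bijOn (fun g => G.comp g k) ⟨?_, ?_, ?_⟩ ?_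
    · intro g hg
      exact G.src_comp g k hg
    · intro g hg g' hg' h
      exact G.comp_right_cancel hg hg' h
    · intro g hg
      have hg' : G.src g = G.src k := hg
      have h1 : G.src g = G.tgt (G.inv k) := by rw [G.tgt_inv, hg']
      exact ⟨G.comp g (G.inv k), (G.src_comp _ _ h1).trans (G.src_inv k),
        G.inv_comp_cancel_right hg'⟩
    · intro g hg
      have hg' : G.src g = G.tgt k := hg
      simp only [q]
      rw [G.tgt_comp _ _ hg', hJc _ _ hg']
      rfl

theorem mul_eq_one_symm_of_finiteDimensional {n : ℕ}
    {a b : EuclideanSpace ℝ (Fin n) →L[ℝ] EuclideanSpace ℝ (Fin n)} (h : a * b = 1) :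
    b * a = 1 := by
  have h1 : (a : EuclideanSpace ℝ (Fin n) →ₗ[ℝ] EuclideanSpace ℝ (Fin n)) * b = 1 := by
    ext1 v
    exact DFunLike.congr_fun h v
  have h2 := mul_eq_one_comm.1 h1
  ext1 v
  exact DFunLike.congr_fun h2 v

/-- An orbifold groupoid with global étale coordinates has a smooth orthogonal representation
whose kernel consists of the ineffective arrows. -/
theorem IsOrbifold.exists_orthogonal_hom (hG : G.IsOrbifold) {χ : M → EuclideanSpace ℝ (Fin n)}
    (hχ : IsLocalDiffeomorph (𝓡 n) 𝓘(ℝ, EuclideanSpace ℝ (Fin n)) ∞ χ) :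
    ∃ ρ : R → unitary (EuclideanSpace ℝ (Fin n) →L[ℝ] EuclideanSpace ℝ (Fin n)),
      ContMDiff (𝓡 n) 𝓘(ℝ, EuclideanSpace ℝ (Fin n) →L[ℝ] EuclideanSpace ℝ (Fin n)) ∞
        (fun g => (ρ g : EuclideanSpace ℝ (Fin n) →L[ℝ] EuclideanSpace ℝ (Fin n))) ∧
      (∀ g h, G.src g = G.tgt h → ρ (G.comp g h) = ρ g * ρ h) ∧
      (∀ g, G.IsIneffective g → ρ g = 1) ∧
      ∀ g, G.src g = G.tgt g → ρ g = 1 → G.IsIneffective g := by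
  obtain ⟨J, hJ, hJc, hJi, hJi'⟩ := hG.exists_jacobian hχ
  obtain ⟨h, hh, hsym, hpos, hinv⟩ := hG.exists_invariant_metric hJ hJc
    fun m => hJi _ (1 : G.IneffStab m).2
  obtain ⟨b, hb, hbo⟩ := exists_contMDiff_orthonormal_frame hh hsym hpos
  -- Orthonormality of the frame reads b* h b = 1, so `b* h` is a left inverse of `b`, visibly
  -- smooth, and two-sided in finite dimension.
  let B : M → EuclideanSpace ℝ (Fin n) →L[ℝ] EuclideanSpace ℝ (Fin n) :=
    fun m => star (b m) * h m
  have hB : ContMDiff (𝓡 n) 𝓘(ℝ, EuclideanSpace ℝ (Fin n) →L[ℝ] EuclideanSpace ℝ (Fin n)) ∞ B :=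
    ContMDiff.clm_comp ((starL' ℝ : (EuclideanSpace ℝ (Fin n) →L[ℝ] EuclideanSpace ℝ (Fin n)) ≃L[ℝ]
      (EuclideanSpace ℝ (Fin n) →L[ℝ] EuclideanSpace ℝ (Fin n))).contDiff.contMDiff.comp hb) hh
  have hBb : ∀ m, B m * b m = 1 := by
    intro m
    ext1 v
    refine ext_inner_right ℝ fun w => ?_
    change inner ℝ (star (b m) (h m (b m v))) w = inner ℝ v w
    rw [ContinuousLinearMap.star_eq_adjoint, ContinuousLinearMap.adjoint_inner_left, hbo]
  have hbB : ∀ m, b m * B m = 1 := fun m => mul_eq_one_symm_of_finiteDimensional (hBb m)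
  -- The cocycle J written in the orthonormal frames; invariance of the metric makes it orthogonal.
  let r : R → EuclideanSpace ℝ (Fin n) →L[ℝ] EuclideanSpace ℝ (Fin n) :=
    fun g => B (G.tgt g) * J g * b (G.src g)
  have hbr : ∀ g, b (G.tgt g) * r g = J g * b (G.src g) := by
    intro g
    simp only [r]
    rw [← mul_assoc, ← mul_assoc, hbB, one_mul]
  have hr : ∀ g, star (r g) * r g = 1 := by
    intro g
    ext1 v
    refine ext_inner_right ℝ fun w => ?_
    change inner ℝ (star (r g) (r g v)) w = inner ℝ v w
    have e : ∀ v, b (G.tgt g) (r g v) = J g (b (G.src g) v) := DFunLike.congr_fun (hbr g)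
    rw [ContinuousLinearMap.star_eq_adjoint, ContinuousLinearMap.adjoint_inner_left,
      ← hbo (G.tgt g), e, e, hinv, hbo]
  refine ⟨fun g => ⟨r g, Unitary.mem_iff.2
    ⟨hr g, mul_eq_one_symm_of_finiteDimensional (hr g)⟩⟩, ?_, ?_, ?_, ?_⟩
  · exact ((hB.comp G.tgt_smooth).clm_comp hJ).clm_comp (hb.comp G.src_submersion.smooth)
  · intro g k hgk
    refine Subtype.ext ?_
    change r (G.comp g k) = r g * r k
    have e : r g * r k = B (G.tgt g) * J g * (b (G.tgt k) * r k) := by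
      simp only [r, hgk, mul_assoc]
    rw [e, hbr]
    simp only [r]
    rw [G.tgt_comp _ _ hgk, G.src_comp _ _ hgk, hJc _ _ hgk]
    simp only [mul_assoc]
  · intro g hg
    refine Subtype.ext ?_
    change B (G.tgt g) * J g * b (G.src g) = 1
    rw [hJi g hg, mul_one, hg.tgt_eq, hBb]
  · intro g hg h1
    refine hJi' g hg ?_
    have h2 : r g = 1 := Subtype.ext_iff.1 h1
    have h3 := hbr g
    rw [h2, mul_one, ← hg] at h3
    calc J g = J g * b (G.src g) * B (G.src g) := by rw [mul_assoc, hbB, mul_one]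
      _ = 1 := by rw [← h3, hbB]

end Metric

end SmoothGroupoid

namespace SmoothGroupoid

/-! ### The conjugation representation on the ineffective stabilizers -/

section Conjugation

variable {n : ℕ} {M R : Type*}
  [TopologicalSpace M] [ChartedSpace (EuclideanSpace ℝ (Fin n)) M]
  [TopologicalSpace R] [ChartedSpace (EuclideanSpace ℝ (Fin n)) R]
  {G : SmoothGroupoid (𝓡 n) (𝓡 n) M R} {T : Type*} [Group T] {θ : M → T → R}

/-- In a global trivialization of the ineffective stabilizers, conjugation by arrows is a locally
constant homomorphism to the automorphism group of the fibre. -/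
theorem IneffTrivOn.exists_conj_hom [Finite T] (hG : G.IsEtale)
    (hθ : G.IneffTrivOn T Set.univ θ) :
    ∃ φ : R → MulAut T,
      (∀ g z, G.comp g (θ (G.src g) z) = G.comp (θ (G.tgt g) (φ g z)) g) ∧
      (∀ g h, G.src g = G.tgt h → φ (G.comp g h) = φ g * φ h) ∧
      ∀ g, ∀ᶠ g' in 𝓝 g, φ g' = φ g := by
  have hsrc : ∀ m z, G.src (θ m z) = m := fun m => hθ.src m trivial
  have htgt : ∀ m z, G.tgt (θ m z) = m := fun m => hθ.tgt trivial
  have hmul : ∀ m z w, θ m (z * w) = G.comp (θ m z) (θ m w) := fun m => hθ.map_mul m trivial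
  have hinj : ∀ {m z w}, θ m z = θ m w → z = w := fun {m} _ _ h => hθ.injective m trivial h
  have hgs : ∀ g z, G.src g = G.tgt (θ (G.src g) z) := fun g z => (htgt _ _).symm
  have hst : ∀ g z, G.src (θ (G.tgt g) z) = G.tgt g := fun g z => hsrc _ _
  have hcan : ∀ g {z w}, G.comp (θ (G.tgt g) z) g = G.comp (θ (G.tgt g) w) g → z = w :=
    fun g z w h => hinj (G.comp_right_cancel (hst g z) (hst g w) h)
  have hex : ∀ g z, ∃ w, G.comp g (θ (G.src g) z) = G.comp (θ (G.tgt g) w) g := by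
    intro g z
    have h1 := hG.isIneffective_conj (k := g) (hθ.ineffective (G.src g) trivial z)
      (hsrc _ _).symm
    have h2 : G.src (G.comp g (θ (G.src g) z)) = G.src g := by rw [G.src_comp _ _ (hgs g z), hsrc]
    obtain ⟨w, hw⟩ := hθ.surjective _ trivial h1
    rw [G.src_comp _ _ (by rw [h2, G.tgt_inv]), G.src_inv] at hw
    exact ⟨w, by rw [hw, G.inv_comp_cancel_right h2]⟩
  choose φ hφ using hex
  have hφm : ∀ g z w, φ g (z * w) = φ g z * φ g w := by
    intro g z w
    refine hcan g ?_
    rw [← hφ, hmul, hmul, G.assoc _ _ _ (hgs g z) (by rw [hsrc, htgt]), hφ,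
      ← G.assoc _ _ _ (hst g _) (hgs g w), hφ, G.assoc _ _ _ (by rw [hsrc, htgt]) (hst g _)]
  have hφi : ∀ g, Function.Injective (φ g) := by
    intro g z w h
    refine hinj (m := G.src g) ?_
    rw [← G.inv_comp_cancel_left (hgs g z), hφ, h, ← hφ, G.inv_comp_cancel_left (hgs g w)]
  let ψ : R → MulAut T := fun g =>
    MulEquiv.ofBijective (MonoidHom.mk' (φ g) (hφm g)) (Finite.injective_iff_bijective.1 (hφi g))
  refine ⟨ψ, hφ, ?_, ?_⟩
  · intro g h hgh
    refine MulEquiv.ext fun z => ?_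
    change φ (G.comp g h) z = φ g (φ h z)
    refine hcan (G.comp g h) ?_
    have e1 : G.comp g (θ (G.tgt h) (φ h z)) = G.comp (θ (G.tgt g) (φ g (φ h z))) g := by
      rw [← hgh]
      exact hφ g _
    rw [← hφ, G.src_comp _ _ hgh, G.tgt_comp _ _ hgh, ← G.assoc _ _ _ hgh (hgs h z), hφ h,
      G.assoc _ _ _ (by rw [htgt, hgh]) (hst h _), e1, G.assoc _ _ _ (hst g _) hgh]
  -- With the value `φ g z` frozen, the two sides of the defining equation for nearby arrows have
  -- the same source and agree at `g`. They agree near `g` by unique lifting, and finiteness of T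
  -- makes this uniform in z.
  · intro g
    have h1 : ∀ z, ∀ᶠ g' in 𝓝 g, φ g' z = φ g z := by
      intro z
      have hc : ∀ z, Continuous fun m => θ m z := fun z =>
        continuousOn_univ.1 (hθ.continuousOn z)
      have c1 : Filter.Tendsto (fun g' => G.comp g' (θ (G.src g') z)) (𝓝 g)
          (𝓝 (G.comp g (θ (G.src g) z))) :=
        G.tendsto_comp Filter.tendsto_id (((hc z).comp G.continuous_src).tendsto g) (hgs g z)
          (Filter.Eventually.of_forall fun g' => hgs g' z)
      have c2 : Filter.Tendsto (fun g' => G.comp (θ (G.tgt g') (φ g z)) g') (𝓝 g)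
          (𝓝 (G.comp g (θ (G.src g) z))) := by
        rw [hφ]
        exact G.tendsto_comp (((hc _).comp G.continuous_tgt).tendsto g) Filter.tendsto_id
          (hst g _) (Filter.Eventually.of_forall fun g' => hst g' _)
      have h2 := hG.isLocalHomeomorph_src.eventually_unique_lift c1 c2
        (Filter.Eventually.of_forall fun g' => by
          rw [G.src_comp _ _ (hgs g' z), G.src_comp _ _ (hst g' _), hsrc])
      filter_upwards [h2] with g' hg'
      rw [hφ] at hg'
      exact hcan g' hg'
    filter_upwards [Filter.eventually_all.2 h1] with g' hg'
    exact MulEquiv.ext hg'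

end Conjugation

/-- If all stabilizer arrows are ineffective and the band is trivialized by `A`, then all
stabilizers are isomorphic to `A`. -/
theorem BandTrivialization.nonempty_stab_mulEquiv {E₀ : Type*} [NormedAddCommGroup E₀]
    [NormedSpace ℝ E₀] {B₀ : Type*} [TopologicalSpace B₀] {E₁ : Type*} [NormedAddCommGroup E₁]
    [NormedSpace ℝ E₁] {B₁ : Type*} [TopologicalSpace B₁] {I₀ : ModelWithCorners ℝ E₀ B₀}
    {I₁ : ModelWithCorners ℝ E₁ B₁} {G₀ G₁ : Type*} [TopologicalSpace G₀] [ChartedSpace B₀ G₀]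
    [TopologicalSpace G₁] [ChartedSpace B₁ G₁] {G : SmoothGroupoid I₀ I₁ G₀ G₁} {A : Type*}
    [CommGroup A] (c : G.BandTrivialization A) (hp : G.IsPurelyIneffective) (y : G₀) :
    Nonempty (G.Stab y ≃* A) := by
  let f : A → G.Stab y := fun a => ⟨c.toFun y a, c.src_toFun y a, c.tgt_toFun y a⟩
  have hf : Function.Bijective f := by
    constructor
    · intro a b hab
      have h1 : c.toFun y a = c.toFun y b := Subtype.ext_iff.1 hab
      obtain ⟨z, -, hz⟩ := c.bijective _ (c.ineffective y b)
      rw [c.src_toFun] at hz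
      exact (hz a h1).trans (hz b rfl).symm
    · rintro ⟨g, rfl, h⟩
      obtain ⟨a, ha, -⟩ := c.bijective g (hp g h.symm)
      exact ⟨a, Subtype.ext ha⟩
  exact ⟨(MulEquiv.mk (Equiv.ofBijective f hf) fun a b => Subtype.ext (c.map_mul y a b)).symm⟩

/-! ### Pure ineffectivity and triviality of the band -/

section Band

variable {n k d : ℕ} {M R K : Type*}
    [TopologicalSpace M] [ChartedSpace (EuclideanSpace ℝ (Fin n)) M]
    [TopologicalSpace R] [ChartedSpace (EuclideanSpace ℝ (Fin n)) R]
    [Group K] [TopologicalSpace K] [ChartedSpace (EuclideanSpace ℝ (Fin k)) K]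
    [LieGroup (𝓡 k) ∞ K]
    [ChartedSpace (EuclideanSpace ℝ (Fin d)) (M × K)]
    [ChartedSpace (EuclideanSpace ℝ (Fin d)) (R × K)]
    {G : SmoothGroupoid (𝓡 n) (𝓡 n) M R} {ρ : R → K}
    (hG : G.IsEtale) (hρ : G.IsSmoothHom (𝓡 k) ρ)
    (hM : IsLocalDiffeomorph (𝓡 d) ((𝓡 n).prod (𝓡 k)) ∞ (id : M × K → M × K))
    (hR : IsLocalDiffeomorph (𝓡 d) ((𝓡 n).prod (𝓡 k)) ∞ (id : R × K → R × K))

/-- A stabilizer arrow (g, a) satisfies ρ(g) a = a. Left translation in `K` is free, so it lies over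
a stabilizer arrow in the kernel of `ρ`. -/
theorem isPurelyIneffective_actionGroupoid
    (hker : ∀ g, G.src g = G.tgt g → ρ g = 1 → G.IsIneffective g ∧ ∀ᶠ g' in 𝓝 g, ρ g' = 1) :
    (actionGroupoid hG hρ hM hR).IsPurelyIneffective := by
  rintro ⟨g, a⟩ h
  obtain ⟨h1, h2⟩ : G.src g = G.tgt g ∧ a = ρ g * a := Prod.ext_iff.1 h
  obtain ⟨h3, h4⟩ := hker g h1 (right_eq_mul.1 h2)
  exact isIneffective_actionGroupoid hG hρ hM hR h3 h4

-- The stabilizer at (m, a) is identified with Z(T) after twisting by ψ(a). Conjugation by (g, a)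
-- replaces ψ(a) by ψ(ρ(g)) ψ(a) = ψ(ρ(g) a), exactly the twist at the target; without the twist the
-- conjugation action would remain. Local constancy of `ψ` makes the family continuous.
open scoped IsMulCommutative in
theorem hasTrivialBand_actionGroupoid
    (hker : ∀ g, G.src g = G.tgt g → ρ g = 1 → G.IsIneffective g ∧ ∀ᶠ g' in 𝓝 g, ρ g' = 1)
    {T : Type*} [Group T] {θ : M → T → R} (hθ : G.IneffTrivOn T Set.univ θ) (ψ : K →* MulAut T)
    (hψ : ∀ a, ∀ᶠ a' in 𝓝 a, ψ a' = ψ a)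
    (hconj : ∀ g z, G.comp g (θ (G.src g) z) = G.comp (θ (G.tgt g) (ψ (ρ g) z)) g)
    (hcen : ∀ m, ∀ z ∈ Subgroup.center T, ρ (θ m z) = 1) :
    (actionGroupoid hG hρ hM hR).HasTrivialBand (Subgroup.center T) := by
  set H := actionGroupoid hG hρ hM hR with hH
  have hHe : H.IsEtale := isEtale_actionGroupoid hG hρ hM hR
  have hpure : H.IsPurelyIneffective := isPurelyIneffective_actionGroupoid hG hρ hM hR hker
  have hsrc : ∀ m z, G.src (θ m z) = m := fun m => hθ.src m trivial
  have htgt : ∀ m z, G.tgt (θ m z) = m := fun m => hθ.tgt trivial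
  have hmul : ∀ m z w, θ m (z * w) = G.comp (θ m z) (θ m w) := fun m => hθ.map_mul m trivial
  have hinj : ∀ {m z w}, θ m z = θ m w → z = w := fun {m} _ _ h => hθ.injective m trivial h
  have hmap : ∀ (a : K) (z : Subgroup.center T), ψ a z ∈ Subgroup.center T := by
    intro a z
    rw [Subgroup.mem_center_iff]
    intro w
    have h1 := Subgroup.mem_center_iff.1 z.2 ((ψ a).symm w)
    have h2 := congrArg (ψ a) h1
    simpa using h2
  have hone : ∀ m (a : K) (z : Subgroup.center T), ρ (θ m (ψ a z)) = 1 := fun m a z =>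
    hcen m _ (hmap a z)
  -- By `hconj`, an element of T with trivial image acts trivially by conjugation.
  have hcen' : ∀ m z, ρ (θ m z) = 1 → z ∈ Subgroup.center T := by
    intro m z h1
    rw [Subgroup.mem_center_iff]
    intro w
    have h2 := hconj (θ m z) w
    rw [h1, hsrc, htgt, map_one, ← hmul] at h2
    exact (hinj (h2.trans (hmul m _ _).symm)).symm
  let F : M × K → Subgroup.center T → R × K := fun x z => (θ x.1 (ψ x.2 z), x.2)
  have Fs : ∀ x z, H.src (F x z) = x := fun x z => Prod.ext (hsrc _ _) rfl
  have Ft : ∀ x z, H.tgt (F x z) = x := fun x z => Prod.ext (htgt _ _) (by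
    change ρ (θ x.1 (ψ x.2 z)) * x.2 = x.2
    rw [hone, one_mul])
  have Fc : ∀ z, Continuous fun x => F x z := by
    intro z
    refine Continuous.prodMk (continuous_iff_continuousAt.2 ?_) continuous_snd
    rintro ⟨m, a⟩
    have h1 : ContinuousAt (fun x : M × K => θ x.1 (ψ a z)) (m, a) :=
      ((continuousOn_univ.1 (hθ.continuousOn (ψ a z))).comp continuous_fst).continuousAt
    refine h1.congr ?_
    have h2 : ∀ᶠ x : M × K in 𝓝 (m, a), ψ x.2 = ψ a :=
      (continuous_snd.tendsto (m, a)).eventually (hψ a)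
    filter_upwards [h2] with x hx
    rw [hx]
  refine ⟨{ toFun := F, src_toFun := Fs, tgt_toFun := Ft, ineffective := ?_, map_mul := ?_,
            bijective := ?_, smooth := ?_, inverse_smooth := ?_, equivariant := ?_ }⟩
  · exact fun x z => hpure _ ((Fs x z).trans (Ft x z).symm)
  · intro x z w
    refine Prod.ext ?_ rfl
    change θ x.1 (ψ x.2 (z * w)) = G.comp (θ x.1 (ψ x.2 z)) (θ x.1 (ψ x.2 w))
    rw [_root_.map_mul, hmul]
  · rintro ⟨g, a⟩ hg
    have h0 : (G.tgt g, ρ g * a) = (G.src g, a) := hg.tgt_eq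
    obtain ⟨h1, h2⟩ : G.tgt g = G.src g ∧ ρ g * a = a := Prod.ext_iff.1 h0
    have h3 : ρ g = 1 := mul_eq_right.1 h2
    obtain ⟨w, hw⟩ := hθ.surjective g trivial (hker g h1.symm h3).1
    have hwc : w ∈ Subgroup.center T := hcen' (G.src g) w (by rw [hw, h3])
    have hz : (ψ a).symm w ∈ Subgroup.center T := by
      have := hmap a⁻¹ ⟨w, hwc⟩
      rw [map_inv] at this
      exact this
    refine ⟨⟨(ψ a).symm w, hz⟩, ?_, ?_⟩
    · refine Prod.ext ?_ rfl
      change θ (G.src g) (ψ a ((ψ a).symm w)) = g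
      rw [MulEquiv.apply_symm_apply, hw]
    · intro z hz'
      have h4 : θ (G.src g) (ψ a z) = g := (Prod.ext_iff.1 hz').1
      refine Subtype.ext ?_
      change (z : T) = (ψ a).symm w
      rw [hinj (hw.trans h4.symm), MulEquiv.symm_apply_apply]
  · intro z
    refine IsLocalDiffeomorph.contMDiff_of_comp hHe (Fc z) ?_
    have : H.src ∘ (fun x => F x z) = id := funext fun x => Fs x z
    rw [this]
    exact contMDiff_id
  · intro x z
    have h1 := hHe.isLocalHomeomorph_src.eventually_section_apply (x := F x z)
      (σ := fun x => F x z) (by rw [Fs]) (Fc z).continuousAt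
      (Filter.Eventually.of_forall fun y => Fs y z)
    filter_upwards [h1] with g hg _ using hg
  · rintro ⟨g, a⟩ z
    refine Prod.ext ?_ rfl
    change G.comp (G.comp g (θ (G.src g) (ψ a z))) (G.inv g) = θ (G.tgt g) (ψ (ρ g * a) z)
    rw [hconj, G.comp_inv_cancel_right (hsrc _ _), map_mul]
    rfl

end Band

end SmoothGroupoid

/-! ### The trivializing étale cover -/

theorem IsLocalDiffeomorphAt.congr_of_eventuallyEq {E : Type*} [NormedAddCommGroup E]
    [NormedSpace ℝ E] {B : Type*} [TopologicalSpace B] {I : ModelWithCorners ℝ E B} {N : Type*}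
    [TopologicalSpace N] [ChartedSpace B N] {E' : Type*} [NormedAddCommGroup E'] [NormedSpace ℝ E']
    {B' : Type*} [TopologicalSpace B'] {I' : ModelWithCorners ℝ E' B'} {X : Type*}
    [TopologicalSpace X] [ChartedSpace B' X] {f f' : X → N} {x : X}
    (h : IsLocalDiffeomorphAt I' I ∞ f x) (hf : f' =ᶠ[𝓝 x] f) :
    IsLocalDiffeomorphAt I' I ∞ f' x := by
  obtain ⟨Φ, hx, hΦ⟩ := h
  obtain ⟨S, hS, hSo, hxS⟩ := eventually_nhds_iff.1 hf
  refine .of_openPartialHomeomorph (Φ.toOpenPartialHomeomorph.restrOpen S hSo) ⟨hx, hxS⟩ ?_ ?_ ?_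
  · intro y hy
    exact (hS y hy.2).trans (hΦ hy.1)
  · exact Φ.contMDiffOn_toFun.mono fun y hy => hy.1
  · exact Φ.contMDiffOn_invFun.mono fun y hy => hy.1

theorem IsLocalHomeomorph.exists_isSmoothMfd {n : ℕ} {N X : Type*} [TopologicalSpace N]
    [ChartedSpace (EuclideanSpace ℝ (Fin n)) N] [IsSmoothMfd n N] [TopologicalSpace X] [T2Space X]
    [SecondCountableTopology X] {p : X → N} (hp : IsLocalHomeomorph p) :
    ∃ _ : ChartedSpace (EuclideanSpace ℝ (Fin n)) X, IsSmoothMfd n X ∧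
      IsLocalDiffeomorph (𝓡 n) (𝓡 n) ∞ p := by
  obtain ⟨cs, hm, hl⟩ := IsLocalHomeomorph.exists_chartedSpace (I := 𝓡 n)
    (Homeomorph.refl (EuclideanSpace ℝ (Fin n))) contMDiff_id contMDiff_id hp
  exact ⟨cs, { toIsManifold := hm }, hl⟩

theorem exists_isSmoothMfd_prod {n k : ℕ} (X K : Type*) [TopologicalSpace X]
    [ChartedSpace (EuclideanSpace ℝ (Fin n)) X] [IsSmoothMfd n X] [TopologicalSpace K]
    [ChartedSpace (EuclideanSpace ℝ (Fin k)) K] [IsManifold (𝓡 k) ∞ K] [T2Space K]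
    [SecondCountableTopology K] :
    ∃ _ : ChartedSpace (EuclideanSpace ℝ (Fin (n + k))) (X × K), IsSmoothMfd (n + k) (X × K) ∧
      IsLocalDiffeomorph (𝓡 (n + k)) ((𝓡 n).prod (𝓡 k)) ∞ (id : X × K → X × K) := by
  obtain ⟨e, he, he'⟩ := exists_homeomorph_euclideanSpace_prod n k
  obtain ⟨cs, hm, hl⟩ := IsLocalHomeomorph.exists_chartedSpace (X := X × K)
    (I := (𝓡 n).prod (𝓡 k)) e he he' (Homeomorph.refl (X × K)).isLocalHomeomorph
  exact ⟨cs, { toIsManifold := hm }, hl⟩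

namespace SmoothGroupoid

section Cover

variable {n : ℕ} {G₀ G₁ : Type u}
    [TopologicalSpace G₀] [ChartedSpace (EuclideanSpace ℝ (Fin n)) G₀] [IsSmoothMfd n G₀]
    [TopologicalSpace G₁] [ChartedSpace (EuclideanSpace ℝ (Fin n)) G₁] [IsSmoothMfd n G₁]
    {G : SmoothGroupoid (𝓡 n) (𝓡 n) G₀ G₁}

/-- An étale cover of the objects with global étale coordinates, over which the ineffective
stabilizers are globally trivial. -/
theorem IsOrbifold.exists_cover (hG : G.IsOrbifold) (hconn : ConnectedSpace G.Coarse) (x : G₀) :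
    ∃ (M : Type u) (_ : TopologicalSpace M) (_ : ChartedSpace (EuclideanSpace ℝ (Fin n)) M)
      (_ : IsSmoothMfd n M) (π : M → G₀) (χ : M → EuclideanSpace ℝ (Fin n))
      (θ : M → G.IneffStab x → G₁),
      IsLocalDiffeomorph (𝓡 n) (𝓡 n) ∞ π ∧ Function.Surjective π ∧
      IsLocalDiffeomorph (𝓡 n) (𝓡 n) ∞ χ ∧ (∀ z, Continuous fun m => θ m z) ∧
      ∀ m, ∃ (V : Set G₀) (θ' : G₀ → G.IneffStab x → G₁), π m ∈ V ∧
        G.IneffTrivOn (G.IneffStab x) V θ' ∧ θ m = θ' (π m) := by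
  have hex : ∀ y : G₀, ∃ (V : Set G₀) (θ : G₀ → G.IneffStab x → G₁), IsOpen V ∧ y ∈ V ∧
      V ⊆ (chartAt (EuclideanSpace ℝ (Fin n)) y).source ∧
      G.IneffTrivOn (G.IneffStab x) V θ := by
    intro y
    obtain ⟨V, θ, hV, hyV, hθ⟩ := hG.exists_ineffTrivOn y
    obtain ⟨e⟩ := hG.nonempty_ineffStab_mulEquiv hconn x y
    have h1 := hθ.precomp e
    refine ⟨V ∩ (chartAt (EuclideanSpace ℝ (Fin n)) y).source, fun y z => θ y (e z),
      hV.inter (chartAt _ y).open_source, ⟨hyV, mem_chart_source _ y⟩, Set.inter_subset_right, ?_⟩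
    exact
      { src := fun y hy => h1.src y hy.1
        ineffective := fun y hy => h1.ineffective y hy.1
        map_mul := fun y hy => h1.map_mul y hy.1
        injective := fun y hy => h1.injective y hy.1
        surjective := fun g hg => h1.surjective g hg.1
        continuousOn := fun z => (h1.continuousOn z).mono Set.inter_subset_left }
  choose V θ hVo hyV hVc hθ using hex
  -- Countability of the cover keeps the disjoint union second countable. On disjoint pieces the
  -- local charts and trivializations need no compatibility, so they combine into global ones.
  obtain ⟨s, hs, hcov⟩ := TopologicalSpace.countable_cover_nhds
    (fun y => (hVo y).mem_nhds (hyV y))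
  have := hs.to_subtype
  let M : Type u := Σ i : s, V i
  let π : M → G₀ := fun m => m.2.1
  have hπ : IsLocalHomeomorph π := by
    refine IsLocalHomeomorph.mk _ ?_
    rintro ⟨i, y⟩
    have h1 : Topology.IsOpenEmbedding (fun y : V i => (⟨i, y⟩ : M)) :=
      .sigmaMk (σ := fun i : s => V i)
    have h2 : Topology.IsOpenEmbedding (Subtype.val : V i → G₀) :=
      (hVo i).isOpenEmbedding_subtypeVal
    have : Nonempty (V i) := ⟨y⟩
    refine ⟨(h1.toOpenPartialHomeomorph _).symm.trans (h2.toOpenPartialHomeomorph _), ?_, ?_⟩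
    · simp
    · intro m hm
      simp only [OpenPartialHomeomorph.trans_source] at hm
      obtain ⟨y', rfl⟩ : m ∈ Set.range (fun y : V i => (⟨i, y⟩ : M)) := by simpa using hm.1
      have h3 := (h1.toOpenPartialHomeomorph _).left_inv (x := y') (by simp)
      simp only [Topology.IsOpenEmbedding.toOpenPartialHomeomorph_apply] at h3
      simp only [OpenPartialHomeomorph.coe_trans, Function.comp, h3]
      rfl
  obtain ⟨cs, hM, hπd⟩ := hπ.exists_isSmoothMfd (n := n)
  refine ⟨M, inferInstance, cs, hM, π,
    fun m => chartAt (EuclideanSpace ℝ (Fin n)) (m.1 : G₀) (π m), fun m => θ m.1 (π m),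
    hπd, ?_, ?_, ?_, ?_⟩
  · intro y
    have hy : y ∈ ⋃ i ∈ s, V i := by
      rw [hcov]
      trivial
    obtain ⟨i, hi, hy⟩ := Set.mem_iUnion₂.1 hy
    exact ⟨⟨⟨i, hi⟩, ⟨y, hy⟩⟩, rfl⟩
  · rintro ⟨i, y⟩
    have h1 : IsLocalDiffeomorphAt (𝓡 n) (𝓡 n) ∞
        (chartAt (EuclideanSpace ℝ (Fin n)) (i : G₀) ∘ π) ⟨i, y⟩ :=
      (hπd ⟨i, y⟩).comp _ _ (isLocalDiffeomorphAt_chartAt (hVc i y.2))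
    have h2 : IsOpen (Set.range (fun y : V i => (⟨i, y⟩ : M))) :=
      isOpen_range_sigmaMk (σ := fun i : s => V i)
    refine h1.congr_of_eventuallyEq ?_
    filter_upwards [h2.mem_nhds ⟨y, rfl⟩] with m hm
    obtain ⟨y', rfl⟩ := hm
    rfl
  · intro z
    refine continuous_sigma fun i => ?_
    exact continuousOn_iff_continuous_domRestrict.1 ((hθ i).continuousOn z)
  · intro m
    exact ⟨V m.1, θ m.1, m.2.2, hθ m.1, rfl⟩

end Cover

/-! ### The homomorphism to O(n) × Aut(T) -/

section LinearHolonomy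

variable {n : ℕ} {M R : Type*}
  [TopologicalSpace M] [ChartedSpace (EuclideanSpace ℝ (Fin n)) M] [IsSmoothMfd n M]
  [TopologicalSpace R] [ChartedSpace (EuclideanSpace ℝ (Fin n)) R] [T2Space R]
  {G : SmoothGroupoid (𝓡 n) (𝓡 n) M R} {T : Type*} [Group T] [Finite T]

/-- The orthogonal representation on tangent spaces together with the action on the ineffective
stabilizers, as a homomorphism to a compact Lie group. -/
theorem IsOrbifold.exists_hom_compact_lieGroup (hG : G.IsOrbifold)
    {χ : M → EuclideanSpace ℝ (Fin n)} (hχ : IsLocalDiffeomorph (𝓡 n) (𝓡 n) ∞ χ)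
    {θ : M → T → R} (hθ : G.IneffTrivOn T Set.univ θ) :
    ∃ (k : ℕ) (K : Type) (_ : Group K) (_ : TopologicalSpace K)
      (_ : ChartedSpace (EuclideanSpace ℝ (Fin k)) K) (_ : LieGroup (𝓡 k) ∞ K) (_ : T2Space K)
      (_ : CompactSpace K) (_ : SecondCountableTopology K) (ρ : R → K) (ψ : K →* MulAut T),
      G.IsSmoothHom (𝓡 k) ρ ∧
      (∀ g, G.src g = G.tgt g → ρ g = 1 → G.IsIneffective g ∧ ∀ᶠ g' in 𝓝 g, ρ g' = 1) ∧
      (∀ a, ∀ᶠ a' in 𝓝 a, ψ a' = ψ a) ∧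
      (∀ g z, G.comp g (θ (G.src g) z) = G.comp (θ (G.tgt g) (ψ (ρ g) z)) g) ∧
      ∀ m, ∀ z ∈ Subgroup.center T, ρ (θ m z) = 1 := by
  obtain ⟨ρ₁, h1s, h1m, h1i, h1k⟩ := hG.exists_orthogonal_hom hχ
  obtain ⟨φ, hφ, hφm, hφl⟩ := hθ.exists_conj_hom hG.etale
  have : Finite (MulAut T) := Finite.of_injective (fun e : MulAut T => (e : T → T))
    DFunLike.coe_injective
  -- A small copy of the finite group Aut(T), so that `K` lives in the lowest universe; it is given
  -- the discrete topology.
  let F : Type := Shrink.{0} (MulAut T)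
  have : Finite F := Finite.of_equiv _ (equivShrink.{0} (MulAut T))
  let e : F ≃* MulAut T := Shrink.mulEquiv
  let : TopologicalSpace F := ⊥
  have : DiscreteTopology F := ⟨rfl⟩
  obtain ⟨k, cs₁, cs, hL, hc, hfst, hr⟩ := exists_lieGroup_unitary_prod
    (A := EuclideanSpace ℝ (Fin n) →L[ℝ] EuclideanSpace ℝ (Fin n)) F
  have : SigmaCompactSpace
      (unitary (EuclideanSpace ℝ (Fin n) →L[ℝ] EuclideanSpace ℝ (Fin n)) × F) :=
    @CompactSpace.sigmaCompact _ _ hc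
  have : SecondCountableTopology
      (unitary (EuclideanSpace ℝ (Fin n) →L[ℝ] EuclideanSpace ℝ (Fin n)) × F) :=
    ChartedSpace.secondCountable_of_sigmaCompact (EuclideanSpace ℝ (Fin k)) _
  have hρ₁ : ContMDiff (𝓡 n) (𝓡 k) ∞ ρ₁ := contMDiffAt_unitary_of_coe hr h1s
  have hφc : Continuous fun g => e.symm (φ g) := by
    refine continuous_iff_continuousAt.2 fun g => ?_
    refine continuousAt_const.congr (f := fun _ => e.symm (φ g)) ?_
    filter_upwards [hφl g] with g' hg'
    rw [hg']
  refine ⟨k, unitary (EuclideanSpace ℝ (Fin n) →L[ℝ] EuclideanSpace ℝ (Fin n)) × F, inferInstance,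
    inferInstance, cs, hL, inferInstance, hc, inferInstance, fun g => (ρ₁ g, e.symm (φ g)),
    (e : F →* MulAut T).comp (MonoidHom.snd _ _), ⟨?_, ?_⟩, ?_, ?_, ?_, ?_⟩
  · exact hfst.contMDiff_of_comp (hρ₁.continuous.prodMk hφc) hρ₁
  · intro g h hgh
    exact Prod.ext (h1m g h hgh) (by rw [hφm g h hgh, map_mul]; rfl)
  · intro g hg h
    obtain ⟨e1, e2⟩ : ρ₁ g = 1 ∧ e.symm (φ g) = 1 := Prod.ext_iff.1 h
    -- Triviality of the orthogonal part already gives ineffectivity. This persists nearby, where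
    -- the orthogonal part is then trivial, while the Aut(T)-part is locally constant.
    have hi := h1k g hg e1
    refine ⟨hi, ?_⟩
    filter_upwards [hφl g, hG.etale.isOpen_setOf_isIneffective.mem_nhds hi] with g' h2 h3
    exact Prod.ext (h1i g' h3) (by rw [h2, e2]; rfl)
  · rintro ⟨v, f⟩
    have : ∀ᶠ a' : unitary (EuclideanSpace ℝ (Fin n) →L[ℝ] EuclideanSpace ℝ (Fin n)) × F in
        𝓝 (v, f), a'.2 = f :=
      (continuous_snd.tendsto (v, f)).eventually
        ((isOpen_discrete {f}).eventually_mem rfl)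
    filter_upwards [this] with a' ha'
    exact congrArg e ha'
  · intro g z
    rw [hφ]
    change _ = G.comp (θ (G.tgt g) (e (e.symm (φ g)) z)) g
    rw [MulEquiv.apply_symm_apply]
  · intro m z hz
    refine Prod.ext (h1i _ (hθ.ineffective m trivial z)) ?_
    change e.symm (φ (θ m z)) = 1
    rw [MulEquiv.map_eq_one_iff]
    refine MulEquiv.ext fun w => ?_
    have h2 := hφ (θ m z) w
    rw [hθ.src m trivial, hθ.tgt trivial, ← hθ.map_mul m trivial, ← hθ.map_mul m trivial] at h2
    have h3 := hθ.injective m trivial h2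
    rw [← Subgroup.mem_center_iff.1 hz w] at h3
    exact (mul_right_cancel h3).symm

end LinearHolonomy

/-! ### Trivializations over the pulled back groupoid -/

section Pull

variable {n : ℕ} {G₀ G₁ M : Type*}
    [TopologicalSpace G₀] [ChartedSpace (EuclideanSpace ℝ (Fin n)) G₀]
    [TopologicalSpace G₁] [ChartedSpace (EuclideanSpace ℝ (Fin n)) G₁]
    [TopologicalSpace M] [ChartedSpace (EuclideanSpace ℝ (Fin n)) M]
    {G : SmoothGroupoid (𝓡 n) (𝓡 n) G₀ G₁} {π : M → G₀}
    [ChartedSpace (EuclideanSpace ℝ (Fin n)) (G.PullArrow π)] (hG : G.IsEtale)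
    (hπ : IsLocalDiffeomorph (𝓡 n) (𝓡 n) ∞ π)
    (hA : IsLocalDiffeomorph (𝓡 n) (𝓡 n) ∞ (PullArrow.arr : G.PullArrow π → G₁))

/-- Trivializations of the ineffective stabilizers at the points `π m`, continuous in `m`,
trivialize the ineffective stabilizers of the pulled back groupoid. -/
theorem exists_ineffTrivOn_pullback {T : Type*} [Group T] {θ : M → T → G₁}
    (hc : ∀ z, Continuous fun m => θ m z)
    (hθ : ∀ m, ∃ (V : Set G₀) (θ' : G₀ → T → G₁), π m ∈ V ∧ G.IneffTrivOn T V θ' ∧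
      θ m = θ' (π m)) :
    ∃ Θ : M → T → G.PullArrow π, (pullback hG hπ hA).IneffTrivOn T Set.univ Θ := by
  have hsrc : ∀ m z, G.src (θ m z) = π m := by
    intro m z
    obtain ⟨V, θ', hV, h, e⟩ := hθ m
    rw [e, h.src _ hV]
  have htgt : ∀ m z, G.tgt (θ m z) = π m := by
    intro m z
    obtain ⟨V, θ', hV, h, e⟩ := hθ m
    rw [e, h.tgt hV]
  let Θ : M → T → G.PullArrow π := fun m z => .mk m (θ m z) m (htgt m z) (hsrc m z)
  refine ⟨Θ, ?_, ?_, ?_, ?_, ?_, ?_⟩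
  · exact fun m _ z => rfl
  · intro m _ z
    refine (isIneffective_pullback_iff hG hπ hA (a := Θ m z) rfl).2 ?_
    obtain ⟨V, θ', hV, h, e⟩ := hθ m
    change G.IsIneffective (θ m z)
    rw [e]
    exact h.ineffective _ hV z
  · intro m _ z w
    obtain ⟨V, θ', hV, h, e⟩ := hθ m
    have h1 : (Θ m z).bot = (Θ m w).top := rfl
    refine PullArrow.ext ?_ ?_ ?_
    · exact (PullArrow.top_comp h1).symm
    · refine Eq.trans ?_ (PullArrow.arr_comp h1).symm
      change θ m (z * w) = G.comp (θ m z) (θ m w)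
      rw [e, h.map_mul _ hV]
    · exact (PullArrow.bot_comp h1).symm
  · intro m _ z w hzw
    obtain ⟨V, θ', hV, h, e⟩ := hθ m
    have h1 : θ m z = θ m w := congrArg PullArrow.arr hzw
    rw [e] at h1
    exact h.injective _ hV h1
  · intro a _ ha
    have h1 : a.top = a.bot := ha.tgt_eq
    have h2 := (isIneffective_pullback_iff hG hπ hA h1.symm).1 ha
    obtain ⟨V, θ', hV, h, e⟩ := hθ a.bot
    obtain ⟨z, hz⟩ := h.surjective a.arr (by rw [a.src_arr]; exact hV) h2
    refine ⟨z, PullArrow.ext h1.symm ?_ rfl⟩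
    change θ a.bot z = a.arr
    rw [e, ← hz, a.src_arr]
  · intro z
    exact (PullArrow.continuous_iff.2 ⟨hc z, continuous_id, continuous_id⟩).continuousOn

end Pull

end SmoothGroupoid

/-! ### Assembly of the theorem -/

open SmoothGroupoid in
open scoped IsMulCommutative in
theorem mainTheorem1 {n : ℕ} {G₀ G₁ : Type u}
    [TopologicalSpace G₀] [ChartedSpace (EuclideanSpace ℝ (Fin n)) G₀] [IsSmoothMfd n G₀]
    [TopologicalSpace G₁] [ChartedSpace (EuclideanSpace ℝ (Fin n)) G₁] [IsSmoothMfd n G₁]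
    (G : SmoothGroupoid (𝓡 n) (𝓡 n) G₀ G₁) (hG : G.IsOrbifold) (hconn : ConnectedSpace G.Coarse)
    (x : G₀) :
    ∃ (d : ℕ) (H₀ H₁ : Type u)
      (_ : TopologicalSpace H₀) (_ : ChartedSpace (EuclideanSpace ℝ (Fin d)) H₀)
      (_ : IsSmoothMfd d H₀)
      (_ : TopologicalSpace H₁) (_ : ChartedSpace (EuclideanSpace ℝ (Fin d)) H₁)
      (_ : IsSmoothMfd d H₁)
      (H : SmoothGroupoid (𝓡 d) (𝓡 d) H₀ H₁)
      (k : ℕ) (K : Type) (_ : Group K)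
      (_ : TopologicalSpace K) (_ : ChartedSpace (EuclideanSpace ℝ (Fin k)) K)
      (_ : LieGroup (𝓡 k) ∞ K) (_ : T2Space K) (_ : CompactSpace K)
      (α : H.GroupAction (𝓡 k) K)
      (A : Type u) (_ : CommGroup A),
      H.IsOrbifold ∧ H.IsPurelyIneffective ∧ H.IsManifoldWithGerbe ∧
      Finite A ∧ H.HasTrivialBand A ∧ Nonempty (A ≃* Subgroup.center (G.IneffStab x)) ∧
      (∀ y : H₀, Nonempty (H.Stab y ≃* Subgroup.center (G.IneffStab x))) ∧
      HSEquivalent (H.semidirect α) G := by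
  have := hG.finite_stab x
  obtain ⟨M, _, _, _, π, χ, θ, hπ, hπs, hχ, hθc, hθ⟩ := hG.exists_cover hconn x
  have : SecondCountableTopology (G.TgtLift π) := TopologicalSpace.Subtype.secondCountableTopology _
  have : SecondCountableTopology (G.PullArrow π) :=
    TopologicalSpace.Subtype.secondCountableTopology _
  obtain ⟨_, _, hA⟩ :=
    (PullArrow.isLocalHomeomorph_arr (G := G) hπ.isLocalHomeomorph).exists_isSmoothMfd (n := n)
  obtain ⟨_, _, hY⟩ : ∃ _ : ChartedSpace (EuclideanSpace ℝ (Fin n)) (G.TgtLift π),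
      IsSmoothMfd n (G.TgtLift π) ∧
      IsLocalDiffeomorph (𝓡 n) (𝓡 n) ∞ (fun b : G.TgtLift π => b.1.1) :=
    IsLocalHomeomorph.exists_isSmoothMfd
      (hπ.isLocalHomeomorph.pullback_fst G.continuous_tgt)
  have hGo := isOrbifold_pullback hπ hA hG
  obtain ⟨Θ, hΘ⟩ := exists_ineffTrivOn_pullback hG.etale hπ hA hθc hθ
  obtain ⟨k, K, _, _, _, _, _, _, _, ρ, ψ, hρ, hker, hψ, hconj, hcen⟩ :=
    hGo.exists_hom_compact_lieGroup hχ hΘ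
  have : IsManifold (𝓡 k) ∞ K := LieGroup.toContMDiffMul.toIsManifold
  obtain ⟨_, _, hM⟩ := exists_isSmoothMfd_prod (n := n) (k := k) M K
  obtain ⟨_, _, hR⟩ := exists_isSmoothMfd_prod (n := n) (k := k) (G.PullArrow π) K
  obtain ⟨_, _, hX⟩ := exists_isSmoothMfd_prod (n := n) (k := k) (G.TgtLift π) K
  have hHo := isOrbifold_actionGroupoid hρ hM hR hGo
  have hHp := isPurelyIneffective_actionGroupoid hGo.etale hρ hM hR hker
  have hHb := hasTrivialBand_actionGroupoid hGo.etale hρ hM hR hker hΘ ψ hψ hconj hcen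
  -- The dimension grows by k, that of `K`, and `A` is taken to be the centre Z(T) itself.
  refine ⟨n + k, M × K, G.PullArrow π × K, inferInstance, inferInstance, inferInstance,
    inferInstance, inferInstance, inferInstance, actionGroupoid hGo.etale hρ hM hR, k, K,
    inferInstance, inferInstance, inferInstance, inferInstance, inferInstance, inferInstance,
    translationAction hGo.etale hρ hM hR, Subgroup.center (G.IneffStab x), inferInstance,
    hHo, hHp, hHo.isManifoldWithGerbe hHp, inferInstance, hHb, ⟨MulEquiv.refl _⟩, ?_, ?_⟩
  · obtain ⟨c⟩ := hHb
    exact c.nonempty_stab_mulEquiv hHp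
  -- The bimodule links H ⋊ K to `G` itself, so the pulled back groupoid need not appear as an
  -- intermediate equivalence.
  · exact ⟨n + k, G.TgtLift π × K, inferInstance, inferInstance, inferInstance,
      ⟨liftEquivalence hG.etale hπ hπs hA hY hρ hM hR hX⟩⟩
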